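/- Let $\mathcal C$ be a real topological vector space, $\mathcal A:\mathcal C\to\mathcal C$ a linear operator, $T>0$, and $c:\mathcal C\to[0,\infty)$ a continuous functional with $c(\lambda H)=|\lambda|c(H)$ for all $\lambda\in\mathbb R$, $H\in\mathcal C$. Let $\mathcal C'$ be the topological dual of $\mathcal C$ with the weak-$\star$ topology; laws on $\mathcal C'$ and on $C([0,T],\mathcal C')$ are laws on the $\sigma$-algebras generated by the evaluations $y\mapsto y(H)$, respectively $y\mapsto y_t(H)$. A random element $\mathcal Y$ of $C([0,T],\mathcal C')$, defined on some probability space, is a solution of the martingale problem $OU(\mathcal C,\mathcal A,c)$ on $[0,T]$ with initial law $\nu_0$ (a law on $\mathcal C'$) if $\mathcal Y_0$ has law $\nu_0$ and, for every $H\in\mathcal C$, the processes $$M_t(H)=\mathcal Y_t(H)-\mathcal Y_0(H)-\int_0^t\mathcal Y_s(\mathcal AH)\,ds,\qquad N_t(H)=M_t(H)^2-t\,c(H)^2,\qquad t\in[0,T],$$ are martingales with respect to the natural filtration $\mathcal F_t=\sigma(\mathcal Y_s(H):s\le t,\ H\in\mathcal C)$. Assume that there is a semigroup $(P_t)_{t\ge0}$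 of continuous linear operators on $\mathcal C$ (so $P_0=\mathrm{Id}$ and $P_{s+t}=P_sP_t$) such that for every $H\in\mathcal C$ $$P_{t+\varepsilon}H-P_tH=\varepsilon\,\mathcal AP_tH+o(\varepsilon,t),$$ where $\varepsilon^{-1}o(\varepsilon,t)\to0$ in $\mathcal C$ as $\varepsilon\downarrow0$, uniformly for $t$ in compact subintervals of $[0,\infty)$. Then: 1. (Uniqueness in law.) Any two solutions of $OU(\mathcal C,\mathcal A,c)$ on $[0,T]$ with the same initial law $\nu_0$, possibly defined on different probability spaces, have the same law on $C([0,T],\mathcal C')$. 2. (Gaussian initial condition.) Suppose that $\nu_0$ is the law of a centred Gaussian field with covariance $\mathfrak E(H,G)$, $H,G\in\mathcal C$, and let $\mathcal Y$ be a solution with initial law $\nu_0$. Then $(\mathcal Y_t(H))_{t\in[0,T],\,H\in\mathcal C}$ is a centred Gaussian process, and for $0\le s\le t\le T$ and $H,G\in\mathcal C$ $$\mathbb E[\mathcal Y_t(H)\mathcal Y_s(G)]=\mathfrak E(P_tH,P_sG)+\int_0^s c(P_{t-r}H,P_{s-r}G)\,dr,\qquad c(H,G):=\tfrac14\big(c(H+G)^2-c(H-G)^2\big).$$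 If moreover $\mathcal Y$ is stationary, in the sense that $\mathcal Y_t$ has law $\nu_0$ for every $t\in[0,T]$, then for $0\le s\le t\le T$ and $H,G\in\mathcal C$ $$\mathbb E[\mathcal Y_t(H)\mathcal Y_s(G)]=\mathfrak E(P_{t-s}H,G).$$ -/

import Mathlib

open MeasureTheory ProbabilityTheory Filter Topology
open scoped NNReal

noncomputable section

namespace OrnsteinUhlenbeck

/-- The cylinder σ-algebra on the topological dual `C'` (with the weak-* topology): the one
generated by the evaluations `y ↦ y H`, `H ∈ C`. -/
instance dualCylinder (C : Type*) [AddCommGroup C] [Module ℝ C] [TopologicalSpace C] :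
    MeasurableSpace (WeakDual ℝ C) :=
  ⨆ H : C, MeasurableSpace.comap (fun y : WeakDual ℝ C => y H) Real.measurableSpace

/-- The space `C([0,T], C')` of paths that are continuous for the weak-* topology of `C'`. -/
abbrev DualPath (T : ℝ) (C : Type*) [AddCommGroup C] [Module ℝ C] [TopologicalSpace C]
    [IsTopologicalAddGroup C] [ContinuousSMul ℝ C] : Type _ :=
  C(Set.Icc (0 : ℝ) T, WeakDual ℝ C)

section

variable {C : Type*} [AddCommGroup C] [Module ℝ C] [TopologicalSpace C]
  [IsTopologicalAddGroup C] [ContinuousSMul ℝ C]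

/-- The cylinder σ-algebra on `C([0,T], C')`, generated by the evaluations `y ↦ y t H`. -/
instance pathCylinder (T : ℝ) : MeasurableSpace (DualPath T C) :=
  ⨆ t : Set.Icc (0 : ℝ) T, ⨆ H : C,
    MeasurableSpace.comap (fun y : DualPath T C => y t H) Real.measurableSpace

/-- The evaluations `y ↦ y t H` are measurable. -/
theorem measurable_path_eval {T : ℝ} (t : Set.Icc (0 : ℝ) T) (H : C) :
    Measurable (fun y : DualPath T C => y t H) := by
  refine measurable_iff_comap_le.2 ?_
  exact le_iSup₂_of_le (f := fun (t : Set.Icc (0 : ℝ) T) (H : C) =>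
    MeasurableSpace.comap (fun y : DualPath T C => y t H) Real.measurableSpace) t H le_rfl

variable {Ω : Type*} [mΩ : MeasurableSpace Ω]

/-- The natural filtration `F_t = σ(Y_s(H) ; s ≤ t, H ∈ C)`, `t ∈ [0,T]`, of a process `Y` with
paths in `C([0,T], C')`. -/
def naturalFiltration {T : ℝ} (Y : Ω → DualPath T C) (hY : Measurable Y) :
    Filtration (Set.Icc (0 : ℝ) T) mΩ where
  seq t := ⨆ s : Set.Icc (0 : ℝ) T, ⨆ _ : s ≤ t, ⨆ H : C,
    MeasurableSpace.comap (fun ω => Y ω s H) Real.measurableSpace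
  mono' := fun _ _ htt' => iSup_mono fun _ =>
    iSup_le fun hs => le_iSup_of_le (hs.trans htt') le_rfl
  le' := fun _ => iSup_le fun s => iSup_le fun _ => iSup_le fun H =>
    ((measurable_path_eval s H).comp hY).comap_le

/-- `M_t(H) = Y_t(H) - Y_0(H) - ∫₀ᵗ Y_s(A H) ds`. The path `s ↦ Y_s(A H)`, continuous on `[0,T]`,
is extended to `ℝ` by constants, which does not affect the integral over `[0,t] ⊆ [0,T]`. -/
def driftMartingale {T : ℝ} (hT : 0 < T) (A : C →ₗ[ℝ] C) (Y : Ω → DualPath T C) (H : C)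
    (t : Set.Icc (0 : ℝ) T) (ω : Ω) : ℝ :=
  Y ω t H - Y ω ⟨0, le_rfl, hT.le⟩ H
    - ∫ s in (0 : ℝ)..(t : ℝ), Y ω (Set.projIcc 0 T hT.le s) (A H)

/-- `N_t(H) = M_t(H)² - t c(H)²`. -/
def bracketMartingale {T : ℝ} (hT : 0 < T) (A : C →ₗ[ℝ] C) (c : C → ℝ) (Y : Ω → DualPath T C)
    (H : C) (t : Set.Icc (0 : ℝ) T) (ω : Ω) : ℝ :=
  driftMartingale hT A Y H t ω ^ 2 - (t : ℝ) * c H ^ 2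

/-- `Y` solves the martingale problem `OU(C, A, c)` on `[0,T]` with initial law `ν₀`: it is a
random element of `C([0,T], C')`, for every `H` the processes `M(H)` and `N(H)` are martingales
for the natural filtration of `Y`, and `Y_0` has law `ν₀`. -/
structure IsSolution {T : ℝ} (hT : 0 < T) (A : C →ₗ[ℝ] C) (c : C → ℝ)
    (ν₀ : Measure (WeakDual ℝ C)) (μ : Measure Ω) (Y : Ω → DualPath T C) : Prop where
  measurable : Measurable Y
  martingale_drift : ∀ H : C,
    Martingale (driftMartingale hT A Y H) (naturalFiltration Y measurable) μ
  martingale_bracket : ∀ H : C,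
    Martingale (bracketMartingale hT A c Y H) (naturalFiltration Y measurable) μ
  initial_law : μ.map (fun ω => Y ω ⟨0, le_rfl, hT.le⟩) = ν₀

/-- `P` is a semigroup of continuous linear operators on `C` associated to `A`:
`P_{t+ε} H - P_t H = ε A P_t H + o(ε,t)`, where `ε⁻¹ o(ε,t) → 0` in `C` as `ε ↓ 0`, uniformly for
`t` in compact intervals. -/
structure IsSemigroupOf (A : C →ₗ[ℝ] C) (P : ℝ≥0 → C →L[ℝ] C) : Prop where
  zero : P 0 = ContinuousLinearMap.id ℝ C
  add : ∀ s t : ℝ≥0, P (s + t) = (P s).comp (P t)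
  expansion : ∀ (H : C) (K : ℝ≥0), ∀ V ∈ 𝓝 (0 : C), ∀ᶠ ε : ℝ≥0 in 𝓝[>] 0, ∀ t ≤ K,
    (ε : ℝ)⁻¹ • (P (t + ε) H - P t H - (ε : ℝ) • A (P t H)) ∈ V

/-- A law on `C'` is that of a centred Gaussian field with covariance `𝔈`. -/
structure IsCentredGaussianField (𝔈 : C → C → ℝ) (ν₀ : Measure (WeakDual ℝ C)) : Prop where
  gaussian : IsGaussianProcess (fun (H : C) (y : WeakDual ℝ C) => y H) ν₀
  centred : ∀ H : C, ∫ y : WeakDual ℝ C, y H ∂ν₀ = 0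
  covariance : ∀ H G : C, ∫ y : WeakDual ℝ C, y H * y G ∂ν₀ = 𝔈 H G

/-- The polarization `c(H,G) = (c(H+G)² - c(H-G)²) / 4` of `c²`. -/
def polar (c : C → ℝ) (H G : C) : ℝ := (c (H + G) ^ 2 - c (H - G) ^ 2) / 4

end

end OrnsteinUhlenbeck

end

/-! Write M(G) for the drift martingale tested against G. Formally d[Y_r(P_{t-r}H)] =
dM_r(P_{t-r}H): the drift Y_r(AP_{t-r}H) dr cancels the derivative of the semigroup. So Y_t(H) -
Y_s(P_{t-s}H) is a stochastic convolution, a limit of sums of increments of M tested against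
deterministic vectors P_{t-r}H frozen on short intervals. Each M(G) is continuous with bracket t
c(G)², hence by Lévy's characterization (`integral_exp_mul`) its increments are Gaussian and
independent of the past. In the limit, given the past up to s, Y_t(H) has conditional characteristic
function exp(i Y_s(P_{t-s}H) - ½∫₀^{t-s} c(P_uH)² du) (`integral_exp_apply`). Removing the latest
time repeatedly expresses every finite-dimensional law through ν₀. This gives uniqueness,
Gaussianity, and the covariance by polarization.

The difficulty is that C is an arbitrary topological vector space: (r,u) ↦ y_r(P_uH) is only
separately continuous, so the formal chain rule is not available. Two devices replace it.

First, the noise is regular in u. Doob's inequality gives E‖M(G)‖² ≤ 4T c(G)² in sup norm, and c is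
a continuous seminorm because √T c(G) is the L² norm of M_T(G). Almost surely, u ↦ M(P_uH) therefore
agrees on the dyadics with a C³ curve of paths (`ae_exists_smooth`), and the convolution can be
defined path by path through integration by parts (`noiseConvolution`).

Second, subtracting this convolution from Y_{s+r}(P_uH) leaves a separately continuous solution of
∂_r f = ∂_u f. A Baire category argument shows that such a solution is constant along
characteristics (`TransportFamily.apply_eq`). -/

namespace OrnsteinUhlenbeck

/-! ### Transport equation: the case of bounded derivatives. -/

open Set

/-- A family `f k r u`, `0 ≤ r ≤ L`, `u ≥ 0`, of separately continuous functions where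
`f (k + 1)` is the `u`-derivative of `f k` for `k < 2` and which satisfies the transport equation
`∂_r f 0 = ∂_u f 0` in integrated form for `u` in a dense set `D`. -/
structure TransportFamily (K L : ℝ) (D : Set ℝ) (f : ℕ → ℝ → ℝ → ℝ) : Prop where
  cont_time : ∀ k u, Continuous fun r => f k r u
  cont_space : ∀ k r, Continuous (f k r)
  deriv : ∀ k < 2, ∀ r u, 0 ≤ u → HasDerivWithinAt (f k r) (f (k + 1) r u) (Ici u) u
  eq : ∀ u ∈ D, ∀ r ∈ Icc 0 L, f 0 r u - f 0 0 u = ∫ v in (0 : ℝ)..r, f 1 v u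
  dense : ∀ u, 0 ≤ u → u < K → ∀ ε > 0, ∃ d ∈ D, u ≤ d ∧ d < u + ε

/-- `f 0` is constant along the characteristics from time `a` to time `b`. -/
def Transports (K : ℝ) (f : ℕ → ℝ → ℝ → ℝ) (a b : ℝ) : Prop :=
  ∀ u, 0 ≤ u → u < K - b → f 0 b u = f 0 a (b - a + u)

namespace TransportFamily

variable {K L : ℝ} {D : Set ℝ} {f : ℕ → ℝ → ℝ → ℝ}

/-- The equation is known only for `u ∈ D`. Approximating `u` from the right by points of `D`, the
bound `M` supplies the domination that separate continuity alone does not give. -/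
theorem sub_eq_integral (h : TransportFamily K L D f) {a b M : ℝ} (ha : 0 ≤ a) (hab : a ≤ b)
    (hb : b ≤ L) (hM : ∀ r ∈ Icc a b, ∀ u, 0 ≤ u → u < K - r → |f 1 r u| ≤ M) {u : ℝ} (hu : 0 ≤ u)
    (huK : u < K - b) : f 0 b u - f 0 a u = ∫ v in a..b, f 1 v u := by
  have hD : ∀ n : ℕ, ∃ d ∈ D, u ≤ d ∧ d < u + 1 / ((n : ℝ) + 1) := fun n =>
    h.dense u hu (by linarith) _ (by positivity)
  choose d hdD hud hdu using hD
  have hd : Tendsto d atTop (𝓝 u) := by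
    refine tendsto_of_tendsto_of_tendsto_of_le_of_le tendsto_const_nhds ?_ hud
      (fun n => (hdu n).le)
    simpa using tendsto_const_nhds.add (tendsto_one_div_add_atTop_nhds_zero_nat (𝕜 := ℝ))
  have heq : ∀ n, f 0 b (d n) - f 0 a (d n) = ∫ v in a..b, f 1 v (d n) := by
    intro n
    have h1 := h.eq _ (hdD n) b ⟨ha.trans hab, hb⟩
    have h2 := h.eq _ (hdD n) a ⟨ha, hab.trans hb⟩
    rw [← intervalIntegral.integral_interval_sub_left
      ((h.cont_time 1 _).intervalIntegrable _ _) ((h.cont_time 1 _).intervalIntegrable _ _),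
      ← h1, ← h2]
    ring
  have hl : Tendsto (fun n => f 0 b (d n) - f 0 a (d n)) atTop (𝓝 (f 0 b u - f 0 a u)) :=
    (((h.cont_space 0 b).tendsto u).comp hd).sub (((h.cont_space 0 a).tendsto u).comp hd)
  have hr : Tendsto (fun n => ∫ v in a..b, f 1 v (d n)) atTop (𝓝 (∫ v in a..b, f 1 v u)) := by
    refine intervalIntegral.tendsto_integral_filter_of_dominated_convergence (fun _ => M) ?_ ?_
      intervalIntegrable_const ?_
    · exact Eventually.of_forall fun n => (h.cont_time 1 _).aestronglyMeasurable
    · filter_upwards [hd.eventually (eventually_lt_nhds huK)] with n hn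
      refine Eventually.of_forall fun v hv => ?_
      rw [uIoc_of_le hab] at hv
      exact hM v ⟨hv.1.le, hv.2⟩ _ (hu.trans (hud n)) (by linarith [hv.2])
    · exact Eventually.of_forall fun v _ => ((h.cont_space 1 v).tendsto u).comp hd
  refine tendsto_nhds_unique hl ?_
  simpa only [heq] using hr

theorem abs_sub_le (h : TransportFamily K L D f) {k : ℕ} (hk : k < 2) {r u u' M : ℝ}
    (hu : 0 ≤ u) (huu' : u ≤ u') (hM : ∀ x ∈ Ico u u', |f (k + 1) r x| ≤ M) :
    |f k r u' - f k r u| ≤ M * (u' - u) :=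
  norm_image_sub_le_of_norm_deriv_right_le_segment (h.cont_space k r).continuousOn
    (fun x hx => h.deriv k hk r x (hu.trans hx.1)) hM u' (right_mem_Icc.2 huu')

theorem abs_sub_sub_le (h : TransportFamily K L D f) {r u u' M : ℝ}
    (hu : 0 ≤ u) (huu' : u ≤ u') (hM0 : 0 ≤ M) (hM : ∀ x ∈ Ico u u', |f 2 r x| ≤ M) :
    |f 0 r u' - f 0 r u - (u' - u) * f 1 r u| ≤ M * (u' - u) * (u' - u) := by
  have := norm_image_sub_le_of_norm_deriv_right_le_segment (a := u) (b := u')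
    (f := fun x => f 0 r x - (x - u) * f 1 r u) (f' := fun x => f 1 r x - 1 * f 1 r u)
    (C := M * (u' - u)) ?_ ?_ ?_ u' (right_mem_Icc.2 huu')
  · simp only [sub_self, zero_mul, sub_zero, Real.norm_eq_abs] at this
    convert this using 2
    ring
  · exact ((h.cont_space 0 r).sub (by fun_prop)).continuousOn
  · intro x hx
    exact (h.deriv 0 two_pos r x (hu.trans hx.1)).sub
      ((((hasDerivAt_id x).sub_const u).mul_const _).hasDerivWithinAt)
  · intro x hx
    rw [one_mul, Real.norm_eq_abs]
    exact (h.abs_sub_le one_lt_two hu hx.1 fun y hy => hM y ⟨hy.1, hy.2.trans hx.2⟩).trans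
      (by have := hx.2; gcongr)

/-- Transport along characteristics in a time interval on which the first two derivatives are
bounded. -/
theorem transports_of_bounded (h : TransportFamily K L D f) {a b M : ℝ} (ha : 0 ≤ a)
    (hab : a ≤ b) (hb : b ≤ L) (hM0 : 0 ≤ M)
    (hM : ∀ r ∈ Icc a b, ∀ u, 0 ≤ u → u < K - r → |f 1 r u| ≤ M ∧ |f 2 r u| ≤ M) :
    Transports K f a b := by
  intro u hu huK
  -- The function along the characteristic ending at `(b, u)`. It is Lipschitz with zero right
  -- derivative, hence constant; its increments are split into a time step at a fixed space point
  -- and a space step at a fixed time.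
  set k : ℝ → ℝ := fun x => f 0 (b - x) (u + x) with hk
  have hM1 := fun r hr u hu huK => (hM r hr u hu huK).1
  have htime : ∀ x y, 0 ≤ x → x ≤ y → y ≤ b - a →
      f 0 (b - x) (u + x) - f 0 (b - y) (u + x) = ∫ v in (b - y)..(b - x), f 1 v (u + x) := by
    intro x y hx hxy hy
    exact h.sub_eq_integral (by linarith) (by linarith) (by linarith)
      (fun r hr => hM1 r ⟨by linarith [hr.1], by linarith [hr.2]⟩) (by linarith) (by linarith)
  have hlip : ∀ x y, 0 ≤ x → x ≤ y → y ≤ b - a → |k y - k x| ≤ 2 * M * |y - x| := by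
    intro x y hx hxy hy
    have h1 : |f 0 (b - y) (u + y) - f 0 (b - y) (u + x)| ≤ M * (y - x) := by
      refine (h.abs_sub_le (M := M) two_pos (by linarith) (by linarith) fun z hz =>
        ?_).trans_eq (by ring)
      exact hM1 _ ⟨by linarith, by linarith⟩ z (by linarith [hz.1]) (by linarith [hz.2])
    have h2 : |f 0 (b - x) (u + x) - f 0 (b - y) (u + x)| ≤ M * (y - x) := by
      rw [htime x y hx hxy hy]
      refine (intervalIntegral.norm_integral_le_of_norm_le_const (a := b - y) (b := b - x) (C := M)
        (f := fun v => f 1 v (u + x)) fun v hv => ?_).trans_eq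
        (by rw [sub_sub_sub_cancel_left, abs_of_nonneg (sub_nonneg.2 hxy)])
      rw [uIoc_of_le (by linarith)] at hv
      exact hM1 v ⟨by linarith [hv.1], by linarith [hv.2]⟩ _ (by linarith) (by linarith [hv.2])
    rw [abs_of_nonneg (by linarith : 0 ≤ y - x)]
    have : k y - k x = (f 0 (b - y) (u + y) - f 0 (b - y) (u + x))
      - (f 0 (b - x) (u + x) - f 0 (b - y) (u + x)) := by simp only [hk]; ring
    rw [this]
    exact (abs_sub _ _).trans (by linarith)
  have hcont : ContinuousOn k (Icc 0 (b - a)) := by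
    refine (LipschitzOnWith.of_dist_le_mul (K := (2 * M).toNNReal) fun x hx y hy => ?_).continuousOn
    rw [Real.coe_toNNReal _ (by linarith), Real.dist_eq, Real.dist_eq]
    rcases le_total x y with hxy | hxy
    · rw [abs_sub_comm, abs_sub_comm x]
      exact hlip x y hx.1 hxy hy.2
    · exact hlip y x hy.1 hxy hx.2
  have hder : ∀ x ∈ Ico 0 (b - a), HasDerivWithinAt k 0 (Ici x) x := by
    intro x hx
    have hB : HasDerivWithinAt (fun y => f 0 (b - y) (u + x)) (-f 1 (b - x) (u + x)) (Ici x) x := by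
      have hI : HasDerivAt (fun y => f 0 (b - x) (u + x) - ∫ v in (b - y)..(b - x), f 1 v (u + x))
          (-f 1 (b - x) (u + x)) x := by
        have h1 := intervalIntegral.integral_hasDerivAt_left
          ((h.cont_time 1 (u + x)).intervalIntegrable (b - x) (b - x))
          ((h.cont_time 1 (u + x)).stronglyMeasurableAtFilter _ _)
          (h.cont_time 1 (u + x)).continuousAt
        have h2 := (h1.comp x ((hasDerivAt_id x).const_sub b)).const_sub (f 0 (b - x) (u + x))
        simpa using h2
      refine hI.hasDerivWithinAt.congr_of_eventuallyEq ?_ (by simp)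
      filter_upwards [self_mem_nhdsWithin, mem_nhdsWithin_of_mem_nhds (Iio_mem_nhds hx.2)]
        with y hy1 hy2
      rw [← htime x y hx.1 hy1 (le_of_lt hy2)]
      ring
    -- The space increment is taken at the moving time `b - y`, so differentiability at one time is
    -- not enough: the bound on `f 2` makes the Taylor remainder uniform in time.
    have hA : HasDerivWithinAt (fun y => f 0 (b - y) (u + y) - f 0 (b - y) (u + x))
        (f 1 (b - x) (u + x)) (Ici x) x := by
      rw [← hasDerivWithinAt_Ioi_iff_Ici, hasDerivWithinAt_iff_tendsto_slope' self_notMem_Ioi]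
      have h1 : Tendsto (fun y => f 1 (b - y) (u + x)) (𝓝[>] x) (𝓝 (f 1 (b - x) (u + x))) :=
        (((h.cont_time 1 (u + x)).comp (continuous_const.sub continuous_id)).tendsto x).mono_left
          nhdsWithin_le_nhds
      have h2 : Tendsto (fun y => M * (y - x)) (𝓝[>] x) (𝓝 0) := by
        have : Continuous fun y => M * (y - x) := by fun_prop
        simpa using (this.tendsto x).mono_left nhdsWithin_le_nhds
      rw [tendsto_iff_norm_sub_tendsto_zero] at h1 ⊢
      refine squeeze_zero' (Eventually.of_forall fun _ => norm_nonneg _) ?_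
        (by simpa using h1.add h2)
      filter_upwards [self_mem_nhdsWithin, mem_nhdsWithin_of_mem_nhds (Iio_mem_nhds hx.2)]
        with y hy1 hy2
      have hxy : 0 < y - x := sub_pos.2 hy1
      have hx0 := hx.1
      have hy2' : y < b - a := hy2
      have key := h.abs_sub_sub_le (r := b - y) (u := u + x) (u' := u + y) (M := M)
        (by linarith) (by linarith) hM0 fun z hz =>
          (hM (b - y) ⟨by linarith, by linarith⟩ z (by linarith [hz.1]) (by linarith [hz.2])).2
      have hs : slope (fun y => f 0 (b - y) (u + y) - f 0 (b - y) (u + x)) x y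
          - f 1 (b - y) (u + x) = (y - x)⁻¹ * (f 0 (b - y) (u + y) - f 0 (b - y) (u + x)
            - (u + y - (u + x)) * f 1 (b - y) (u + x)) := by
        rw [slope_def_field]
        field_simp
        ring
      have hs' : |slope (fun y => f 0 (b - y) (u + y) - f 0 (b - y) (u + x)) x y
          - f 1 (b - y) (u + x)| ≤ M * (y - x) := by
        rw [hs, abs_mul, abs_of_pos (inv_pos.2 hxy), inv_mul_le_iff₀ hxy]
        refine key.trans_eq ?_
        ring
      calc _ ≤ |slope (fun y => f 0 (b - y) (u + y) - f 0 (b - y) (u + x)) x y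
            - f 1 (b - y) (u + x)| + |f 1 (b - y) (u + x) - f 1 (b - x) (u + x)| :=
            _root_.abs_sub_le _ _ _
        _ ≤ _ := by rw [add_comm]; gcongr
    have := hA.add hB
    rw [add_neg_cancel] at this
    refine this.congr_of_eventuallyEq (Eventually.of_forall fun y => ?_) ?_ <;> simp [hk]
  have := constant_of_has_deriv_right_zero hcont hder (b - a) ⟨by linarith, le_rfl⟩
  simp only [hk, sub_sub_cancel, sub_zero, add_zero] at this
  rw [← this, add_comm]

end TransportFamily

end OrnsteinUhlenbeck

/-! ### Transport equation: removing the bounds by Baire category. -/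

namespace OrnsteinUhlenbeck

open Set

/-- Transport along characteristics holds near the time `s`, inside `[0, L]`. -/
def TransportsNear (K L : ℝ) (f : ℕ → ℝ → ℝ → ℝ) (s : ℝ) : Prop :=
  ∃ δ > 0, ∀ a b, 0 ≤ a → s - δ < a → a ≤ b → b < s + δ → b ≤ L → Transports K f a b

theorem Transports.refl (K : ℝ) (f : ℕ → ℝ → ℝ → ℝ) (a : ℝ) : Transports K f a a := by
  intro u _ _
  simp

theorem Transports.trans {K : ℝ} {f : ℕ → ℝ → ℝ → ℝ} {a b c : ℝ} (hab : Transports K f a b)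
    (hbc : Transports K f b c) (hle : b ≤ c) : Transports K f a c := by
  intro u hu huK
  rw [hbc u hu huK, hab (c - b + u) (by linarith) (by linarith)]
  congr 1
  ring

theorem isOpen_setOf_transportsNear (K L : ℝ) (f : ℕ → ℝ → ℝ → ℝ) :
    IsOpen {s | TransportsNear K L f s} := by
  rw [Metric.isOpen_iff]
  rintro s ⟨δ, hδ, h⟩
  refine ⟨δ / 2, half_pos hδ, fun x hx => ⟨δ / 2, half_pos hδ, fun a b ha hxa hab hbx hb => ?_⟩⟩
  rw [Metric.mem_ball, Real.dist_eq, abs_lt] at hx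
  exact h a b ha (by linarith [hx.1]) hab (by linarith [hx.2]) hb

namespace TransportFamily

variable {K L : ℝ} {D : Set ℝ} {f : ℕ → ℝ → ℝ → ℝ}

/-- The inequality `u < K - b` is strict, so it persists at nearby end times, and separate
continuity suffices for the limit. -/
theorem isClosed_setOf_transports (h : TransportFamily K L D f) (a : ℝ) :
    IsClosed {b | Transports K f a b} := by
  refine isClosed_of_closure_subset fun b hb u hu huK => ?_
  have hcl : IsClosed {x | f 0 x u = f 0 a (x - a + u)} :=
    isClosed_eq (h.cont_time 0 u) ((h.cont_space 0 a).comp (by fun_prop))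
  refine hcl.mem_of_frequently_of_tendsto ?_ tendsto_id
  refine ((mem_closure_iff_frequently.1 hb).and_eventually
    (eventually_lt_nhds (show b < K - u by linarith))).mono fun x hx => ?_
  exact hx.1 u hu (by linarith [hx.2])

/-- Transport from `x` is evaluated at the moving point `x - a + u`, so that the characteristic
meets time `x` at the fixed point `b - a + u`. Each side then varies in one variable only as `x`
decreases to `a`. -/
theorem transports_of_forall_gt (h : TransportFamily K L D f) {a b : ℝ} (hab : a < b)
    (hx : ∀ x, a < x → x ≤ b → Transports K f x b) : Transports K f a b := by
  intro u hu huK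
  have hcl : IsClosed {x | f 0 b (x - a + u) = f 0 x (b - a + u)} :=
    isClosed_eq ((h.cont_space 0 b).comp (by fun_prop)) (h.cont_time 0 _)
  have := hcl.mem_of_frequently_of_tendsto (b := 𝓝[>] a) (f := id) (x := a) ?_
    (tendsto_id.mono_left nhdsWithin_le_nhds)
  · simpa using this
  refine Eventually.frequently ?_
  filter_upwards [self_mem_nhdsWithin, mem_nhdsWithin_of_mem_nhds (Iio_mem_nhds hab),
    mem_nhdsWithin_of_mem_nhds (Iio_mem_nhds (show a < K - b - u + a by linarith))]
    with x hx1 hx2 hx3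
  have hx1' : a < x := hx1
  have hx3' : x < K - b - u + a := hx3
  have := hx x hx1' (le_of_lt hx2) (x - a + u) (by linarith) (by linarith)
  simp only [id]
  rw [this]
  congr 1
  ring

/-- Continuous induction: the end times reachable from `a` form a closed set, and local transport
extends it beyond each of its points before `b`. -/
theorem transports_of_forall_near (h : TransportFamily K L D f) {a b : ℝ} (ha : 0 ≤ a)
    (hab : a ≤ b) (hb : b ≤ L) (hs : ∀ s ∈ Icc a b, TransportsNear K L f s) :
    Transports K f a b := by
  have := IsClosed.Icc_subset_of_forall_exists_gt (a := a) (b := b)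
    ((h.isClosed_setOf_transports a).inter isClosed_Icc) (Transports.refl K f a) ?_
  · exact this (right_mem_Icc.2 hab)
  rintro x ⟨hx, hax, hxb⟩ y hy
  obtain ⟨δ, hδ, hnear⟩ := hs x ⟨hax, hxb.le⟩
  have hxy : x < y := hy
  refine ⟨min (min y b) (x + δ / 2), ?_, ?_, (min_le_left _ _).trans (min_le_left _ _)⟩
  · have hle : x ≤ min (min y b) (x + δ / 2) :=
      le_min (le_min hxy.le hxb.le) (by linarith)
    have h1 : min (min y b) (x + δ / 2) ≤ x + δ / 2 := min_le_right _ _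
    have h2 : min (min y b) (x + δ / 2) ≤ b := (min_le_left _ _).trans (min_le_right _ _)
    exact hx.trans (hnear _ _ (ha.trans hax) (by linarith) hle (by linarith) (by linarith)) hle
  · exact lt_min (lt_min hxy hxb) (by linarith)

/-- Differentiating the transport identity in `u` carries bounds on `f 1` and `f 2` from time `a` to
time `b`. -/
theorem deriv_eq_of_eq (h : TransportFamily K L D f) {k : ℕ} (hk : k < 2) {a b : ℝ} (hab : a ≤ b)
    (he : ∀ u, 0 ≤ u → u < K - b → f k b u = f k a (b - a + u)) :
    ∀ u, 0 ≤ u → u < K - b → f (k + 1) b u = f (k + 1) a (b - a + u) := by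
  intro u hu huK
  have h1 := h.deriv k hk b u hu
  have h2 : HasDerivWithinAt (fun x => f k a (b - a + x)) (f (k + 1) a (b - a + u)) (Ici u) u := by
    have h3 := (h.deriv k hk a (b - a + u) (by linarith)).scomp u (h := fun x => b - a + x)
      (s := Ici u) (((hasDerivAt_id u).const_add (b - a)).hasDerivWithinAt)
      (fun x hx => by simpa using hx)
    rw [one_smul] at h3
    exact h3
  refine (uniqueDiffWithinAt_Ici u).eq_deriv _ h1 (h2.congr_of_eventuallyEq ?_ (he u hu huK))
  filter_upwards [self_mem_nhdsWithin, mem_nhdsWithin_of_mem_nhds (Iio_mem_nhds huK)] with x hx hx'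
  exact he x (hu.trans hx) hx'

theorem isClosed_setOf_bounded (h : TransportFamily K L D f) (M : ℝ) :
    IsClosed {r | ∀ u, 0 ≤ u → u < K - r → |f 1 r u| ≤ M ∧ |f 2 r u| ≤ M} := by
  refine isClosed_of_closure_subset fun b hb u hu huK => ?_
  have hcl : IsClosed {x | |f 1 x u| ≤ M ∧ |f 2 x u| ≤ M} :=
    (isClosed_le (h.cont_time 1 u).abs continuous_const).inter
      (isClosed_le (h.cont_time 2 u).abs continuous_const)
  refine hcl.mem_of_frequently_of_tendsto ?_ tendsto_id
  refine ((mem_closure_iff_frequently.1 hb).and_eventually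
    (eventually_lt_nhds (show b < K - u by linarith))).mono fun x hx => ?_
  exact hx.1 u hu (by linarith [hx.2])

theorem exists_bound (h : TransportFamily K L D f) (r : ℝ) :
    ∃ n : ℕ, ∀ u, 0 ≤ u → u < K - r → |f 1 r u| ≤ n ∧ |f 2 r u| ≤ n := by
  obtain ⟨M, hM⟩ := isCompact_Icc.exists_bound_of_continuousOn (s := Icc 0 (K - r))
    (h.cont_space 1 r).continuousOn
  obtain ⟨M', hM'⟩ := isCompact_Icc.exists_bound_of_continuousOn (s := Icc 0 (K - r))
    (h.cont_space 2 r).continuousOn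
  obtain ⟨n, hn⟩ := exists_nat_ge (max M M')
  exact ⟨n, fun u hu huK =>
    ⟨(hM u ⟨hu, huK.le⟩).trans ((le_max_left _ _).trans hn),
      (hM' u ⟨hu, huK.le⟩).trans ((le_max_right _ _).trans hn)⟩⟩

/-- Transport holds near `q` if the first two derivatives are bounded by the same constant at all
exceptional times near `q`. -/
theorem transportsNear_of_bounded (h : TransportFamily K L D f) {q δ M : ℝ} (hδ : 0 < δ)
    (hM0 : 0 ≤ M)
    (hM : ∀ s ∈ Icc 0 L, ¬ TransportsNear K L f s → |s - q| < δ →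
      ∀ u, 0 ≤ u → u < K - s → |f 1 s u| ≤ M ∧ |f 2 s u| ≤ M) :
    TransportsNear K L f q := by
  refine ⟨δ, hδ, fun a b ha hqa hab hbq hb => ?_⟩
  set Q : Set ℝ := {s | ¬ TransportsNear K L f s} with hQ
  have hQc : IsClosed Q := (isOpen_setOf_transportsNear K L f).isClosed_compl
  rcases (Icc a b ∩ Q).eq_empty_or_nonempty with hem | hne
  · refine h.transports_of_forall_near ha hab hb fun s hs => ?_
    by_contra hcon
    exact (Set.eq_empty_iff_forall_notMem.1 hem) s ⟨hs, hcon⟩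
  -- The first exceptional time. Before it, local transport and a limit suffice; after it, bounded
  -- derivatives will be used.
  set q₁ := sInf (Icc a b ∩ Q) with hq₁
  have hq₁m : q₁ ∈ Icc a b ∩ Q := (isCompact_Icc.inter_right hQc).sInf_mem hne
  have hleft : Transports K f a q₁ := by
    rcases hq₁m.1.1.eq_or_lt with heq | hlt
    · rw [← heq]
      exact Transports.refl K f a
    refine (h.isClosed_setOf_transports a).mem_of_frequently_of_tendsto (b := 𝓝[<] q₁) (f := id)
      (Eventually.frequently ?_) (tendsto_id.mono_left nhdsWithin_le_nhds)
    filter_upwards [self_mem_nhdsWithin, mem_nhdsWithin_of_mem_nhds (Ioi_mem_nhds hlt)]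
      with x hx1 hx2
    have hx1' : x < q₁ := hx1
    refine h.transports_of_forall_near (b := x) ha (le_of_lt hx2) (by linarith [hq₁m.1.2])
      fun s hs => ?_
    by_contra hcon
    have hsm : s ∈ Icc a b ∩ Q := ⟨⟨hs.1, by linarith [hs.2, hq₁m.1.2]⟩, hcon⟩
    linarith [csInf_le (isCompact_Icc.inter_right hQc).bddBelow hsm, hs.2]
  refine hleft.trans (h.transports_of_bounded (M := M) (ha.trans hq₁m.1.1) hq₁m.1.2 hb hM0
    fun r hr => ?_) hq₁m.1.2
  have hrne : (Icc q₁ r ∩ Q).Nonempty := ⟨q₁, ⟨le_rfl, hr.1⟩, hq₁m.2⟩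
  -- The last exceptional time up to `r`. There is none in `(p, r]`, so transport from `p` to `r`
  -- holds and brings the bound `M` from `p` to `r`.
  set p := sSup (Icc q₁ r ∩ Q) with hp
  have hpm : p ∈ Icc q₁ r ∩ Q := (isCompact_Icc.inter_right hQc).sSup_mem hrne
  have hap : a ≤ p := hq₁m.1.1.trans hpm.1.1
  have hpb : p ≤ b := hpm.1.2.trans hr.2
  have hpM := hM p ⟨ha.trans hap, hpb.trans hb⟩ hpm.2 (by rw [abs_lt]; constructor <;> linarith)
  have hpr : Transports K f p r := by
    rcases hpm.1.2.eq_or_lt with heq | hlt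
    · rw [heq]
      exact Transports.refl K f r
    refine h.transports_of_forall_gt hlt fun x hx1 hx2 =>
      h.transports_of_forall_near (by linarith) hx2 (hr.2.trans hb) fun s hs => ?_
    by_contra hcon
    have hsm : s ∈ Icc q₁ r ∩ Q := ⟨⟨by linarith [hs.1, hpm.1.1], hs.2⟩, hcon⟩
    linarith [le_csSup (isCompact_Icc.inter_right hQc).bddAbove hsm, hs.1]
  have h1 := h.deriv_eq_of_eq two_pos hpm.1.2 hpr
  have h2 := h.deriv_eq_of_eq one_lt_two hpm.1.2 h1
  intro u hu huK
  have hpr' := hpm.1.2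
  rw [h1 u hu huK, h2 u hu huK]
  exact hpM _ (by linarith) (by linarith)

/-- Exceptional times would form a complete metric space, covered by the closed sets of times at
which both derivatives are bounded by `n`. By Baire one of these has interior; around an interior
point the bound is uniform over exceptional times, so that point is not exceptional. -/
theorem transportsNear (h : TransportFamily K L D f) {s : ℝ} (hs : s ∈ Icc 0 L) :
    TransportsNear K L f s := by
  by_contra hcon
  set Q : Set ℝ := Icc 0 L ∩ {s | ¬ TransportsNear K L f s} with hQ
  have hQc : IsClosed Q :=
    isClosed_Icc.inter (isOpen_setOf_transportsNear K L f).isClosed_compl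
  have : CompleteSpace Q := hQc.completeSpace_coe
  have : Nonempty Q := ⟨⟨s, hs, hcon⟩⟩
  obtain ⟨n, q, hq⟩ := nonempty_interior_of_iUnion_of_closed
    (f := fun n : ℕ => ((↑) : Q → ℝ) ⁻¹'
      {r | ∀ u, 0 ≤ u → u < K - r → |f 1 r u| ≤ n ∧ |f 2 r u| ≤ n})
    (fun n => (h.isClosed_setOf_bounded n).preimage continuous_subtype_val)
    (Set.eq_univ_of_forall fun r => mem_iUnion.2 (h.exists_bound r))
  rw [mem_interior_iff_mem_nhds, Metric.mem_nhds_iff] at hq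
  obtain ⟨δ, hδ, hball⟩ := hq
  refine q.2.2 (h.transportsNear_of_bounded hδ n.cast_nonneg fun x hx hxn hxq => ?_)
  have hmem : (⟨x, hx, hxn⟩ : Q) ∈ Metric.ball q δ := by
    rw [Metric.mem_ball, Subtype.dist_eq, Real.dist_eq]
    exact hxq
  exact hball hmem

/-- A separately continuous solution of the transport equation is constant along
characteristics. -/
theorem apply_eq (h : TransportFamily K L D f) (hL : 0 ≤ L) (hLK : L < K) :
    f 0 L 0 = f 0 0 L := by
  have := h.transports_of_forall_near le_rfl hL le_rfl (fun s hs => h.transportsNear hs) 0 le_rfl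
    (by linarith)
  simpa using this

end TransportFamily

end OrnsteinUhlenbeck

/-! ### Regularity of the semigroup orbits. -/

namespace OrnsteinUhlenbeck

section Semigroup

variable {C : Type*} [AddCommGroup C] [Module ℝ C] [TopologicalSpace C]
  [IsTopologicalAddGroup C] [ContinuousSMul ℝ C]

omit [Module ℝ C] [ContinuousSMul ℝ C] in
-- Uniformity in the base point turns right increments into two-sided continuity: for `t < t₀` the
-- increment is based at `t`. The symmetric neighbourhood `V ∩ -V` absorbs the sign.
theorem continuous_of_forall_eventually_sub_mem {f : ℝ≥0 → C}
    (hf : ∀ K : ℝ≥0, ∀ V ∈ 𝓝 (0 : C), ∀ᶠ δ : ℝ≥0 in 𝓝[>] 0, ∀ t ≤ K, f (t + δ) - f t ∈ V) :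
    Continuous f := by
  rw [continuous_iff_continuousAt]
  intro t₀
  rw [ContinuousAt, ← tendsto_sub_nhds_zero_iff]
  intro V hV
  have hV' : V ∩ -V ∈ 𝓝 (0 : C) := inter_mem hV (neg_mem_nhds_zero C hV)
  have h := hf (t₀ + 1) _ hV'
  obtain ⟨δ, hδ, hsub⟩ := (mem_nhdsGT_iff_exists_Ioo_subset).1 h
  have hδ' : 0 < δ := hδ
  have h1 : Metric.ball t₀ (min δ 1 : ℝ≥0) ∈ 𝓝 t₀ :=
    Metric.ball_mem_nhds _ (by exact_mod_cast lt_min hδ' one_pos)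
  rw [Filter.mem_map]
  filter_upwards [h1] with t ht
  rw [Metric.mem_ball, NNReal.dist_eq, NNReal.coe_min] at ht
  have ht1 := ht.trans_le (min_le_left _ _)
  have ht2 := ht.trans_le (min_le_right _ _)
  rw [abs_lt] at ht1 ht2
  rcases lt_trichotomy t t₀ with hlt | heq | hgt
  · have hd : t₀ - t ∈ Set.Ioo 0 δ := by
      refine ⟨tsub_pos_of_lt hlt, ?_⟩
      rw [← NNReal.coe_lt_coe, NNReal.coe_sub hlt.le]
      linarith [ht1.1]
    have := (hsub hd t (hlt.le.trans (by simp))).2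
    rw [add_tsub_cancel_of_le hlt.le, Set.mem_neg, neg_sub] at this
    exact this
  · simpa [heq] using mem_of_mem_nhds hV
  · have hd : t - t₀ ∈ Set.Ioo 0 δ := by
      refine ⟨tsub_pos_of_lt hgt, ?_⟩
      rw [← NNReal.coe_lt_coe, NNReal.coe_sub hgt.le]
      linarith [ht1.2]
    have := (hsub hd t₀ (by simp)).1
    rw [add_tsub_cancel_of_le hgt.le] at this
    exact this

namespace IsSemigroupOf

variable {A : C →ₗ[ℝ] C} {P : ℝ≥0 → C →L[ℝ] C}

/-- `A` is not assumed continuous. With R the normalised remainder, one step of length 2δ is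
compared with two steps of length δ: the values of P cancel in 2R(2δ,t) - R(δ,t) - R(δ,t+δ), which
leaves AP_{t+δ}H - AP_tH. -/
theorem continuous_generator (hP : IsSemigroupOf A P) (H : C) :
    Continuous fun t : ℝ≥0 => A (P t H) := by
  refine continuous_of_forall_eventually_sub_mem fun K V hV => ?_
  have hcont : Continuous fun p : C × C × C => (2 : ℝ) • p.1 - p.2.1 - p.2.2 := by fun_prop
  have hpre := hcont.tendsto 0
  simp only [Prod.fst_zero, smul_zero, Prod.snd_zero, sub_zero] at hpre
  have hmem := hpre hV
  rw [Filter.mem_map, show (0 : C × C × C) = (0, 0, 0) from rfl, nhds_prod_eq, nhds_prod_eq,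
    Filter.mem_prod_iff] at hmem
  obtain ⟨W₁, hW₁, W₂, hW₂, hsub⟩ := hmem
  rw [Filter.mem_prod_iff] at hW₂
  obtain ⟨W₃, hW₃, W₄, hW₄, hsub'⟩ := hW₂
  have h2 : Tendsto (fun δ : ℝ≥0 => 2 * δ) (𝓝[>] 0) (𝓝[>] 0) := by
    refine tendsto_nhdsWithin_iff.2 ⟨?_, ?_⟩
    · have : Continuous fun δ : ℝ≥0 => 2 * δ := by fun_prop
      simpa using (this.tendsto 0).mono_left nhdsWithin_le_nhds
    · filter_upwards [self_mem_nhdsWithin] with δ hδ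
      exact mul_pos two_pos (Set.mem_Ioi.1 hδ)
  filter_upwards [h2.eventually (hP.expansion H K W₁ hW₁), hP.expansion H K W₃ hW₃,
    hP.expansion H (K + 1) W₄ hW₄, self_mem_nhdsWithin,
    mem_nhdsWithin_of_mem_nhds (Iio_mem_nhds one_pos)] with δ h₁ h₃ h₄ hδ hδ1 t ht
  have := @hsub (_, _, _) ⟨h₁ t ht, @hsub' (_, _) ⟨h₃ t ht, h₄ (t + δ)
    (add_le_add ht (le_of_lt hδ1))⟩⟩
  rw [Set.mem_preimage] at this
  convert this using 1
  have hδ0 : (δ : ℝ) ≠ 0 := by exact_mod_cast (ne_of_gt hδ)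
  have e : t + 2 * δ = t + δ + δ := by ring
  rw [e]
  push_cast
  match_scalars <;> field_simp <;> norm_num

/-- The increment is ε(AP_tH + R(ε,t)), with R the normalised remainder. The first term is uniformly
small on compacts by continuity of t ↦ AP_tH. -/
theorem continuous_apply (hP : IsSemigroupOf A P) (H : C) : Continuous fun t : ℝ≥0 => P t H := by
  refine continuous_of_forall_eventually_sub_mem fun K V hV => ?_
  have hadd : Tendsto (fun p : C × C => p.1 + p.2) (𝓝 0 ×ˢ 𝓝 0) (𝓝 0) := by
    rw [← nhds_prod_eq]
    simpa using (continuous_add (M := C)).tendsto (0, 0)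
  obtain ⟨W₁, hW₁, W₂, hW₂, hsub⟩ := Filter.mem_prod_iff.1 (hadd hV)
  have hc : Continuous fun p : ℝ≥0 × ℝ≥0 => (p.1 : ℝ) • A (P p.2 H) :=
    (NNReal.continuous_coe.comp continuous_fst).smul
      ((hP.continuous_generator H).comp continuous_snd)
  have hsm : Continuous fun p : ℝ≥0 × C => (p.1 : ℝ) • p.2 :=
    (NNReal.continuous_coe.comp continuous_fst).smul continuous_snd
  have h1 : ∀ᶠ ε : ℝ≥0 in 𝓝 0, ∀ t ∈ Set.Icc 0 K, (ε : ℝ) • A (P t H) ∈ W₁ := by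
    refine isCompact_Icc.eventually_forall_of_forall_eventually fun t _ => ?_
    have := hc.tendsto (0, t)
    simp only [NNReal.coe_zero, zero_smul] at this
    exact this hW₁
  have h2 : ∀ᶠ p : ℝ≥0 × C in 𝓝 0 ×ˢ 𝓝 0, (p.1 : ℝ) • p.2 ∈ W₂ := by
    rw [← nhds_prod_eq]
    have := hsm.tendsto (0, 0)
    simp only [NNReal.coe_zero, zero_smul] at this
    exact this hW₂
  obtain ⟨U, hU, U', hU', hUsub⟩ := Filter.mem_prod_iff.1 h2
  filter_upwards [nhdsWithin_le_nhds h1, nhdsWithin_le_nhds hU, hP.expansion H K U' hU',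
    self_mem_nhdsWithin] with ε hε₁ hε₂ hε₃ hε t ht
  have := @hsub (_, _) ⟨hε₁ t ⟨zero_le, ht⟩, @hUsub (_, _) ⟨hε₂, hε₃ t ht⟩⟩
  rw [Set.mem_preimage] at this
  convert this using 1
  have hε0 : (ε : ℝ) ≠ 0 := by exact_mod_cast (ne_of_gt hε)
  simp only [smul_smul, mul_inv_cancel₀ hε0, one_smul]
  abel

omit [ContinuousSMul ℝ C] in
theorem tendsto_quotient (hP : IsSemigroupOf A P) (H : C) (t : ℝ≥0) :
    Tendsto (fun ε : ℝ≥0 => (ε : ℝ)⁻¹ • (P (t + ε) H - P t H)) (𝓝[>] 0) (𝓝 (A (P t H))) := by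
  rw [← tendsto_sub_nhds_zero_iff]
  intro V hV
  rw [Filter.mem_map]
  filter_upwards [hP.expansion H t V hV, self_mem_nhdsWithin] with ε h hε
  have hε0 : (ε : ℝ) ≠ 0 := by exact_mod_cast (ne_of_gt hε)
  have := h t le_rfl
  rwa [smul_sub _ (_ - _), smul_smul, inv_mul_cancel₀ hε0, one_smul] at this

omit [ContinuousSMul ℝ C] in
-- The quotient at time 0 is pushed through `P t`. Since `C` need not be Hausdorff, this limit and
-- the previous one can be identified only after applying a continuous function.
theorem tendsto_quotient' (hP : IsSemigroupOf A P) (H : C) (t : ℝ≥0) :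
    Tendsto (fun ε : ℝ≥0 => (ε : ℝ)⁻¹ • (P (t + ε) H - P t H)) (𝓝[>] 0) (𝓝 (P t (A H))) := by
  have h := ((P t).continuous.tendsto _).comp (hP.tendsto_quotient H 0)
  simp only [hP.zero, ContinuousLinearMap.id_apply] at h
  refine h.congr fun ε => ?_
  simp only [Function.comp, map_smul, map_sub, zero_add, hP.add, ContinuousLinearMap.comp_apply]

omit [ContinuousSMul ℝ C] in
/-- Continuous functionals do not distinguish `A P_t H` from `P_t A H`. -/
theorem apply_comm (hP : IsSemigroupOf A P) {φ : C → ℝ} (hφ : Continuous φ) (H : C) (t : ℝ≥0) :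
    φ (A (P t H)) = φ (P t (A H)) :=
  tendsto_nhds_unique ((hφ.tendsto _).comp (hP.tendsto_quotient H t))
    ((hφ.tendsto _).comp (hP.tendsto_quotient' H t))

omit [ContinuousSMul ℝ C] in
theorem hasDerivWithinAt (hP : IsSemigroupOf A P) (y : C →L[ℝ] ℝ) (H : C) {u : ℝ} (hu : 0 ≤ u) :
    HasDerivWithinAt (fun x : ℝ => y (P x.toNNReal H)) (y (P u.toNNReal (A H))) (Set.Ici u) u := by
  rw [← hasDerivWithinAt_Ioi_iff_Ici, hasDerivWithinAt_iff_tendsto_slope' Set.self_notMem_Ioi]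
  have h1 := (y.continuous.tendsto _).comp (hP.tendsto_quotient' H u.toNNReal)
  have h2 : Tendsto (fun x : ℝ => (x - u).toNNReal) (𝓝[>] u) (𝓝[>] 0) := by
    refine tendsto_nhdsWithin_iff.2 ⟨?_, ?_⟩
    · have : Continuous fun x : ℝ => (x - u).toNNReal := by fun_prop
      simpa using (this.tendsto u).mono_left nhdsWithin_le_nhds
    · filter_upwards [self_mem_nhdsWithin] with x hx
      exact Real.toNNReal_pos.2 (sub_pos.2 hx)
  refine (h1.comp h2).congr' ?_
  filter_upwards [self_mem_nhdsWithin] with x hx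
  have hx' : 0 < x - u := sub_pos.2 hx
  simp only [Function.comp, slope_def_module, map_smul, map_sub]
  rw [← Real.toNNReal_add hu hx'.le, add_sub_cancel, Real.coe_toNNReal _ hx'.le]

/-- Homogeneity turns the qualitative o(ε) into a bound in terms of `c`. Only a continuous function
of `A (P t H)` is involved, so it may be replaced by `P t (A H)`. -/
theorem eventually_le (hP : IsSemigroupOf A P) {c : C → ℝ} (hc : Continuous c)
    (hhom : ∀ (a : ℝ) (H : C), c (a • H) = |a| * c H) (H : C) (K : ℝ≥0) {η : ℝ} (hη : 0 < η) :
    ∀ᶠ ε : ℝ≥0 in 𝓝[>] 0, ∀ t ≤ K,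
      c (P (t + ε) H - P t H - (ε : ℝ) • P t (A H)) ≤ η * ε := by
  have h0 : c 0 = 0 := by simpa using hhom 0 0
  have hV : {x | c x < η} ∈ 𝓝 (0 : C) :=
    (isOpen_lt hc continuous_const).mem_nhds (by simpa [h0] using hη)
  filter_upwards [hP.expansion H K _ hV, self_mem_nhdsWithin] with ε h hε t ht
  have hε0 : (0 : ℝ) < ε := by exact_mod_cast hε
  have h1 : c ((ε : ℝ)⁻¹ • (P (t + ε) H - P t H - (ε : ℝ) • A (P t H))) < η := h t ht
  rw [hhom, abs_of_pos (inv_pos.2 hε0), inv_mul_lt_iff₀ hε0,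
    hP.apply_comm (φ := fun x => c (P (t + ε) H - P t H - (ε : ℝ) • x)) (by fun_prop)] at h1
  linarith

end IsSemigroupOf

end Semigroup

end OrnsteinUhlenbeck

/-! ### Riemann sums and the pathwise stochastic convolution. -/

namespace OrnsteinUhlenbeck

section Riemann

variable {E : Type*} [NormedAddCommGroup E] [NormedSpace ℝ E]

/-- Riemann sums with frozen first argument converge to the integral along the diagonal. -/
theorem tendsto_sum_integral_diag {Ψ : ℝ → ℝ → E} (hΨ : Continuous (Function.uncurry Ψ)) {L : ℝ}
    (hL : 0 ≤ L) {p : ℕ → ℕ → ℝ} (hp : ∀ N : ℕ, 0 < N → ∀ j < N,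
      p N j ∈ Set.Icc (j * (L / N)) ((j + 1 : ℕ) * (L / N))) :
    Tendsto (fun N : ℕ => ∑ j ∈ Finset.range N,
      ∫ v in (j * (L / N))..((j + 1 : ℕ) * (L / N)), Ψ (p N j) v) atTop
      (𝓝 (∫ v in (0 : ℝ)..L, Ψ v v)) := by
  have huc : UniformContinuousOn (Function.uncurry Ψ) (Set.Icc 0 L ×ˢ Set.Icc 0 L) :=
    (isCompact_Icc.prod isCompact_Icc).uniformContinuousOn_of_continuous hΨ.continuousOn
  rw [Metric.uniformContinuousOn_iff] at huc
  have hdiag : Continuous fun v => Ψ v v := hΨ.comp (continuous_id.prodMk continuous_id)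
  have hsec : ∀ x, Continuous (Ψ x) := fun x => hΨ.comp (continuous_const.prodMk continuous_id)
  rw [Metric.tendsto_atTop]
  intro ε hε
  -- Dividing by `L + 1` rather than `L` covers `L = 0` and makes the final inequality strict.
  have hε' : 0 < ε / (L + 1) := by positivity
  obtain ⟨δ, hδ, hδΨ⟩ := huc _ hε'
  obtain ⟨N₀, hN₀⟩ := exists_nat_gt (L / δ)
  refine ⟨N₀ + 1, fun N hN => ?_⟩
  have hNpos : 0 < N := by omega
  have hNR : (0 : ℝ) < N := by exact_mod_cast hNpos
  have hh0 : 0 ≤ L / N := by positivity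
  have hhδ : L / N < δ := by
    rw [div_lt_comm₀ hNR hδ]
    exact hN₀.trans (by exact_mod_cast (by omega : N₀ < N))
  have hsplit : ∫ v in (0 : ℝ)..L, Ψ v v = ∑ j ∈ Finset.range N,
      ∫ v in (j * (L / N))..((j + 1 : ℕ) * (L / N)), Ψ v v := by
    rw [intervalIntegral.sum_integral_adjacent_intervals (a := fun j : ℕ => (j : ℝ) * (L / N))
      fun k _ => hdiag.intervalIntegrable _ _]
    simp [mul_div_cancel₀ L hNR.ne']
  rw [hsplit, dist_eq_norm, ← Finset.sum_sub_distrib]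
  have hterm : ∀ j ∈ Finset.range N,
      ‖(∫ v in (j * (L / N))..((j + 1 : ℕ) * (L / N)), Ψ (p N j) v)
        - ∫ v in (j * (L / N))..((j + 1 : ℕ) * (L / N)), Ψ v v‖ ≤ ε / (L + 1) * (L / N) := by
    intro j hj
    have hjN := Finset.mem_range.1 hj
    have hpj := hp N hNpos j hjN
    have hle : (j : ℝ) * (L / N) ≤ (j + 1 : ℕ) * (L / N) := by gcongr; simp
    have hj0 : 0 ≤ (j : ℝ) * (L / N) := by positivity
    have hj1 : ((j + 1 : ℕ) : ℝ) * (L / N) ≤ L := by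
      calc ((j + 1 : ℕ) : ℝ) * (L / N) ≤ N * (L / N) := by gcongr; omega
        _ = L := mul_div_cancel₀ L hNR.ne'
    have hstep : ((j + 1 : ℕ) : ℝ) * (L / N) - j * (L / N) = L / N := by push_cast; ring
    rw [← intervalIntegral.integral_sub ((hsec _).intervalIntegrable _ _)
      (hdiag.intervalIntegrable _ _)]
    refine (intervalIntegral.norm_integral_le_of_norm_le_const (C := ε / (L + 1))
      fun v hv => ?_).trans_eq (by rw [hstep, abs_of_nonneg hh0])
    rw [Set.uIoc_of_le hle] at hv
    have := hδΨ (p N j, v) ⟨⟨hj0.trans hpj.1, hpj.2.trans hj1⟩, hj0.trans hv.1.le, hv.2.trans hj1⟩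
      (v, v) ⟨⟨hj0.trans hv.1.le, hv.2.trans hj1⟩, hj0.trans hv.1.le, hv.2.trans hj1⟩ ?_
    · rw [dist_eq_norm] at this
      exact this.le
    · rw [Prod.dist_eq, dist_self, Real.dist_eq, max_eq_left (abs_nonneg _), abs_lt]
      constructor <;> linarith [hpj.1, hpj.2, hv.1, hv.2]
  calc _ ≤ ∑ j ∈ Finset.range N, ε / (L + 1) * (L / N) := norm_sum_le_of_le _ hterm
    _ = ε * (L / (L + 1)) := by
      rw [Finset.sum_const, Finset.card_range, nsmul_eq_mul]
      field_simp
    _ < ε * 1 := by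
      gcongr
      rw [div_lt_one (by linarith)]
      linarith
    _ = ε := mul_one ε

theorem tendsto_riemann_sum [CompleteSpace E] {φ : ℝ → E} (hφ : Continuous φ) {L : ℝ}
    (hL : 0 ≤ L) {p : ℕ → ℕ → ℝ} (hp : ∀ N : ℕ, 0 < N → ∀ j < N,
      p N j ∈ Set.Icc (j * (L / N)) ((j + 1 : ℕ) * (L / N))) :
    Tendsto (fun N : ℕ => ∑ j ∈ Finset.range N, (L / N) • φ (p N j)) atTop
      (𝓝 (∫ v in (0 : ℝ)..L, φ v)) := by
  refine (tendsto_sum_integral_diag (Ψ := fun x _ => φ x) (hφ.comp continuous_fst) hL hp).congr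
    fun N => Finset.sum_congr rfl fun j _ => ?_
  rw [intervalIntegral.integral_const]
  congr 1
  push_cast
  ring

theorem hasDerivAt_parametric_integral {Φ Φ' : ℝ → ℝ → E} (hΦ : Continuous (Function.uncurry Φ))
    (hΦ' : Continuous (Function.uncurry Φ'))
    (hd : ∀ x v, HasDerivAt (fun x => Φ x v) (Φ' x v) x) (a b x₀ : ℝ) :
    HasDerivAt (fun x => ∫ v in a..b, Φ x v) (∫ v in a..b, Φ' x₀ v) x₀ := by
  obtain ⟨M, hM⟩ := ((isCompact_Icc (a := x₀ - 1) (b := x₀ + 1)).prod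
    (isCompact_uIcc (a := a) (b := b))).exists_bound_of_continuousOn hΦ'.continuousOn
  have hsec : ∀ x, Continuous (Φ x) := fun x => hΦ.comp (continuous_const.prodMk continuous_id)
  have hsec' : ∀ x, Continuous (Φ' x) := fun x => hΦ'.comp (continuous_const.prodMk continuous_id)
  refine (intervalIntegral.hasDerivAt_integral_of_dominated_loc_of_deriv_le (F := Φ) (F' := Φ')
    (bound := fun _ => M)
    (s := Set.Icc (x₀ - 1) (x₀ + 1)) (Icc_mem_nhds (by linarith) (by linarith))
    (Eventually.of_forall fun x => (hsec x).aestronglyMeasurable)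
    ((hsec x₀).intervalIntegrable _ _) (hsec' x₀).aestronglyMeasurable
    (Eventually.of_forall fun v hv x hx => hM (x, v) ⟨hx, Set.uIoc_subset_uIcc hv⟩)
    intervalIntegrable_const (Eventually.of_forall fun v _ x _ => hd x v)).2

end Riemann

/-- A family `w k r u` of jointly continuous functions, null at time `0`, where `w (k + 1)` is the
`u`-derivative of `w k` for `k < 3`. -/
structure SmoothNoise (w : ℕ → ℝ → ℝ → ℝ) : Prop where
  cont : ∀ k, Continuous (Function.uncurry (w k))
  deriv : ∀ k < 3, ∀ r u, HasDerivAt (w k r) (w (k + 1) r u) u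
  zero : ∀ k u, w k 0 u = 0

/-- The solution of the transport equation driven by the noise `w`. -/
noncomputable def noiseConvolution (w : ℕ → ℝ → ℝ → ℝ) (k : ℕ) (r u : ℝ) : ℝ :=
  w k r u + ∫ v in (0 : ℝ)..r, w (k + 1) v (r - v + u)

namespace SmoothNoise

variable {w : ℕ → ℝ → ℝ → ℝ}

theorem cont_comp (h : SmoothNoise w) (k : ℕ) {X : Type*} [TopologicalSpace X] {a b : X → ℝ}
    (ha : Continuous a) (hb : Continuous b) : Continuous fun x => w k (a x) (b x) :=
  (h.cont k).comp (ha.prodMk hb)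

theorem cont_convolution (h : SmoothNoise w) (k : ℕ) :
    Continuous (Function.uncurry (noiseConvolution w k)) := by
  refine (h.cont k).add ?_
  refine intervalIntegral.continuous_parametric_intervalIntegral_of_continuous
    (f := fun (p : ℝ × ℝ) v => w (k + 1) v (p.1 - v + p.2)) ?_ continuous_fst
  exact h.cont_comp (k + 1) (by fun_prop) (by fun_prop)

theorem deriv_convolution (h : SmoothNoise w) {k : ℕ} (hk : k < 2) (r u : ℝ) :
    HasDerivAt (noiseConvolution w k r) (noiseConvolution w (k + 1) r u) u := by
  refine (h.deriv k (by omega) r u).add ?_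
  refine hasDerivAt_parametric_integral (Φ := fun x v => w (k + 1) v (r - v + x))
    (Φ' := fun x v => w (k + 2) v (r - v + x)) (h.cont_comp _ (by fun_prop) (by fun_prop))
    (h.cont_comp _ (by fun_prop) (by fun_prop)) (fun x v => ?_) 0 r u
  exact (h.deriv (k + 1) (by omega) v (r - v + x)).comp_const_add (r - v) x

theorem convolution_zero (h : SmoothNoise w) (k : ℕ) (u : ℝ) : noiseConvolution w k 0 u = 0 := by
  simp [noiseConvolution, h.zero]

/-- This is ∂_r N = ∂_u N + ∂_r w for the convolution N, in integrated form, so `w` need not be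
differentiable in time. Writing the integral term of N as J(r, r+u) with J(r,x) = ∫₀^r w₁(v, x-v)
dv, its total derivative in r is w₁(r,u) + ∂_x J(r, r+u), which is the convolution at level 1. -/
theorem integral_convolution (h : SmoothNoise w) (r u : ℝ) :
    ∫ v in (0 : ℝ)..r, noiseConvolution w 1 v u = noiseConvolution w 0 r u - w 0 r u := by
  set J : ℝ → ℝ → ℝ := fun r x => ∫ v in (0 : ℝ)..r, w 1 v (x - v) with hJ
  set J₂ : ℝ → ℝ → ℝ := fun r x => ∫ v in (0 : ℝ)..r, w 2 v (x - v) with hJ₂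
  have hJ₂c : Continuous (Function.uncurry J₂) :=
    intervalIntegral.continuous_parametric_intervalIntegral_of_continuous
      (f := fun (p : ℝ × ℝ) v => w 2 v (p.2 - v))
      (h.cont_comp 2 (by fun_prop) (by fun_prop)) continuous_fst
  have h1 : ∀ p : ℝ × ℝ, HasDerivAt (fun r => J r p.2) (w 1 p.1 (p.2 - p.1)) p.1 := fun p =>
    intervalIntegral.integral_hasDerivAt_right
      ((h.cont_comp 1 (by fun_prop) (by fun_prop)).intervalIntegrable _ _)
      ((h.cont_comp 1 (by fun_prop) (by fun_prop)).stronglyMeasurableAtFilter _ _)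
      (h.cont_comp 1 (by fun_prop) (by fun_prop)).continuousAt
  have h2 : ∀ p : ℝ × ℝ, HasDerivAt (fun x => J p.1 x) (J₂ p.1 p.2) p.2 := fun p =>
    hasDerivAt_parametric_integral (Φ := fun x v => w 1 v (x - v))
      (Φ' := fun x v => w 2 v (x - v)) (h.cont_comp _ (by fun_prop) (by fun_prop))
      (h.cont_comp _ (by fun_prop) (by fun_prop))
      (fun x v => (h.deriv 1 (by omega) v (x - v)).comp_sub_const x v) 0 p.1 p.2
  have hder : ∀ r : ℝ, HasDerivAt (fun r => J r (r + u)) (noiseConvolution w 1 r u) r := by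
    intro r
    have hF := hasStrictFDerivAt_uncurry_coprod (𝕜 := ℝ) (u := (r, r + u)) (f := J)
      (f₁ := fun r x => ContinuousLinearMap.toSpanSingleton ℝ (w 1 r (x - r)))
      (f₂ := fun r x => ContinuousLinearMap.toSpanSingleton ℝ (J₂ r x))
      (Eventually.of_forall fun p => (h1 p).hasFDerivAt)
      (Eventually.of_forall fun p => (h2 p).hasFDerivAt) ?_ ?_
    · have hg : HasDerivAt (fun r : ℝ => (r, r + u)) (1, 1) r :=
        (hasDerivAt_id r).prodMk ((hasDerivAt_id r).add_const u)
      have := hF.hasFDerivAt.comp_hasDerivAt r hg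
      convert! this using 1
      simp [noiseConvolution, hJ₂, Function.HasUncurry.uncurry]
      refine intervalIntegral.integral_congr fun v _ => ?_
      congr 1
      ring
    · refine Continuous.continuousAt ?_
      exact (ContinuousLinearMap.toSpanSingletonCLE (𝕜 := ℝ) (E := ℝ)).continuous.comp
        (h.cont_comp 1 continuous_fst (continuous_snd.sub continuous_fst))
    · exact ((ContinuousLinearMap.toSpanSingletonCLE (𝕜 := ℝ) (E := ℝ)).continuous.comp hJ₂c).continuousAt
  rw [intervalIntegral.integral_eq_sub_of_hasDerivAt (fun x _ => hder x)
    (((h.cont_convolution 1).comp (continuous_id.prodMk continuous_const)).intervalIntegrable _ _)]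
  simp only [hJ, noiseConvolution, intervalIntegral.integral_same, sub_zero, add_sub_cancel_left]
  refine intervalIntegral.integral_congr fun v _ => ?_
  congr 1
  ring

/-- The noise convolution is a limit of sums of increments of the noise. -/
theorem tendsto_sum_increments (h : SmoothNoise w) {L : ℝ} (hL : 0 ≤ L) :
    Tendsto (fun N : ℕ => ∑ j ∈ Finset.range N,
      (w 0 ((j + 1 : ℕ) * (L / N)) (L - (j + 1 : ℕ) * (L / N))
        - w 0 (j * (L / N)) (L - (j + 1 : ℕ) * (L / N)))) atTop
      (𝓝 (noiseConvolution w 0 L 0)) := by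
  have h1 := (tendsto_sum_integral_diag (Ψ := fun x v => w 1 x (L - v))
    (h.cont_comp 1 (by fun_prop) (by fun_prop)) hL (p := fun N j => j * (L / N))
    (fun N hN j hj => ⟨le_rfl, by push_cast; nlinarith [div_nonneg hL (Nat.cast_nonneg N)]⟩)
    ).const_add (w 0 L 0)
  simp only [noiseConvolution, add_zero, zero_add]
  refine h1.congr' ?_
  filter_upwards [eventually_gt_atTop 0] with N hN
  have hNR : (0 : ℝ) < N := by exact_mod_cast hN
  -- Summation by parts: along the antidiagonal the values of `w 0` telescope to `w 0 L 0`, and each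
  -- time increment exceeds its telescoping term by a space increment, an integral of `w 1`.
  have htel := Finset.sum_range_sub (fun j : ℕ => w 0 (j * (L / N)) (L - j * (L / N))) N
  simp only [mul_div_cancel₀ L hNR.ne', sub_self, Nat.cast_zero, zero_mul, h.zero, sub_zero]
    at htel
  rw [← htel, ← Finset.sum_add_distrib]
  refine Finset.sum_congr rfl fun j _ => ?_
  rw [intervalIntegral.integral_eq_sub_of_hasDerivAt
    (f := fun v => -w 0 (j * (L / N)) (L - v)) (fun v _ => ?_)
    ((h.cont_comp 1 (by fun_prop) (by fun_prop)).intervalIntegrable _ _)]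
  · ring
  · have := ((h.deriv 0 (by omega) (j * (L / N)) (L - v)).comp_const_sub L v).neg
    rw [neg_neg] at this
    exact this

end SmoothNoise

end OrnsteinUhlenbeck

/-! ### Martingales with linear bracket and Doob's inequality at discrete times. -/

namespace OrnsteinUhlenbeck

variable {Ω : Type*} {mΩ : MeasurableSpace Ω} {μ : Measure Ω}

theorem integral_smul_eq_of_condExp [IsFiniteMeasure μ] {E : Type*} [NormedAddCommGroup E]
    [NormedSpace ℝ E] [CompleteSpace E] {m : MeasurableSpace Ω} (hm : m ≤ mΩ) {Z W : Ω → ℝ}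
    (hZ : Integrable Z μ) (h : μ[Z | m] =ᵐ[μ] W) {ζ : Ω → E} (hζ : StronglyMeasurable[m] ζ)
    (hint : Integrable (fun ω => Z ω • ζ ω) μ) :
    ∫ ω, Z ω • ζ ω ∂μ = ∫ ω, W ω • ζ ω ∂μ := by
  have h1 := condExp_bilin_of_aestronglyMeasurable_left (μ := μ) (m := m)
    (ContinuousLinearMap.lsmul ℝ ℝ : ℝ →L[ℝ] E →L[ℝ] E).flip (f := ζ) (g := Z)
    hζ.aestronglyMeasurable (by simpa using hint) hZ
  simp only [ContinuousLinearMap.flip_apply, ContinuousLinearMap.lsmul_apply] at h1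
  rw [← integral_condExp hm]
  refine integral_congr_ae ?_
  filter_upwards [h1, h] with ω h1 h
  rw [h1, h]

/-- The pathwise form of Doob's inequality. A step that does not raise the running maximum gives
equality; a step that raises it completes a square. -/
theorem sum_partialSups_mul_sub_le (X : ℕ → ℝ) (n : ℕ) :
    ∑ i ∈ Finset.range n, partialSups X i * (X (i + 1) - X i)
      ≤ partialSups X n * X n - (partialSups X n) ^ 2 / 2 - (X 0) ^ 2 / 2 := by
  induction n with
  | zero => simp; nlinarith
  | succ n ih =>
    rw [Finset.sum_range_succ]
    have h : partialSups X (n + 1) = max (partialSups X n) (X (n + 1)) := partialSups_succ X n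
    rcases le_total (X (n + 1)) (partialSups X n) with hle | hle
    · rw [h, max_eq_left hle]
      linarith
    · rw [h, max_eq_right hle]
      nlinarith [sq_nonneg (X (n + 1) - partialSups X n)]

/-- `X` is a continuous process on `[0,T]` such that `X` and `X² - κ t` are martingales. -/
structure HasLinearBracket {T : ℝ} (𝓕 : Filtration (Set.Icc (0 : ℝ) T) mΩ) (μ : Measure Ω) (κ : ℝ)
    (X : Ω → C(Set.Icc (0 : ℝ) T, ℝ)) : Prop where
  martingale : Martingale (fun t ω => X ω t) 𝓕 μ
  bracket : Martingale (fun t ω => X ω t ^ 2 - (t : ℝ) * κ) 𝓕 μ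

namespace HasLinearBracket

variable {T κ : ℝ} {𝓕 : Filtration (Set.Icc (0 : ℝ) T) mΩ} {X : Ω → C(Set.Icc (0 : ℝ) T, ℝ)}
  [IsProbabilityMeasure μ]

omit [IsProbabilityMeasure μ] in
theorem measurable (h : HasLinearBracket 𝓕 μ κ X) (t : Set.Icc (0 : ℝ) T) :
    StronglyMeasurable[𝓕 t] fun ω => X ω t := h.martingale.1 t

theorem memLp (h : HasLinearBracket 𝓕 μ κ X) (t : Set.Icc (0 : ℝ) T) :
    MemLp (fun ω => X ω t) 2 μ := by
  refine (memLp_two_iff_integrable_sq ((h.measurable t).mono (𝓕.le t)).aestronglyMeasurable).2 ?_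
  exact ((h.bracket.integrable t).add (integrable_const ((t : ℝ) * κ))).congr
    (Eventually.of_forall fun ω => sub_add_cancel _ _)

theorem memLp_sub (h : HasLinearBracket 𝓕 μ κ X) (s t : Set.Icc (0 : ℝ) T) :
    MemLp (fun ω => X ω t - X ω s) 2 μ := (h.memLp t).sub (h.memLp s)

theorem integrable_sq_sub (h : HasLinearBracket 𝓕 μ κ X) (s t : Set.Icc (0 : ℝ) T) :
    Integrable (fun ω => (X ω t - X ω s) ^ 2) μ := (h.memLp_sub s t).integrable_sq

theorem integral_smul_sub (h : HasLinearBracket 𝓕 μ κ X) {E : Type*} [NormedAddCommGroup E]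
    [NormedSpace ℝ E] [CompleteSpace E] {s t : Set.Icc (0 : ℝ) T} (hst : s ≤ t) {ζ : Ω → E}
    (hζ : StronglyMeasurable[𝓕 s] ζ) (hζ2 : MemLp ζ 2 μ) :
    ∫ ω, (X ω t - X ω s) • ζ ω ∂μ = 0 := by
  have hi : ∀ r, Integrable (fun ω => X ω r • ζ ω) μ := fun r =>
    memLp_one_iff_integrable.1 (hζ2.smul (h.memLp r))
  simp only [sub_smul]
  rw [integral_sub (hi t) (hi s), sub_eq_zero]
  exact integral_smul_eq_of_condExp (𝓕.le s) ((h.memLp t).integrable one_le_two)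
    (h.martingale.2 s t hst) hζ (hi t)

theorem condExp_sq_sub (h : HasLinearBracket 𝓕 μ κ X) {s t : Set.Icc (0 : ℝ) T} (hst : s ≤ t) :
    μ[fun ω => (X ω t - X ω s) ^ 2 | 𝓕 s] =ᵐ[μ] fun _ => ((t : ℝ) - s) * κ := by
  have i1 := h.bracket.integrable t
  have i2 : Integrable (fun ω => X ω s * X ω t) μ := (h.memLp s).integrable_mul (h.memLp t)
  have i3 : Integrable (fun ω => X ω s ^ 2 + (t : ℝ) * κ) μ :=
    (h.memLp s).integrable_sq.add (integrable_const _)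
  have e : (fun ω => (X ω t - X ω s) ^ 2) = (fun ω => X ω t ^ 2 - (t : ℝ) * κ)
      - (2 : ℝ) • (fun ω => X ω s * X ω t) + fun ω => X ω s ^ 2 + (t : ℝ) * κ := by
    ext ω
    simp only [Pi.add_apply, Pi.sub_apply, Pi.smul_apply, smul_eq_mul]
    ring
  have c3 : μ[fun ω => X ω s ^ 2 + (t : ℝ) * κ | 𝓕 s] = fun ω => X ω s ^ 2 + (t : ℝ) * κ :=
    condExp_of_stronglyMeasurable (𝓕.le s)
      (((h.measurable s).pow 2).add stronglyMeasurable_const) i3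
  have c2 : μ[fun ω => X ω s * X ω t | 𝓕 s] =ᵐ[μ] fun ω => X ω s * X ω s := by
    have := condExp_smul_of_aestronglyMeasurable_left (μ := μ) (m := 𝓕 s) (f := fun ω => X ω s)
      (g := fun ω => X ω t) (h.measurable s).aestronglyMeasurable i2
      ((h.memLp t).integrable one_le_two)
    refine EventuallyEq.trans this ?_
    filter_upwards [h.martingale.2 s t hst] with ω hω
    simp [hω]
  rw [e]
  filter_upwards [condExp_add (i1.sub (i2.smul (2 : ℝ))) i3 (𝓕 s),
    condExp_sub i1 (i2.smul (2 : ℝ)) (𝓕 s), condExp_smul (μ := μ) (2 : ℝ)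
      (fun ω => X ω s * X ω t) (𝓕 s), c2, h.bracket.2 s t hst] with ω h1 h2 h3 h4 h5
  rw [h1, Pi.add_apply, h2, Pi.sub_apply, h3, Pi.smul_apply, h4, h5, c3, smul_eq_mul]
  ring

theorem integral_sq_sub_smul (h : HasLinearBracket 𝓕 μ κ X) {E : Type*} [NormedAddCommGroup E]
    [NormedSpace ℝ E] [CompleteSpace E] {s t : Set.Icc (0 : ℝ) T} (hst : s ≤ t) {ζ : Ω → E} {B : ℝ}
    (hζ : StronglyMeasurable[𝓕 s] ζ) (hB : ∀ ω, ‖ζ ω‖ ≤ B) :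
    ∫ ω, (X ω t - X ω s) ^ 2 • ζ ω ∂μ = (((t : ℝ) - s) * κ) • ∫ ω, ζ ω ∂μ := by
  rw [integral_smul_eq_of_condExp (𝓕.le s) (h.integrable_sq_sub s t) (h.condExp_sq_sub hst) hζ
    ((h.integrable_sq_sub s t).smul_bdd B (hζ.mono (𝓕.le s)).aestronglyMeasurable
      (Eventually.of_forall hB)), integral_smul]

theorem integral_sq_sub (h : HasLinearBracket 𝓕 μ κ X) {s t : Set.Icc (0 : ℝ) T} (hst : s ≤ t) :
    ∫ ω, (X ω t - X ω s) ^ 2 ∂μ = ((t : ℝ) - s) * κ := by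
  have := h.integral_sq_sub_smul hst (ζ := fun _ => (1 : ℝ)) (B := 1) stronglyMeasurable_const
    (by simp)
  simpa using this

theorem memLp_partialSups (h : HasLinearBracket 𝓕 μ κ X) (τ : ℕ → Set.Icc (0 : ℝ) T) (n : ℕ) :
    MemLp (fun ω => partialSups (fun k => |X ω (τ k)|) n) 2 μ := by
  induction n with
  | zero => exact (h.memLp (τ 0)).abs
  | succ n ih =>
    have : (fun ω => partialSups (fun k => |X ω (τ k)|) (n + 1))
        = (fun ω => partialSups (fun k => |X ω (τ k)|) n) ⊔ fun ω => |X ω (τ (n + 1))| := by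
      ext ω
      exact partialSups_succ (fun k => |X ω (τ k)|) n
    rw [this]
    exact ih.sup (h.memLp _).abs

omit [IsProbabilityMeasure μ] in
theorem measurable_partialSups (h : HasLinearBracket 𝓕 μ κ X) {τ : ℕ → Set.Icc (0 : ℝ) T}
    (hτ : Monotone τ) (n : ℕ) :
    StronglyMeasurable[𝓕 (τ n)] fun ω => partialSups (fun k => |X ω (τ k)|) n := by
  induction n with
  | zero => simpa using (h.measurable (τ 0)).norm
  | succ n ih =>
    have : (fun ω => partialSups (fun k => |X ω (τ k)|) (n + 1))
        = (fun ω => partialSups (fun k => |X ω (τ k)|) n) ⊔ fun ω => |X ω (τ (n + 1))| := by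
      ext ω
      exact partialSups_succ (fun k => |X ω (τ k)|) n
    rw [this]
    exact @StronglyMeasurable.sup _ _ _ _ (𝓕 (τ (n + 1))) _ _ _
      (ih.mono (𝓕.mono (hτ n.le_succ))) (h.measurable (τ (n + 1))).norm

/-- Doob's `L²` maximal inequality along finitely many times. -/
theorem integral_partialSups_sq_le (h : HasLinearBracket 𝓕 μ κ X) {τ : ℕ → Set.Icc (0 : ℝ) T}
    (hτ : Monotone τ) (n : ℕ) :
    ∫ ω, (partialSups (fun k => |X ω (τ k)|) n) ^ 2 ∂μ ≤ 4 * ∫ ω, X ω (τ n) ^ 2 ∂μ := by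
  set S : ℕ → Ω → ℝ := fun n ω => partialSups (fun k => |X ω (τ k)|) n with hS
  have hS2 : ∀ i, MemLp (S i) 2 μ := fun i => h.memLp_partialSups τ i
  have hint : ∀ i, Integrable (fun ω => S i ω * (|X ω (τ (i + 1))| - |X ω (τ i)|)) μ := fun i =>
    (hS2 i).integrable_mul ((h.memLp _).abs.sub (h.memLp _).abs)
  have hpos : ∀ i, 0 ≤ ∫ ω, S i ω * (|X ω (τ (i + 1))| - |X ω (τ i)|) ∂μ := by
    intro i
    -- The submartingale property of |X|: the martingale increment is tested against the
    -- past-measurable weight sign(X) S, and sign(X_i)(X_{i+1} - X_i) ≤ |X_{i+1}| - |X_i|.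
    set ζ : Ω → ℝ := fun ω => (SignType.sign (X ω (τ i)) : ℝ) * S i ω with hζ
    have hsm : StronglyMeasurable[𝓕 (τ i)] fun ω => (SignType.sign (X ω (τ i)) : ℝ) := by
      have h0 : Measurable fun x : ℝ => (SignType.sign x : ℝ) := by
        have : (fun x : ℝ => (SignType.sign x : ℝ)) =
            fun x => if 0 < x then 1 else if x < 0 then -1 else 0 := by
          ext x
          rw [sign_apply]
          split_ifs <;> simp
        rw [this]
        exact Measurable.ite measurableSet_Ioi measurable_const
          (Measurable.ite measurableSet_Iio measurable_const measurable_const)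
      exact (h0.comp (h.measurable (τ i)).measurable).stronglyMeasurable
    have hbd : ∀ ω, ‖(SignType.sign (X ω (τ i)) : ℝ)‖ ≤ 1 := by
      intro ω
      rcases lt_trichotomy (X ω (τ i)) 0 with hx | hx | hx <;> simp [hx]
    have hζm : StronglyMeasurable[𝓕 (τ i)] ζ := hsm.mul (h.measurable_partialSups hτ i)
    have hζ2 : MemLp ζ 2 μ := by
      refine (hS2 i).of_le (hζm.mono (𝓕.le _)).aestronglyMeasurable
        (Eventually.of_forall fun ω => ?_)
      rw [hζ, norm_mul]
      exact mul_le_of_le_one_left (norm_nonneg _) (hbd ω)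
    have h0 := h.integral_smul_sub (hτ i.le_succ) hζm hζ2
    refine h0.symm.trans_le ?_
    refine integral_mono (hζ2.integrable_mul (h.memLp_sub (τ i) (τ (i + 1))) |>.congr
      (Eventually.of_forall fun ω => mul_comm _ _)) (hint i) fun ω => ?_
    have hS0 : 0 ≤ S i ω :=
      (abs_nonneg _).trans (le_partialSups (fun k => |X ω (τ k)|) i)
    have h1 : (SignType.sign (X ω (τ i)) : ℝ) * X ω (τ i) = |X ω (τ i)| := sign_mul_self _
    have h2 : (SignType.sign (X ω (τ i)) : ℝ) * X ω (τ (i + 1)) ≤ |X ω (τ (i + 1))| := by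
      refine (le_abs_self _).trans ?_
      rw [abs_mul]
      exact mul_le_of_le_one_left (abs_nonneg _) (hbd ω)
    simp only [hζ, smul_eq_mul]
    nlinarith
  -- From S²/2 ≤ S|X| - ∑ and S|X| ≤ S²/4 + |X|²; hence the factor 4.
  have hkey : ∀ ω, (S n ω) ^ 2 ≤ 4 * X ω (τ n) ^ 2
      - 4 * ∑ i ∈ Finset.range n, S i ω * (|X ω (τ (i + 1))| - |X ω (τ i)|) := by
    intro ω
    have := sum_partialSups_mul_sub_le (fun k => |X ω (τ k)|) n
    simp only [hS]
    nlinarith [sq_nonneg (partialSups (fun k => |X ω (τ k)|) n - 2 * |X ω (τ n)|),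
      sq_abs (X ω (τ n)), sq_nonneg (|X ω (τ 0)|)]
  have hsum : Integrable (fun ω => 4 * ∑ i ∈ Finset.range n,
      S i ω * (|X ω (τ (i + 1))| - |X ω (τ i)|)) μ :=
    (integrable_finsetSum _ fun i _ => hint i).const_mul 4
  calc ∫ ω, (S n ω) ^ 2 ∂μ ≤ ∫ ω, (4 * X ω (τ n) ^ 2
      - 4 * ∑ i ∈ Finset.range n, S i ω * (|X ω (τ (i + 1))| - |X ω (τ i)|)) ∂μ :=
        integral_mono (hS2 n).integrable_sq
          (((h.memLp _).integrable_sq.const_mul 4).sub hsum) hkey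
    _ ≤ 4 * ∫ ω, X ω (τ n) ^ 2 ∂μ := by
      rw [integral_sub ((h.memLp _).integrable_sq.const_mul 4) hsum, integral_const_mul,
        integral_const_mul, integral_finsetSum _ fun i _ => hint i]
      have := Finset.sum_nonneg fun i (_ : i ∈ Finset.range n) => hpos i
      linarith

end HasLinearBracket

end OrnsteinUhlenbeck

/-! ### Uniform grids and Doob's inequality in continuous time. -/

namespace OrnsteinUhlenbeck

/-- The point `a + j h`, projected to `[0,T]`. -/
noncomputable def gridTime {T : ℝ} (hT : 0 ≤ T) (a h : ℝ) (j : ℕ) : Set.Icc (0 : ℝ) T :=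
  Set.projIcc 0 T hT (a + j * h)

theorem gridTime_mono {T : ℝ} (hT : 0 ≤ T) (a : ℝ) {h : ℝ} (hh : 0 ≤ h) :
    Monotone (gridTime hT a h) := fun i j hij =>
  Set.monotone_projIcc hT (by gcongr)

theorem gridTime_zero {T : ℝ} (hT : 0 ≤ T) (s : Set.Icc (0 : ℝ) T) (h : ℝ) :
    gridTime hT s h 0 = s := by
  simp [gridTime]

theorem gridTime_coe {T : ℝ} (hT : 0 ≤ T) {a h : ℝ} {j : ℕ} (hm : a + j * h ∈ Set.Icc 0 T) :
    (gridTime hT a h j : ℝ) = a + j * h := by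
  rw [gridTime, Set.projIcc_of_mem hT hm]

theorem gridTime_last {T : ℝ} (hT : 0 ≤ T) (s t : Set.Icc (0 : ℝ) T) {N : ℕ} (hN : 0 < N) :
    gridTime hT s ((t - s : ℝ) / N) N = t := by
  have hNR : (N : ℝ) ≠ 0 := by positivity
  rw [gridTime, mul_div_cancel₀ _ hNR, add_sub_cancel, Set.projIcc_val]

theorem gridTime_mem {T : ℝ} {s t : Set.Icc (0 : ℝ) T} (hst : s ≤ t) {N j : ℕ} (hN : 0 < N)
    (hj : j ≤ N) : (s : ℝ) + j * ((t - s : ℝ) / N) ∈ Set.Icc 0 T := by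
  have hNR : (0 : ℝ) < N := by positivity
  have hst' : (s : ℝ) ≤ t := hst
  have h0 : 0 ≤ (t - s : ℝ) / N := div_nonneg (by linarith) hNR.le
  refine ⟨add_nonneg s.2.1 (by positivity), ?_⟩
  calc (s : ℝ) + j * ((t - s : ℝ) / N) ≤ s + N * ((t - s : ℝ) / N) := by gcongr
    _ = t := by rw [mul_div_cancel₀ _ hNR.ne']; ring
    _ ≤ T := t.2.2

/-- The norm is attained at some `x`, and the grid point with index ⌊xN/T⌋ tends to `x`. When `T =
0` the division by zero is harmless, everything being 0. -/
theorem tendsto_partialSups_norm {T : ℝ} (hT : 0 ≤ T) (φ : C(Set.Icc (0 : ℝ) T, ℝ)) :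
    Tendsto (fun N : ℕ => partialSups (fun k => |φ (gridTime hT 0 (T / N) k)|) N) atTop
      (𝓝 ‖φ‖) := by
  have : Nonempty (Set.Icc (0 : ℝ) T) := ⟨⟨0, le_rfl, hT⟩⟩
  obtain ⟨x, -, hx⟩ := isCompact_univ.exists_isMaxOn Set.univ_nonempty
    (φ.continuous.norm.continuousOn (s := Set.univ))
  have hnorm : ‖φ‖ = ‖φ x‖ :=
    le_antisymm ((ContinuousMap.norm_le _ (norm_nonneg _)).2 fun y => hx (Set.mem_univ y))
      (φ.norm_coe_le_norm x)
  have hlim : Tendsto (fun N : ℕ => |φ (gridTime hT 0 (T / N) ⌊(x : ℝ) * N / T⌋₊)|) atTop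
      (𝓝 ‖φ‖) := by
    have h1 : Tendsto (fun N : ℕ => (0 : ℝ) + ⌊(x : ℝ) * N / T⌋₊ * (T / N)) atTop (𝓝 (x : ℝ)) := by
      have h2 : Tendsto (fun N : ℕ => (x : ℝ) - T / N) atTop (𝓝 (x : ℝ)) := by
        simpa using tendsto_const_nhds.sub (tendsto_const_div_atTop_nhds_zero_nat T)
      refine tendsto_of_tendsto_of_tendsto_of_le_of_le' h2 tendsto_const_nhds ?_ ?_
      all_goals
        filter_upwards [eventually_gt_atTop 0] with N hN
        have hNR : (0 : ℝ) < N := by positivity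
        rcases hT.eq_or_lt with hT0 | hT0
        · have hx0 : (x : ℝ) = 0 := le_antisymm (hT0 ▸ x.2.2) x.2.1
          simp [hx0, ← hT0]
      · have := (Nat.lt_floor_add_one ((x : ℝ) * N / T)).le
        have h3 : (x : ℝ) * N / T * (T / N) ≤ (⌊(x : ℝ) * N / T⌋₊ + 1) * (T / N) := by gcongr
        have h4 : (x : ℝ) * N / T * (T / N) = x := by field_simp
        linarith
      · have h0 : 0 ≤ (x : ℝ) * N / T := div_nonneg (mul_nonneg x.2.1 hNR.le) hT
        have h3 : ⌊(x : ℝ) * N / T⌋₊ * (T / N) ≤ (x : ℝ) * N / T * (T / N) := by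
          gcongr
          exact Nat.floor_le h0
        have h4 : (x : ℝ) * N / T * (T / N) = x := by field_simp
        linarith
    have h2 : Continuous fun y : ℝ => |φ (Set.projIcc 0 T hT y)| :=
      (φ.continuous.comp continuous_projIcc).abs
    have h3 := (h2.tendsto (x : ℝ)).comp h1
    rw [Set.projIcc_val, ← Real.norm_eq_abs, ← hnorm] at h3
    exact h3
  refine tendsto_of_tendsto_of_tendsto_of_le_of_le' hlim tendsto_const_nhds ?_ ?_
  · filter_upwards [eventually_gt_atTop 0] with N hN
    have hNR : (0 : ℝ) < N := by positivity
    refine le_partialSups_of_le (fun k => |φ (gridTime hT 0 (T / N) k)|) (Nat.floor_le_of_le ?_)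
    rcases hT.eq_or_lt with hT0 | hT0
    · simp [← hT0]
    · rw [div_le_iff₀ hT0, mul_comm]
      gcongr
      exact x.2.2
  · exact Eventually.of_forall fun N => partialSups_le _ _ _ fun k _ => φ.norm_coe_le_norm _

namespace HasLinearBracket

variable {Ω : Type*} {mΩ : MeasurableSpace Ω} {μ : Measure Ω}
variable {T κ : ℝ} {𝓕 : Filtration (Set.Icc (0 : ℝ) T) mΩ} {X : Ω → C(Set.Icc (0 : ℝ) T, ℝ)}
  [IsProbabilityMeasure μ]

omit [IsProbabilityMeasure μ] in
theorem measurable' (h : HasLinearBracket 𝓕 μ κ X) (t : Set.Icc (0 : ℝ) T) :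
    Measurable fun ω => X ω t := ((h.measurable t).mono (𝓕.le t)).measurable

omit [IsProbabilityMeasure μ] in
theorem measurable_norm (h : HasLinearBracket 𝓕 μ κ X) (hT : 0 ≤ T) :
    Measurable fun ω => ‖X ω‖ := by
  refine measurable_of_tendsto_metrizable (fun N : ℕ => ?_)
    (tendsto_pi_nhds.2 fun ω => tendsto_partialSups_norm hT (X ω))
  exact ((h.measurable_partialSups (gridTime_mono hT 0 (by positivity)) N).mono
    (𝓕.le _)).measurable

/-- Doob's `L²` maximal inequality. -/
theorem lintegral_norm_sq_le (h : HasLinearBracket 𝓕 μ κ X) (hT : 0 ≤ T)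
    (h0 : ∀ ω, X ω ⟨0, le_rfl, hT⟩ = 0) :
    ∫⁻ ω, ENNReal.ofReal (‖X ω‖ ^ 2) ∂μ ≤ ENNReal.ofReal (4 * (T * κ)) := by
  set S : ℕ → Ω → ℝ := fun N ω => partialSups (fun k => |X ω (gridTime hT 0 (T / N) k)|) N with hS
  have hlim : ∀ ω, Tendsto (fun N => ENNReal.ofReal (S N ω ^ 2)) atTop
      (𝓝 (ENNReal.ofReal (‖X ω‖ ^ 2))) := fun ω =>
    (ENNReal.continuous_ofReal.tendsto _).comp ((tendsto_partialSups_norm hT (X ω)).pow 2)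
  have hbd : ∀ᶠ N in atTop, ∫⁻ ω, ENNReal.ofReal (S N ω ^ 2) ∂μ ≤ ENNReal.ofReal (4 * (T * κ)) := by
    filter_upwards [eventually_gt_atTop 0] with N hN
    have h1 := h.integral_partialSups_sq_le (gridTime_mono hT 0 (h := T / N) (by positivity)) N
    have h2 : gridTime hT 0 (T / N) N = ⟨T, hT, le_rfl⟩ := by
      have := gridTime_last hT ⟨0, le_rfl, hT⟩ ⟨T, hT, le_rfl⟩ hN
      simpa using this
    have h3 := h.integral_sq_sub (s := ⟨0, le_rfl, hT⟩) (t := ⟨T, hT, le_rfl⟩)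
      (Subtype.mk_le_mk.2 hT)
    simp only [h0, sub_zero] at h3
    rw [h2, h3] at h1
    rw [← ofReal_integral_eq_lintegral_ofReal
      (h.memLp_partialSups (gridTime hT 0 (T / N)) N).integrable_sq
      (Eventually.of_forall fun ω => sq_nonneg _)]
    exact ENNReal.ofReal_le_ofReal h1
  -- The grids are not nested, so the discrete maxima need not increase with `N`; Fatou's lemma
  -- replaces monotone convergence.
  calc ∫⁻ ω, ENNReal.ofReal (‖X ω‖ ^ 2) ∂μ
      = ∫⁻ ω, liminf (fun N => ENNReal.ofReal (S N ω ^ 2)) atTop ∂μ :=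
        lintegral_congr fun ω => (hlim ω).liminf_eq.symm
    _ ≤ liminf (fun N => ∫⁻ ω, ENNReal.ofReal (S N ω ^ 2) ∂μ) atTop := by
        refine lintegral_liminf_le fun N => ?_
        exact ((((h.measurable_partialSups (gridTime_mono hT 0 (by positivity)) N).mono
          (𝓕.le _)).measurable).pow_const 2).ennreal_ofReal
    _ ≤ ENNReal.ofReal (4 * (T * κ)) :=
        liminf_le_of_frequently_le' hbd.frequently

theorem integrable_norm_sq (h : HasLinearBracket 𝓕 μ κ X) (hT : 0 ≤ T)
    (h0 : ∀ ω, X ω ⟨0, le_rfl, hT⟩ = 0) : Integrable (fun ω => ‖X ω‖ ^ 2) μ := by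
  refine ⟨((h.measurable_norm hT).pow_const 2).aestronglyMeasurable, ?_⟩
  rw [hasFiniteIntegral_iff_ofReal (Eventually.of_forall fun ω => sq_nonneg _)]
  exact (h.lintegral_norm_sq_le hT h0).trans_lt ENNReal.ofReal_lt_top

end HasLinearBracket

end OrnsteinUhlenbeck

/-! ### The Lindeberg condition. -/

namespace OrnsteinUhlenbeck

/-- For |x| ≤ 1 the Taylor remainder is at most |x|³, hence at most δx² when |x| ≤ δ and at most x²
otherwise. For |x| > 1 the terms are bounded separately by 1 + 1 + |x| + x²/2 ≤ 4x². -/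
theorem norm_exp_mul_I_sub_le {δ : ℝ} (x : ℝ) (hδ : 0 ≤ δ) (hδ1 : δ ≤ 1) :
    ‖Complex.exp (x * Complex.I) - 1 - x * Complex.I + (x : ℂ) ^ 2 / 2‖
      ≤ δ * x ^ 2 + 4 * Set.indicator {y : ℝ | δ < |y|} (fun y => y ^ 2) x := by
  have hsmall : |x| ≤ 1 → ‖Complex.exp (x * Complex.I) - 1 - x * Complex.I + (x : ℂ) ^ 2 / 2‖
      ≤ |x| ^ 3 := by
    intro hx
    have h1 : ‖(x : ℂ) * Complex.I‖ = |x| := by simp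
    have h := Complex.exp_bound (x := (x : ℂ) * Complex.I) (by rw [h1]; exact hx)
      (n := 3) (by norm_num)
    rw [h1] at h
    have h2 : Complex.exp (x * Complex.I) - 1 - x * Complex.I + (x : ℂ) ^ 2 / 2
        = Complex.exp (x * Complex.I)
          - ∑ m ∈ Finset.range 3, ((x : ℂ) * Complex.I) ^ m / (m.factorial : ℂ) := by
      simp only [Finset.sum_range_succ, Finset.sum_range_zero, mul_pow, Complex.I_sq]
      simp [Nat.factorial]
      ring
    rw [h2]
    refine h.trans (mul_le_of_le_one_right (by positivity) ?_)
    norm_num [Nat.factorial]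
  by_cases hx : δ < |x|
  · rw [Set.indicator_of_mem (by exact hx)]
    rcases le_total |x| 1 with h1 | h1
    · refine (hsmall h1).trans ?_
      have : |x| ^ 3 ≤ x ^ 2 := by
        rw [← sq_abs x]
        exact pow_le_pow_of_le_one (abs_nonneg x) h1 (by norm_num)
      nlinarith [sq_nonneg x]
    · have h2 : ‖Complex.exp (x * Complex.I)‖ = 1 := Complex.norm_exp_ofReal_mul_I x
      have h3 : ‖(x : ℂ) * Complex.I‖ = |x| := by simp
      have h4 : ‖(x : ℂ) ^ 2 / 2‖ = |x| ^ 2 / 2 := by simp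
      have h5 := norm_add_le (Complex.exp (x * Complex.I) - 1 - x * Complex.I) ((x : ℂ) ^ 2 / 2)
      have h6 := norm_sub_le (Complex.exp (x * Complex.I) - 1) (x * Complex.I)
      have h7 := norm_sub_le (Complex.exp (x * Complex.I)) 1
      rw [h4] at h5
      rw [h3] at h6
      rw [h2, norm_one] at h7
      rw [← sq_abs x]
      nlinarith [mul_nonneg hδ (sq_nonneg |x|)]
  · rw [Set.indicator_of_notMem (by exact hx), mul_zero, add_zero]
    rw [not_lt] at hx
    refine (hsmall (hx.trans hδ1)).trans ?_
    rw [← sq_abs x, pow_succ, mul_comm]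
    gcongr

namespace HasLinearBracket

variable {Ω : Type*} {mΩ : MeasurableSpace Ω} {μ : Measure Ω}
variable {T κ : ℝ} {𝓕 : Filtration (Set.Icc (0 : ℝ) T) mΩ} {X : Ω → C(Set.Icc (0 : ℝ) T, ℝ)}

/-- Some increment among the first `n` ones along `τ` exceeds `δ`. -/
def bigIncrement (X : Ω → C(Set.Icc (0 : ℝ) T, ℝ)) (τ : ℕ → Set.Icc (0 : ℝ) T) (δ : ℝ) (n : ℕ) :
    Set Ω := {ω | ∃ j < n, δ < |X ω (τ (j + 1)) - X ω (τ j)|}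

theorem bigIncrement_mono (X : Ω → C(Set.Icc (0 : ℝ) T, ℝ)) (τ : ℕ → Set.Icc (0 : ℝ) T) (δ : ℝ) :
    Monotone (bigIncrement X τ δ) := fun _ _ h _ ⟨j, hj, hω⟩ => ⟨j, hj.trans_le h, hω⟩

theorem measurableSet_bigIncrement (h : HasLinearBracket 𝓕 μ κ X) {τ : ℕ → Set.Icc (0 : ℝ) T}
    (hτ : Monotone τ) (δ : ℝ) (n : ℕ) : MeasurableSet[𝓕 (τ n)] (bigIncrement X τ δ n) := by
  have : bigIncrement X τ δ n = ⋃ j ∈ Finset.range n, {ω | δ < |X ω (τ (j + 1)) - X ω (τ j)|} := by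
    ext ω
    simp [bigIncrement]
  rw [this]
  refine Finset.measurableSet_biUnion _ fun j hj => ?_
  have hj' : j + 1 ≤ n := Finset.mem_range.1 hj
  have h1 : StronglyMeasurable[𝓕 (τ n)] fun ω => X ω (τ (j + 1)) :=
    (h.measurable _).mono (𝓕.mono (hτ hj'))
  have h2 : StronglyMeasurable[𝓕 (τ n)] fun ω => X ω (τ j) :=
    (h.measurable _).mono (𝓕.mono (hτ (by omega)))
  have h3 : Measurable[𝓕 (τ n)] fun ω => |X ω (τ (j + 1)) - X ω (τ j)| :=
    ((h1.sub h2).norm).measurable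
  exact h3 measurableSet_Ioi

/-- The first big increment is paid for by the sup norm. Every later one is paid for by its square
times the indicator of an event that precedes it, so that the bracket can be used under the
expectation. -/
theorem sum_indicator_sq_le (X : Ω → C(Set.Icc (0 : ℝ) T, ℝ)) (τ : ℕ → Set.Icc (0 : ℝ) T) (δ : ℝ)
    (n : ℕ) (ω : Ω) :
    ∑ j ∈ Finset.range n,
        Set.indicator {y : ℝ | δ < |y|} (fun y => y ^ 2) (X ω (τ (j + 1)) - X ω (τ j))
      ≤ (bigIncrement X τ δ n).indicator (fun ω => 4 * ‖X ω‖ ^ 2) ω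
        + ∑ j ∈ Finset.range n, (X ω (τ (j + 1)) - X ω (τ j)) ^ 2
          • (bigIncrement X τ δ j).indicator (fun _ => (1 : ℝ)) ω := by
  induction n with
  | zero => simp [bigIncrement]
  | succ n ih =>
    rw [Finset.sum_range_succ, Finset.sum_range_succ]
    by_cases hB : ω ∈ bigIncrement X τ δ n
    · have hB' : ω ∈ bigIncrement X τ δ (n + 1) := bigIncrement_mono X τ δ n.le_succ hB
      rw [Set.indicator_of_mem hB] at ih
      rw [Set.indicator_of_mem hB', Set.indicator_of_mem hB, smul_eq_mul, mul_one]
      have := Set.indicator_le_self' (s := {y : ℝ | δ < |y|}) (f := fun y : ℝ => y ^ 2)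
        (fun x _ => sq_nonneg x) (X ω (τ (n + 1)) - X ω (τ n))
      linarith
    · rw [Set.indicator_of_notMem hB] at ih
      rw [Set.indicator_of_notMem hB, smul_zero, add_zero]
      by_cases hn : δ < |X ω (τ (n + 1)) - X ω (τ n)|
      · have hB' : ω ∈ bigIncrement X τ δ (n + 1) := ⟨n, n.lt_succ_self, hn⟩
        rw [Set.indicator_of_mem hB', Set.indicator_of_mem (by exact hn)]
        have h1 : |X ω (τ (n + 1)) - X ω (τ n)| ≤ 2 * ‖X ω‖ := by
          refine (abs_sub _ _).trans ?_
          have h2 := (X ω).norm_coe_le_norm (τ (n + 1))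
          have h3 := (X ω).norm_coe_le_norm (τ n)
          rw [Real.norm_eq_abs] at h2 h3
          linarith
        have h4 : (X ω (τ (n + 1)) - X ω (τ n)) ^ 2 ≤ 4 * ‖X ω‖ ^ 2 := by
          rw [← sq_abs]
          nlinarith [abs_nonneg (X ω (τ (n + 1)) - X ω (τ n))]
        linarith
      · rw [Set.indicator_of_notMem (by exact hn)]
        have : 0 ≤ (bigIncrement X τ δ (n + 1)).indicator (fun ω => 4 * ‖X ω‖ ^ 2) ω :=
          Set.indicator_nonneg (fun _ _ => by positivity) _
        linarith

theorem eventually_notMem_bigIncrement (X : Ω → C(Set.Icc (0 : ℝ) T, ℝ)) (hT : 0 ≤ T) {δ : ℝ}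
    (hδ : 0 < δ) (s t : Set.Icc (0 : ℝ) T) (ω : Ω) :
    ∀ᶠ N : ℕ in atTop, ω ∉ bigIncrement X (gridTime hT s ((t - s : ℝ) / N)) δ N := by
  have huc := CompactSpace.uniformContinuous_of_continuous (X ω).continuous
  rw [Metric.uniformContinuous_iff] at huc
  obtain ⟨η, hη, hX⟩ := huc δ hδ
  have hlim : Tendsto (fun N : ℕ => |(t - s : ℝ) / N|) atTop (𝓝 0) := by
    simpa using (tendsto_const_div_atTop_nhds_zero_nat (t - s : ℝ)).abs
  filter_upwards [hlim.eventually (eventually_lt_nhds hη)] with N hN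
  rintro ⟨j, -, hj⟩
  have hd : dist (gridTime hT s ((t - s : ℝ) / N) (j + 1)) (gridTime hT s ((t - s : ℝ) / N) j)
      < η := by
    refine lt_of_le_of_lt ?_ hN
    rw [Subtype.dist_eq, Real.dist_eq]
    refine (Set.abs_projIcc_sub_projIcc hT).trans_eq ?_
    congr 1
    push_cast
    ring
  have := hX hd
  rw [Real.dist_eq] at this
  linarith

variable [IsProbabilityMeasure μ]

/-- The Lindeberg condition for the increments along uniform partitions. -/
theorem tendsto_lindeberg (h : HasLinearBracket 𝓕 μ κ X) (hT : 0 ≤ T) (hκ : 0 ≤ κ)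
    (h0 : ∀ ω, X ω ⟨0, le_rfl, hT⟩ = 0) {δ : ℝ} (hδ : 0 < δ) {s t : Set.Icc (0 : ℝ) T}
    (hst : s ≤ t) :
    Tendsto (fun N : ℕ => ∑ j ∈ Finset.range N, ∫ ω, Set.indicator {y : ℝ | δ < |y|}
      (fun y => y ^ 2) (X ω (gridTime hT s ((t - s : ℝ) / N) (j + 1))
        - X ω (gridTime hT s ((t - s : ℝ) / N) j)) ∂μ) atTop (𝓝 0) := by
  have hst' : (0 : ℝ) ≤ t - s := sub_nonneg.2 hst
  set τ : ℕ → ℕ → Set.Icc (0 : ℝ) T := fun N => gridTime hT s ((t - s : ℝ) / N) with hτ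
  have hτm : ∀ N, Monotone (τ N) := fun N => gridTime_mono hT _ (by positivity)
  set B : ℕ → ℕ → Set Ω := fun N => bigIncrement X (τ N) δ with hB
  have hBm : ∀ N n, MeasurableSet (B N n) := fun N n =>
    (𝓕.le _) _ (h.measurableSet_bigIncrement (hτm N) δ n)
  have hlim1 : Tendsto (fun N => ∫ ω, (B N N).indicator (fun ω => 4 * ‖X ω‖ ^ 2) ω ∂μ) atTop
      (𝓝 0) := by
    have := tendsto_integral_of_dominated_convergence (μ := μ)
      (F := fun N ω => (B N N).indicator (fun ω => 4 * ‖X ω‖ ^ 2) ω) (f := fun _ => 0)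
      (fun ω => 4 * ‖X ω‖ ^ 2)
      (fun N => ((((h.measurable_norm hT).pow_const 2).const_mul 4).indicator
        (hBm N N)).aestronglyMeasurable)
      ((h.integrable_norm_sq hT h0).const_mul 4) (fun N => Eventually.of_forall fun ω => ?_)
      (Eventually.of_forall fun ω => ?_)
    · simpa using this
    · refine (norm_indicator_le_norm_self _ _).trans_eq ?_
      rw [Real.norm_of_nonneg (by positivity)]
    · refine tendsto_const_nhds.congr' ?_
      filter_upwards [eventually_notMem_bigIncrement X hT hδ s t ω] with N hN
      rw [Set.indicator_of_notMem hN]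
  have hlim2 : Tendsto (fun N => ∫ ω, (B N N).indicator (fun _ => (1 : ℝ)) ω ∂μ) atTop (𝓝 0) := by
    have := tendsto_integral_of_dominated_convergence (μ := μ)
      (F := fun N ω => (B N N).indicator (fun _ => (1 : ℝ)) ω) (f := fun _ => 0)
      (fun ω => 1) (fun N => (measurable_const.indicator (hBm N N)).aestronglyMeasurable)
      (integrable_const 1) (fun N => Eventually.of_forall fun ω => ?_)
      (Eventually.of_forall fun ω => ?_)
    · simpa using this
    · exact (norm_indicator_le_norm_self _ _).trans_eq norm_one
    · refine tendsto_const_nhds.congr' ?_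
      filter_upwards [eventually_notMem_bigIncrement X hT hδ s t ω] with N hN
      rw [Set.indicator_of_notMem hN]
  have hbound : ∀ᶠ N : ℕ in atTop, ∑ j ∈ Finset.range N, ∫ ω, Set.indicator {y : ℝ | δ < |y|}
      (fun y => y ^ 2) (X ω (τ N (j + 1)) - X ω (τ N j)) ∂μ
      ≤ ∫ ω, (B N N).indicator (fun ω => 4 * ‖X ω‖ ^ 2) ω ∂μ
        + (t - s) * κ * ∫ ω, (B N N).indicator (fun _ => (1 : ℝ)) ω ∂μ := by
    filter_upwards [eventually_gt_atTop 0] with N hN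
    have hNR : (0 : ℝ) < N := by positivity
    have hms : Measurable fun y : ℝ => Set.indicator {y : ℝ | δ < |y|} (fun y => y ^ 2) y :=
      (measurable_id.pow_const 2).indicator (measurableSet_lt measurable_const measurable_id.abs)
    have hi1 : ∀ j ∈ Finset.range N, Integrable (fun ω => Set.indicator {y : ℝ | δ < |y|}
        (fun y => y ^ 2) (X ω (τ N (j + 1)) - X ω (τ N j))) μ := by
      intro j _
      refine (h.integrable_sq_sub (τ N j) (τ N (j + 1))).mono'
        (hms.comp ((h.measurable' _).sub (h.measurable' _))).aestronglyMeasurable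
        (Eventually.of_forall fun ω => ?_)
      refine (norm_indicator_le_norm_self _ _).trans_eq ?_
      rw [Real.norm_of_nonneg (sq_nonneg _)]
    have hi2 : Integrable (fun ω => (B N N).indicator (fun ω => 4 * ‖X ω‖ ^ 2) ω) μ :=
      ((h.integrable_norm_sq hT h0).const_mul 4).indicator (hBm N N)
    have hi3 : ∀ j ∈ Finset.range N, Integrable (fun ω => (X ω (τ N (j + 1)) - X ω (τ N j)) ^ 2
        • (B N j).indicator (fun _ => (1 : ℝ)) ω) μ := by
      intro j _
      refine (h.integrable_sq_sub (τ N j) (τ N (j + 1))).smul_bdd 1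
        (measurable_const.indicator (hBm N j)).aestronglyMeasurable
        (Eventually.of_forall fun ω => ?_)
      exact (norm_indicator_le_norm_self _ _).trans_eq norm_one
    rw [← integral_finsetSum _ hi1]
    refine (integral_mono (integrable_finsetSum _ hi1) (hi2.add (integrable_finsetSum _ hi3))
      (sum_indicator_sq_le X (τ N) δ N)).trans ?_
    rw [integral_add' hi2 (integrable_finsetSum _ hi3), integral_finsetSum _ hi3]
    gcongr
    -- The event `B N j` is known at the start of the j-th interval, so the conditional variance
    -- (t-s)κ/N factors out; the event is then enlarged to `B N N`.
    have hterm : ∀ j ∈ Finset.range N, ∫ ω, (X ω (τ N (j + 1)) - X ω (τ N j)) ^ 2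
        • (B N j).indicator (fun _ => (1 : ℝ)) ω ∂μ
        ≤ (t - s) / N * κ * ∫ ω, (B N N).indicator (fun _ => (1 : ℝ)) ω ∂μ := by
      intro j hj
      have hj' := Finset.mem_range.1 hj
      rw [h.integral_sq_sub_smul (hτm N j.le_succ) (B := 1)
        (stronglyMeasurable_const.indicator (h.measurableSet_bigIncrement (hτm N) δ j))
        (fun ω => (norm_indicator_le_norm_self (fun _ => (1 : ℝ)) ω).trans_eq norm_one), smul_eq_mul]
      have e1 := gridTime_coe hT (gridTime_mem hst hN (j := j + 1) hj')
      have e2 := gridTime_coe hT (gridTime_mem hst hN (j := j) hj'.le)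
      have e3 : (τ N (j + 1) : ℝ) - τ N j = (t - s) / N := by
        rw [hτ]
        simp only
        rw [e1, e2]
        push_cast
        ring
      rw [e3]
      gcongr ?_ * ?_
      refine integral_mono ((integrable_const 1).indicator (hBm N j))
        ((integrable_const 1).indicator (hBm N N)) fun ω => ?_
      exact Set.indicator_le_indicator_of_subset (bigIncrement_mono X (τ N) δ hj'.le)
        (fun _ => zero_le_one) ω
    refine (Finset.sum_le_sum hterm).trans_eq ?_
    rw [Finset.sum_const, Finset.card_range, nsmul_eq_mul]
    field_simp
  refine squeeze_zero' (Eventually.of_forall fun N => Finset.sum_nonneg fun j _ =>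
    integral_nonneg fun ω => Set.indicator_nonneg (fun _ _ => sq_nonneg _) _) hbound ?_
  simpa using hlim1.add (hlim2.const_mul ((t - s) * κ))

end HasLinearBracket

end OrnsteinUhlenbeck

/-! ### Lévy's characterization. -/

namespace OrnsteinUhlenbeck

/-- In an approximate geometric recursion the errors merely add up, since multiplication by `q` does
not enlarge them. -/
theorem norm_sub_pow_mul_le {a : ℕ → ℂ} {q : ℂ} (hq : ‖q‖ ≤ 1) {e : ℕ → ℝ}
    (h : ∀ j, ‖a (j + 1) - q * a j‖ ≤ e j) (n : ℕ) :
    ‖a n - q ^ n * a 0‖ ≤ ∑ j ∈ Finset.range n, e j := by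
  induction n with
  | zero => simp
  | succ n ih =>
    have e1 : a (n + 1) - q ^ (n + 1) * a 0 = (a (n + 1) - q * a n) + q * (a n - q ^ n * a 0) := by
      ring
    rw [e1, Finset.sum_range_succ, add_comm]
    refine (norm_add_le _ _).trans ?_
    rw [norm_mul]
    linarith [h n, mul_le_of_le_one_left (norm_nonneg (a n - q ^ n * a 0)) hq]

namespace HasLinearBracket

variable {Ω : Type*} {mΩ : MeasurableSpace Ω} {μ : Measure Ω}
variable {T κ : ℝ} {𝓕 : Filtration (Set.Icc (0 : ℝ) T) mΩ} {X : Ω → C(Set.Icc (0 : ℝ) T, ℝ)}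
variable [IsProbabilityMeasure μ]

/-- Second-order expansion of the exponential: the linear term vanishes by the martingale property,
the quadratic term is given by the bracket, and the remainder is of Lindeberg type. -/
theorem norm_integral_exp_sub_le (h : HasLinearBracket 𝓕 μ κ X) {s t : Set.Icc (0 : ℝ) T}
    (hst : s ≤ t) {ζ : Ω → ℂ} {B δ : ℝ} (hζ : StronglyMeasurable[𝓕 s] ζ) (hB : ∀ ω, ‖ζ ω‖ ≤ B)
    (hδ : 0 ≤ δ) (hδ1 : δ ≤ 1) :
    ‖∫ ω, Complex.exp ((X ω t - X ω s : ℝ) * Complex.I) * ζ ω ∂μ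
      - (1 - ((t : ℝ) - s) * κ / 2 : ℝ) * ∫ ω, ζ ω ∂μ‖
      ≤ B * (δ * (((t : ℝ) - s) * κ) + 4 * ∫ ω, Set.indicator {y : ℝ | δ < |y|}
        (fun y => y ^ 2) (X ω t - X ω s) ∂μ) := by
  have hζ' := (hζ.mono (𝓕.le s)).aestronglyMeasurable (μ := μ)
  have hexp : Continuous fun x : ℝ => Complex.exp (x * Complex.I) := by fun_prop
  have hΔm : Measurable fun ω => X ω t - X ω s := (h.measurable' t).sub (h.measurable' s)
  have i0 : Integrable ζ μ := (integrable_const B).mono' hζ' (Eventually.of_forall hB)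
  have i1 : Integrable (fun ω => Complex.exp ((X ω t - X ω s : ℝ) * Complex.I) * ζ ω) μ := by
    refine (integrable_const B).mono'
      ((hexp.measurable.comp hΔm).aestronglyMeasurable.mul hζ') (Eventually.of_forall fun ω => ?_)
    rw [norm_mul, Complex.norm_exp_ofReal_mul_I, one_mul]
    exact hB ω
  have hζI : StronglyMeasurable[𝓕 s] fun ω => Complex.I * ζ ω :=
    hζ.const_mul _
  have hζ2 : MemLp (fun ω => Complex.I * ζ ω) 2 μ :=
    MemLp.of_bound (hζI.mono (𝓕.le s)).aestronglyMeasurable B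
      (Eventually.of_forall fun ω => by simpa using hB ω)
  have i2 : Integrable (fun ω => (X ω t - X ω s) • (Complex.I * ζ ω)) μ :=
    memLp_one_iff_integrable.1 (hζ2.smul (h.memLp_sub s t))
  have i3 : Integrable (fun ω => (X ω t - X ω s) ^ 2 • ζ ω) μ :=
    (h.integrable_sq_sub s t).smul_bdd B hζ' (Eventually.of_forall hB)
  have hms : Measurable fun y : ℝ => Set.indicator {y : ℝ | δ < |y|} (fun y => y ^ 2) y :=
    (measurable_id.pow_const 2).indicator (measurableSet_lt measurable_const measurable_id.abs)
  have i4 : Integrable (fun ω => Set.indicator {y : ℝ | δ < |y|}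
      (fun y => y ^ 2) (X ω t - X ω s)) μ := by
    refine (h.integrable_sq_sub s t).mono' (hms.comp hΔm).aestronglyMeasurable
      (Eventually.of_forall fun ω => (norm_indicator_le_norm_self _ _).trans_eq ?_)
    rw [Real.norm_of_nonneg (sq_nonneg _)]
  have key : ∫ ω, Complex.exp ((X ω t - X ω s : ℝ) * Complex.I) * ζ ω ∂μ
      - (1 - ((t : ℝ) - s) * κ / 2 : ℝ) * ∫ ω, ζ ω ∂μ
      = ∫ ω, (Complex.exp ((X ω t - X ω s : ℝ) * Complex.I) - 1
        - (X ω t - X ω s : ℝ) * Complex.I + ((X ω t - X ω s : ℝ) : ℂ) ^ 2 / 2) * ζ ω ∂μ := by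
    have e : (fun ω => (Complex.exp ((X ω t - X ω s : ℝ) * Complex.I) - 1
        - (X ω t - X ω s : ℝ) * Complex.I + ((X ω t - X ω s : ℝ) : ℂ) ^ 2 / 2) * ζ ω)
        = fun ω => ((Complex.exp ((X ω t - X ω s : ℝ) * Complex.I) * ζ ω - ζ ω)
          - (X ω t - X ω s) • (Complex.I * ζ ω)) + (1 / 2 : ℂ) * ((X ω t - X ω s) ^ 2 • ζ ω) := by
      ext ω
      simp only [Complex.real_smul]
      push_cast
      ring
    have i12 : Integrable (fun ω => Complex.exp ((X ω t - X ω s : ℝ) * Complex.I) * ζ ω - ζ ω) μ :=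
      i1.sub i0
    have i123 : Integrable (fun ω => (Complex.exp ((X ω t - X ω s : ℝ) * Complex.I) * ζ ω - ζ ω)
        - (X ω t - X ω s) • (Complex.I * ζ ω)) μ := i12.sub i2
    rw [e, integral_add i123 (i3.const_mul _), integral_sub i12 i2,
      integral_sub i1 i0, h.integral_smul_sub hst hζI hζ2, integral_const_mul,
      h.integral_sq_sub_smul hst hζ hB, Complex.real_smul]
    push_cast
    ring
  rw [key]
  have hbd : ∀ ω, ‖(Complex.exp ((X ω t - X ω s : ℝ) * Complex.I) - 1
        - (X ω t - X ω s : ℝ) * Complex.I + ((X ω t - X ω s : ℝ) : ℂ) ^ 2 / 2) * ζ ω‖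
      ≤ B * (δ * (X ω t - X ω s) ^ 2
        + 4 * Set.indicator {y : ℝ | δ < |y|} (fun y => y ^ 2) (X ω t - X ω s)) := by
    intro ω
    rw [norm_mul, mul_comm]
    have := norm_exp_mul_I_sub_le (X ω t - X ω s) hδ hδ1
    have hB0 : 0 ≤ B := (norm_nonneg _).trans (hB ω)
    exact mul_le_mul (hB ω) this (norm_nonneg _) hB0
  refine (norm_integral_le_of_norm_le ((((h.integrable_sq_sub s t).const_mul δ).add
    (i4.const_mul 4)).const_mul B) (Eventually.of_forall hbd)).trans_eq ?_
  rw [integral_const_mul]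
  congr 1
  rw [integral_add' ((h.integrable_sq_sub s t).const_mul δ) (i4.const_mul 4), integral_const_mul,
    integral_const_mul, h.integral_sq_sub hst]

/-- Lévy's characterization: the increments of `X` are Gaussian and independent of the past. -/
theorem integral_exp_mul (h : HasLinearBracket 𝓕 μ κ X) (hT : 0 ≤ T) (hκ : 0 ≤ κ)
    (h0 : ∀ ω, X ω ⟨0, le_rfl, hT⟩ = 0) {s t : Set.Icc (0 : ℝ) T}
    (hst : s ≤ t) {ζ : Ω → ℂ} {B : ℝ} (hζ : StronglyMeasurable[𝓕 s] ζ) (hB : ∀ ω, ‖ζ ω‖ ≤ B) :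
    ∫ ω, Complex.exp ((X ω t - X ω s : ℝ) * Complex.I) * ζ ω ∂μ
      = Real.exp (-(((t : ℝ) - s) * κ) / 2) * ∫ ω, ζ ω ∂μ := by
  have hst' : (0 : ℝ) ≤ t - s := sub_nonneg.2 hst
  have hB0 : 0 ≤ B := by
    obtain ⟨ω⟩ := μ.nonempty_of_neZero
    exact (norm_nonneg _).trans (hB ω)
  set q : ℕ → ℝ := fun N => 1 - (t - s : ℝ) / N * κ / 2 with hq
  set Lind : ℝ → ℕ → ℝ := fun δ N => ∑ j ∈ Finset.range N, ∫ ω, Set.indicator {y : ℝ | δ < |y|}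
      (fun y => y ^ 2) (X ω (gridTime hT s ((t - s : ℝ) / N) (j + 1))
        - X ω (gridTime hT s ((t - s : ℝ) / N) j)) ∂μ with hLind
  set I := ∫ ω, Complex.exp ((X ω t - X ω s : ℝ) * Complex.I) * ζ ω ∂μ with hI
  have hstep : ∀ δ, 0 ≤ δ → δ ≤ 1 → ∀ᶠ N : ℕ in atTop,
      ‖I - (q N : ℂ) ^ N * ∫ ω, ζ ω ∂μ‖ ≤ B * (δ * ((t - s) * κ) + 4 * Lind δ N) := by
    intro δ hδ hδ1
    -- For large `N` this places `q N` between 0 and 1, as the error recursion requires.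
    have hq1 : ∀ᶠ N : ℕ in atTop, (t - s : ℝ) / N * κ / 2 < 1 := by
      have : Tendsto (fun N : ℕ => (t - s : ℝ) / N * κ / 2) atTop (𝓝 0) := by
        simpa using ((tendsto_const_div_atTop_nhds_zero_nat (t - s : ℝ)).mul_const κ).div_const 2
      exact this.eventually (eventually_lt_nhds one_pos)
    filter_upwards [eventually_gt_atTop 0, hq1] with N hN hqN
    have hNR : (0 : ℝ) < N := by positivity
    set τ := gridTime hT s ((t - s : ℝ) / N) with hτ
    have hτm : Monotone τ := gridTime_mono hT _ (by positivity)
    have hτ0 : τ 0 = s := gridTime_zero hT s _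
    have hτN : τ N = t := gridTime_last hT s t hN
    set ξ : ℕ → Ω → ℂ := fun j ω => Complex.exp ((X ω (τ j) - X ω s : ℝ) * Complex.I) * ζ ω
    have hexp : Continuous fun x : ℝ => Complex.exp (x * Complex.I) := by fun_prop
    have hξm : ∀ j, StronglyMeasurable[𝓕 (τ j)] (ξ j) := by
      intro j
      have hle : s ≤ τ j := hτ0 ▸ hτm (Nat.zero_le j)
      exact (hexp.comp_stronglyMeasurable ((h.measurable (τ j)).sub
        ((h.measurable s).mono (𝓕.mono hle)))).mul (hζ.mono (𝓕.mono hle))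
    have hξB : ∀ j ω, ‖ξ j ω‖ ≤ B := by
      intro j ω
      simp only [ξ]
      rw [norm_mul, Complex.norm_exp_ofReal_mul_I, one_mul]
      exact hB ω
    have hcoe : ∀ j < N, (τ (j + 1) : ℝ) - τ j = (t - s) / N := by
      intro j hj
      rw [hτ, gridTime_coe hT (gridTime_mem hst hN (j := j + 1) hj),
        gridTime_coe hT (gridTime_mem hst hN (j := j) hj.le)]
      push_cast
      ring
    -- The recursion lemma asks for all `j`, so the sequence is frozen after `N`, and `e` takes a
    -- dummy value there that makes the inequality an equality. Only `j < N` enters the final sum.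
    set a : ℕ → ℂ := fun j => ∫ ω, ξ (min j N) ω ∂μ with ha
    set e : ℕ → ℝ := fun j => if j < N then B * (δ * ((t - s : ℝ) / N * κ)
      + 4 * ∫ ω, Set.indicator {y : ℝ | δ < |y|} (fun y => y ^ 2)
        (X ω (τ (j + 1)) - X ω (τ j)) ∂μ) else ‖(1 - q N : ℂ)‖ * ‖a N‖ with he
    have hrec : ∀ j, ‖a (j + 1) - (q N : ℂ) * a j‖ ≤ e j := by
      intro j
      by_cases hj : j < N
      · have h1 := h.norm_integral_exp_sub_le (hτm j.le_succ) (hξm j) (hξB j) hδ hδ1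
        rw [Nat.succ_eq_add_one, hcoe j hj] at h1
        have h2 : ∀ ω, Complex.exp ((X ω (τ (j + 1)) - X ω (τ j) : ℝ) * Complex.I) * ξ j ω
            = ξ (j + 1) ω := by
          intro ω
          simp only [ξ]
          rw [← mul_assoc, ← Complex.exp_add]
          congr 2
          push_cast
          ring
        simp only [h2] at h1
        simp only [ha, he, hj, if_true]
        rw [min_eq_left hj.le, min_eq_left (Nat.succ_le_of_lt hj)]
        exact h1
      · simp only [ha, he, hj, if_false]
        rw [min_eq_right (by omega), min_eq_right (by omega), min_self, ← norm_mul, sub_mul,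
          one_mul]
    have hqn : ‖(q N : ℂ)‖ ≤ 1 := by
      have h0 : 0 ≤ (t - s : ℝ) / N * κ / 2 := by positivity
      rw [Complex.norm_real, Real.norm_eq_abs, abs_le]
      constructor <;> simp only [hq] <;> linarith
    have hfin := norm_sub_pow_mul_le hqn hrec N
    have haN : a N = I := by simp [ha, hI, hτN, ξ]
    have ha0 : a 0 = ∫ ω, ζ ω ∂μ := by simp [ha, hτ0, ξ]
    rw [haN, ha0] at hfin
    refine hfin.trans_eq ?_
    rw [Finset.sum_congr rfl (fun j hj => if_pos (Finset.mem_range.1 hj)), ← Finset.mul_sum,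
      Finset.sum_add_distrib, ← Finset.mul_sum, Finset.sum_const, Finset.card_range, nsmul_eq_mul]
    congr 2
    · field_simp
    · rw [← Finset.mul_sum]
  have hqlim : Tendsto (fun N : ℕ => (q N : ℂ) ^ N) atTop
      (𝓝 (Real.exp (-(((t : ℝ) - s) * κ) / 2) : ℂ)) := by
    have h1 := Real.tendsto_one_add_div_pow_exp (-(((t : ℝ) - s) * κ) / 2)
    have h2 := (Complex.continuous_ofReal.tendsto _).comp h1
    refine h2.congr fun N => ?_
    simp only [Function.comp, hq]
    push_cast
    congr 1
    ring
  have hlim : ∀ δ, 0 < δ → δ ≤ 1 →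
      ‖I - Real.exp (-(((t : ℝ) - s) * κ) / 2) * ∫ ω, ζ ω ∂μ‖ ≤ B * (δ * ((t - s) * κ)) := by
    intro δ hδ hδ1
    have h1 : Tendsto (fun N : ℕ => B * (δ * ((t - s) * κ) + 4 * Lind δ N)) atTop
        (𝓝 (B * (δ * ((t - s) * κ) + 4 * 0))) :=
      (((h.tendsto_lindeberg hT hκ h0 hδ hst).const_mul 4).const_add _).const_mul B
    rw [mul_zero, add_zero] at h1
    exact le_of_tendsto_of_tendsto (((hqlim.mul_const _).const_sub I).norm) h1
      (hstep δ hδ.le hδ1)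
  -- δ tends to 0 only after N has tended to infinity.
  have hzero : ‖I - Real.exp (-(((t : ℝ) - s) * κ) / 2) * ∫ ω, ζ ω ∂μ‖ ≤ 0 := by
    have h1 : Tendsto (fun n : ℕ => B * (1 / ((n : ℝ) + 1) * ((t - s) * κ))) atTop (𝓝 0) := by
      simpa using ((tendsto_one_div_add_atTop_nhds_zero_nat (𝕜 := ℝ)).mul_const
        ((t - s) * κ)).const_mul B
    refine ge_of_tendsto' h1 fun n => hlim _ (by positivity) ?_
    rw [div_le_one (by positivity)]
    linarith [n.cast_nonneg (α := ℝ)]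
  exact sub_eq_zero.1 (norm_le_zero_iff.1 hzero)

end HasLinearBracket

end OrnsteinUhlenbeck

/-! ### Continuous extension from the dyadics. -/

namespace OrnsteinUhlenbeck

section DyadicExtension

variable {E : Type*} [NormedAddCommGroup E]

/-- The dyadic points of `[0,K]`. -/
def dyadics (K : ℝ) : Set ℝ := {x | ∃ n j : ℕ, j ≤ 2 ^ n ∧ x = j * (K / 2 ^ n)}

theorem dyadics_refine {K : ℝ} {n j : ℕ} (hj : j ≤ 2 ^ n) {m : ℕ} (hm : n ≤ m) :
    j * 2 ^ (m - n) ≤ 2 ^ m ∧ (j : ℝ) * (K / 2 ^ n) = ((j * 2 ^ (m - n) : ℕ) : ℝ) * (K / 2 ^ m) := by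
  obtain ⟨l, rfl⟩ := Nat.exists_eq_add_of_le hm
  rw [Nat.add_sub_cancel_left]
  refine ⟨by rw [pow_add]; gcongr, ?_⟩
  push_cast
  rw [pow_add]
  field_simp

theorem dyadics_subset_Icc {K : ℝ} (hK : 0 ≤ K) : dyadics K ⊆ Set.Icc 0 K := by
  rintro x ⟨n, j, hj, rfl⟩
  refine ⟨by positivity, ?_⟩
  calc (j : ℝ) * (K / 2 ^ n) ≤ (2 ^ n : ℝ) * (K / 2 ^ n) := by
        gcongr
        exact_mod_cast hj
    _ = K := mul_div_cancel₀ K (by positivity)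

theorem exists_dyadic_between {K u : ℝ} (hu : 0 ≤ u) (huK : u < K) {ε : ℝ} (hε : 0 < ε) :
    ∃ d ∈ dyadics K, u ≤ d ∧ d < u + ε := by
  have hK : 0 < K := hu.trans_lt huK
  have hlim : Tendsto (fun n : ℕ => K / 2 ^ n) atTop (𝓝 0) := by
    simpa [div_eq_mul_inv] using
      (tendsto_pow_atTop_nhds_zero_of_lt_one (r := (2⁻¹ : ℝ)) (by norm_num)
        (by norm_num)).const_mul K
  obtain ⟨n, hn⟩ := (hlim.eventually (eventually_lt_nhds hε)).exists
  have hh : 0 < K / 2 ^ n := by positivity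
  refine ⟨⌈u / (K / 2 ^ n)⌉₊ * (K / 2 ^ n), ⟨n, _, ?_, rfl⟩, ?_, ?_⟩
  · refine Nat.ceil_le.2 ?_
    rw [div_le_iff₀ hh]
    push_cast
    rw [mul_div_cancel₀ K (by positivity)]
    exact huK.le
  · rw [← div_le_iff₀ hh]
    exact Nat.le_ceil _
  · have := Nat.ceil_lt_add_one (div_nonneg hu hh.le)
    calc (⌈u / (K / 2 ^ n)⌉₊ : ℝ) * (K / 2 ^ n) < (u / (K / 2 ^ n) + 1) * (K / 2 ^ n) := by gcongr
      _ = u + K / 2 ^ n := by field_simp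
      _ < u + ε := by gcongr

theorem zero_mem_dyadics (K : ℝ) : 0 ∈ dyadics K := ⟨0, 0, by simp, by simp⟩

theorem right_mem_dyadics (K : ℝ) : K ∈ dyadics K := ⟨0, 1, by simp, by simp⟩

theorem Icc_subset_closure_dyadics {K : ℝ} : Set.Icc 0 K ⊆ closure (dyadics K) := by
  intro x hx
  rcases hx.2.eq_or_lt with heq | hlt
  · exact subset_closure (heq ▸ right_mem_dyadics K)
  · rw [Metric.mem_closure_iff]
    intro ε hε
    obtain ⟨d, hd, hxd, hdx⟩ := exists_dyadic_between hx.1 hlt hε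
    refine ⟨d, hd, ?_⟩
    rw [Real.dist_eq, abs_lt]
    constructor <;> linarith

/-- A bound on the square increments along the dyadic partitions gives Hölder continuity. -/
theorem norm_sub_sq_le_of_frequently {K B : ℝ} {φ : ℝ → E}
    (h : ∃ᶠ n : ℕ in atTop, ∑ j ∈ Finset.range (2 ^ n),
      ‖φ ((j + 1 : ℕ) * (K / 2 ^ n)) - φ (j * (K / 2 ^ n))‖ ^ 2 ≤ B * (K / 2 ^ n))
    (hK : 0 < K) {x y : ℝ} (hx : x ∈ dyadics K) (hy : y ∈ dyadics K) (hxy : x ≤ y) :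
    ‖φ y - φ x‖ ^ 2 ≤ B * (y - x) := by
  obtain ⟨n, j, hj, rfl⟩ := hx
  obtain ⟨n', j', hj', rfl⟩ := hy
  -- Dyadic grids are nested, so both points lie on every fine enough grid; this is why a bound at
  -- infinitely many levels suffices. At such a level, Cauchy–Schwarz over the k - i increments
  -- gives (k - i)·B·K/2^m, which is `B` times the distance.
  obtain ⟨m, hm, hB⟩ := (frequently_atTop.1 h) (max n n')
  obtain ⟨h1, e1⟩ := dyadics_refine (K := K) hj ((le_max_left _ _).trans hm)
  obtain ⟨h2, e2⟩ := dyadics_refine (K := K) hj' ((le_max_right _ _).trans hm)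
  rw [e1, e2] at hxy ⊢
  generalize j * 2 ^ (m - n) = i at *
  generalize j' * 2 ^ (m - n') = k at *
  have hh : 0 < K / 2 ^ m := by positivity
  have hik : i ≤ k := by
    have := le_of_mul_le_mul_right hxy hh
    exact_mod_cast this
  have htel : φ (k * (K / 2 ^ m)) - φ (i * (K / 2 ^ m)) = ∑ l ∈ Finset.Ico i k,
      (φ ((l + 1 : ℕ) * (K / 2 ^ m)) - φ (l * (K / 2 ^ m))) :=
    (Finset.sum_Ico_sub (fun l : ℕ => φ (l * (K / 2 ^ m))) hik).symm
  rw [htel]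
  calc _ ≤ (∑ l ∈ Finset.Ico i k, ‖φ ((l + 1 : ℕ) * (K / 2 ^ m)) - φ (l * (K / 2 ^ m))‖) ^ 2 := by
        gcongr
        exact norm_sum_le _ _
    _ ≤ (Finset.Ico i k).card *
        ∑ l ∈ Finset.Ico i k, ‖φ ((l + 1 : ℕ) * (K / 2 ^ m)) - φ (l * (K / 2 ^ m))‖ ^ 2 :=
        sq_sum_le_card_mul_sum_sq
    _ ≤ (Finset.Ico i k).card * (B * (K / 2 ^ m)) := by
        gcongr
        refine (Finset.sum_le_sum_of_subset_of_nonneg ?_ fun _ _ _ => sq_nonneg _).trans hB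
        intro l hl
        rw [Finset.mem_range]
        exact (Finset.mem_Ico.1 hl).2.trans_le h2
    _ = B * (k * (K / 2 ^ m) - i * (K / 2 ^ m)) := by
        rw [Nat.card_Ico, Nat.cast_sub hik]
        ring

theorem exists_continuous_extension [CompleteSpace E] {K B : ℝ} (hK : 0 < K) {φ : ℝ → E}
    (h : ∀ x ∈ dyadics K, ∀ y ∈ dyadics K, x ≤ y → ‖φ y - φ x‖ ^ 2 ≤ B * (y - x)) :
    ∃ ψ : ℝ → E, Continuous ψ ∧ ∀ x ∈ dyadics K, ψ x = φ x := by
  have hdist : ∀ x ∈ dyadics K, ∀ y ∈ dyadics K, dist (φ x) (φ y) ^ 2 ≤ |B| * dist x y := by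
    intro x hx y hy
    rcases le_total x y with hxy | hxy
    · rw [dist_comm, dist_eq_norm, dist_comm, Real.dist_eq, abs_of_nonneg (sub_nonneg.2 hxy)]
      exact (h x hx y hy hxy).trans
        (mul_le_mul_of_nonneg_right (le_abs_self B) (sub_nonneg.2 hxy))
    · rw [dist_eq_norm, Real.dist_eq, abs_of_nonneg (sub_nonneg.2 hxy)]
      exact (h y hy x hx hxy).trans
        (mul_le_mul_of_nonneg_right (le_abs_self B) (sub_nonneg.2 hxy))
  have hmod : ∀ ε > 0, ∃ δ > 0, ∀ x ∈ dyadics K, ∀ y ∈ dyadics K, dist x y < δ →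
      dist (φ x) (φ y) < ε := by
    intro ε hε
    refine ⟨ε ^ 2 / (|B| + 1), by positivity, fun x hx y hy hxy => ?_⟩
    refine lt_of_pow_lt_pow_left₀ 2 hε.le ((hdist x hx y hy).trans_lt ?_)
    rw [lt_div_iff₀ (by positivity)] at hxy
    nlinarith [dist_nonneg (x := x) (y := y), sq_pos_of_pos hε, abs_nonneg B]
  have hcauchy : ∀ x ∈ Set.Icc 0 K, ∃ y, Tendsto φ (𝓝[dyadics K] x) (𝓝 y) := by
    intro x hx
    have : (𝓝[dyadics K] x).NeBot := mem_closure_iff_nhdsWithin_neBot.1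
      (Icc_subset_closure_dyadics hx)
    refine CompleteSpace.complete (Metric.cauchy_iff.2 ⟨inferInstance, fun ε hε => ?_⟩)
    obtain ⟨δ, hδ, hφ⟩ := hmod ε hε
    refine ⟨φ '' (Metric.ball x (δ / 2) ∩ dyadics K), image_mem_map
      (Set.inter_comm _ _ ▸ inter_mem_nhdsWithin _ (Metric.ball_mem_nhds x (half_pos hδ))), ?_⟩
    · rintro _ ⟨a, ⟨ha, ha'⟩, rfl⟩ _ ⟨b, ⟨hb, hb'⟩, rfl⟩
      refine hφ a ha' b hb' ?_
      calc dist a b ≤ dist a x + dist b x := dist_triangle_right _ _ _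
        _ < δ / 2 + δ / 2 := add_lt_add ha hb
        _ = δ := add_halves δ
  have hcont := continuousOn_extendFrom Icc_subset_closure_dyadics hcauchy
  refine ⟨Set.IccExtend hK.le ((Set.Icc 0 K).domRestrict (extendFrom (dyadics K) φ)),
    (continuousOn_iff_continuous_domRestrict.1 hcont).Icc_extend', fun x hx => ?_⟩
  have hxI := dyadics_subset_Icc hK.le hx
  rw [Set.IccExtend_of_mem _ _ hxI, Set.domRestrict_apply]
  refine extendFrom_eq (subset_closure hx) ?_
  rw [Metric.tendsto_nhdsWithin_nhds]
  intro ε hε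
  obtain ⟨δ, hδ, hφ⟩ := hmod ε hε
  exact ⟨δ, hδ, fun {y} hy hyx => hφ y hy x hx hyx⟩

end DyadicExtension

end OrnsteinUhlenbeck

/-! ### Random linear maps along semigroup orbits. -/

namespace OrnsteinUhlenbeck

variable {C : Type*} [AddCommGroup C] [Module ℝ C] [TopologicalSpace C]
  [IsTopologicalAddGroup C] [ContinuousSMul ℝ C]
variable {A : C →ₗ[ℝ] C} {P : ℝ≥0 → C →L[ℝ] C} {p : Seminorm ℝ C}

theorem tendsto_div_two_pow {K : ℝ} (hK : 0 < K) :
    Tendsto (fun n : ℕ => (K / 2 ^ n).toNNReal) atTop (𝓝[>] 0) := by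
  refine tendsto_nhdsWithin_iff.2 ⟨?_, Eventually.of_forall fun n =>
    Real.toNNReal_pos.2 (by positivity)⟩
  have hlim : Tendsto (fun n : ℕ => K / 2 ^ n) atTop (𝓝 0) := by
    simpa [div_eq_mul_inv] using
      (tendsto_pow_atTop_nhds_zero_of_lt_one (r := (2⁻¹ : ℝ)) (by norm_num)
        (by norm_num)).const_mul K
  simpa [Function.comp_def] using (continuous_real_toNNReal.tendsto 0).comp hlim

namespace IsSemigroupOf

theorem eventually_seminorm_le (hP : IsSemigroupOf A P) (hp : Continuous p) (H : C) {K η : ℝ}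
    (hK : 0 < K) (hη : 0 < η) : ∀ᶠ n : ℕ in atTop, ∀ j : ℕ, j ≤ 2 ^ n →
      p (P ((j + 1 : ℕ) * (K / 2 ^ n)).toNNReal H - P (j * (K / 2 ^ n)).toNNReal H
        - (K / 2 ^ n) • P (j * (K / 2 ^ n)).toNNReal (A H)) ≤ η * (K / 2 ^ n) := by
  filter_upwards [(tendsto_div_two_pow hK).eventually
    (hP.eventually_le hp (fun a H => map_smul_eq_mul p a H) H K.toNNReal hη)] with n hn j hj
  have hh : 0 ≤ K / 2 ^ n := by positivity
  have h1 := hn (j * (K / 2 ^ n)).toNNReal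
    (Real.toNNReal_le_toNNReal (dyadics_subset_Icc hK.le ⟨n, j, hj, rfl⟩).2)
  rw [← Real.toNNReal_add (by positivity) hh, Real.coe_toNNReal _ hh] at h1
  have e : ((j + 1 : ℕ) : ℝ) * (K / 2 ^ n) = j * (K / 2 ^ n) + K / 2 ^ n := by
    push_cast
    ring
  rw [e]
  exact h1

theorem exists_seminorm_increment_le (hP : IsSemigroupOf A P) (hp : Continuous p) (H : C) {K : ℝ}
    (hK : 0 < K) : ∃ b : ℝ, 0 ≤ b ∧ ∀ᶠ n : ℕ in atTop, ∀ j : ℕ, j ≤ 2 ^ n →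
      p (P ((j + 1 : ℕ) * (K / 2 ^ n)).toNNReal H - P (j * (K / 2 ^ n)).toNNReal H)
        ≤ b * (K / 2 ^ n) := by
  have hc : Continuous fun x : ℝ => p (P x.toNNReal (A H)) :=
    hp.comp ((hP.continuous_apply (A H)).comp continuous_real_toNNReal)
  obtain ⟨b, hb⟩ := (isCompact_Icc (a := (0 : ℝ)) (b := K)).exists_bound_of_continuousOn
    hc.continuousOn
  have hb0 : 0 ≤ b := (norm_nonneg _).trans (hb 0 ⟨le_rfl, hK.le⟩)
  refine ⟨1 + b, by positivity, ?_⟩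
  filter_upwards [hP.eventually_seminorm_le hp H hK one_pos] with n hn j hj
  have hh : 0 ≤ K / 2 ^ n := by positivity
  have h1 := hn j hj
  have h2 := (le_abs_self _).trans (hb _ (dyadics_subset_Icc hK.le ⟨n, j, hj, rfl⟩))
  have h3 := map_add_le_add p (P ((j + 1 : ℕ) * (K / 2 ^ n)).toNNReal H
    - P (j * (K / 2 ^ n)).toNNReal H - (K / 2 ^ n) • P (j * (K / 2 ^ n)).toNNReal (A H))
    ((K / 2 ^ n) • P (j * (K / 2 ^ n)).toNNReal (A H))
  rw [sub_add_cancel, map_smul_eq_mul, Real.norm_of_nonneg hh] at h3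
  nlinarith

end IsSemigroupOf

/-- A random linear map into a normed space whose second moments are controlled by a seminorm. -/
structure IsL2Bounded {Ω : Type*} [MeasurableSpace Ω] {E : Type*} [NormedAddCommGroup E]
    [NormedSpace ℝ E] (μ : Measure Ω) (p : Seminorm ℝ C) (M : ℝ) (Φ : Ω → C →ₗ[ℝ] E) : Prop where
  measurable : ∀ G, Measurable fun ω => ‖Φ ω G‖
  bound : ∀ G, ∫⁻ ω, ENNReal.ofReal (‖Φ ω G‖ ^ 2) ∂μ ≤ ENNReal.ofReal (M * p G ^ 2)

namespace IsL2Bounded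

variable {Ω : Type*} {mΩ : MeasurableSpace Ω} {μ : Measure Ω} {E : Type*} [NormedAddCommGroup E]
    [NormedSpace ℝ E] {M : ℝ} {Φ : Ω → C →ₗ[ℝ] E}

omit [TopologicalSpace C] [IsTopologicalAddGroup C] [ContinuousSMul ℝ C] in
theorem measurable_sq (h : IsL2Bounded μ p M Φ) (G : C) :
    Measurable fun ω => ENNReal.ofReal (‖Φ ω G‖ ^ 2) :=
  ((h.measurable G).pow_const 2).ennreal_ofReal

omit [TopologicalSpace C] [IsTopologicalAddGroup C] [ContinuousSMul ℝ C] in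
-- By Fatou, the liminf of the norms vanishes almost surely. The exceptional set does not depend on
-- `z`, so the limit need not be a measurable function of ω.
theorem ae_eq_zero_of_tendsto (h : IsL2Bounded μ p M Φ) {G : ℕ → C}
    (hG : Tendsto (fun n => p (G n)) atTop (𝓝 0)) :
    ∀ᵐ ω ∂μ, ∀ z, Tendsto (fun n => Φ ω (G n)) atTop (𝓝 z) → z = 0 := by
  have h1 : Tendsto (fun n => ∫⁻ ω, ENNReal.ofReal (‖Φ ω (G n)‖ ^ 2) ∂μ) atTop (𝓝 0) := by
    refine tendsto_of_tendsto_of_tendsto_of_le_of_le tendsto_const_nhds ?_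
      (fun _ => zero_le) (fun n => h.bound (G n))
    simpa [Function.comp_def] using
      (ENNReal.continuous_ofReal.tendsto _).comp ((hG.pow 2).const_mul M)
  have h2 : ∫⁻ ω, liminf (fun n => ENNReal.ofReal (‖Φ ω (G n)‖ ^ 2)) atTop ∂μ = 0 :=
    le_antisymm ((lintegral_liminf_le fun n => h.measurable_sq (G n)).trans_eq h1.liminf_eq)
      zero_le
  rw [lintegral_eq_zero_iff (Measurable.liminf fun n => h.measurable_sq (G n))] at h2
  filter_upwards [h2] with ω hω z hz
  have h3 : Tendsto (fun n => ENNReal.ofReal (‖Φ ω (G n)‖ ^ 2)) atTop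
      (𝓝 (ENNReal.ofReal (‖z‖ ^ 2))) :=
    (ENNReal.continuous_ofReal.tendsto _).comp (hz.norm.pow 2)
  rw [h3.liminf_eq, Pi.zero_apply, ENNReal.ofReal_eq_zero] at hω
  have h4 : ‖z‖ = 0 := by nlinarith [norm_nonneg z]
  exact norm_eq_zero.1 h4

/-- With h = K/2^n, each increment has second moment O(h²), so h⁻¹ times the sum of squares has
bounded expectation. By Fatou its liminf is almost surely finite, that is, bounded along infinitely
many levels. -/
theorem ae_frequently (h : IsL2Bounded μ p M Φ) (hM : 0 ≤ M) (hP : IsSemigroupOf A P)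
    (hp : Continuous p) (H : C) {K : ℝ} (hK : 0 < K) :
    ∀ᵐ ω ∂μ, ∃ B : ℝ, ∃ᶠ n : ℕ in atTop, ∑ j ∈ Finset.range (2 ^ n),
      ‖Φ ω (P ((j + 1 : ℕ) * (K / 2 ^ n)).toNNReal H) - Φ ω (P (j * (K / 2 ^ n)).toNNReal H)‖ ^ 2
        ≤ B * (K / 2 ^ n) := by
  obtain ⟨b, hb0, hb⟩ := hP.exists_seminorm_increment_le hp H hK
  set G : ℕ → ℕ → C := fun n j =>
    P ((j + 1 : ℕ) * (K / 2 ^ n)).toNNReal H - P (j * (K / 2 ^ n)).toNNReal H with hG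
  set Λ : ℕ → Ω → ENNReal := fun n ω => ENNReal.ofReal ((K / 2 ^ n)⁻¹) *
    ∑ j ∈ Finset.range (2 ^ n), ENNReal.ofReal (‖Φ ω (G n j)‖ ^ 2) with hΛ
  have hΛm : ∀ n, Measurable (Λ n) := fun n =>
    (Finset.measurable_sum _ fun j _ => h.measurable_sq (G n j)).const_mul _
  have hΛb : ∀ᶠ n in atTop, ∫⁻ ω, Λ n ω ∂μ ≤ ENNReal.ofReal (M * b ^ 2 * K) := by
    filter_upwards [hb] with n hn
    have hh : 0 < K / 2 ^ n := by positivity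
    rw [lintegral_const_mul _ (Finset.measurable_sum _ fun j _ => h.measurable_sq (G n j)),
      lintegral_finsetSum _ fun j _ => h.measurable_sq (G n j)]
    have hterm : ∀ j ∈ Finset.range (2 ^ n), ∫⁻ ω, ENNReal.ofReal (‖Φ ω (G n j)‖ ^ 2) ∂μ
        ≤ ENNReal.ofReal (M * (b * (K / 2 ^ n)) ^ 2) := by
      intro j hj
      refine (h.bound _).trans (ENNReal.ofReal_le_ofReal ?_)
      have := hn j (Finset.mem_range.1 hj).le
      have h0 := apply_nonneg p (G n j)
      gcongr
    calc _ ≤ ENNReal.ofReal ((K / 2 ^ n)⁻¹) *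
          ∑ j ∈ Finset.range (2 ^ n), ENNReal.ofReal (M * (b * (K / 2 ^ n)) ^ 2) := by
          gcongr with j hj
          exact hterm j hj
      _ = ENNReal.ofReal (M * b ^ 2 * K) := by
          rw [Finset.sum_const, Finset.card_range, nsmul_eq_mul, ← ENNReal.ofReal_natCast,
            ← ENNReal.ofReal_mul (by positivity), ← ENNReal.ofReal_mul (by positivity)]
          congr 1
          push_cast
          field_simp
  have hlim : ∫⁻ ω, liminf (fun n => Λ n ω) atTop ∂μ ≠ ⊤ :=
    (((lintegral_liminf_le hΛm).trans (liminf_le_of_frequently_le' hΛb.frequently)).trans_lt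
      ENNReal.ofReal_lt_top).ne
  filter_upwards [ae_lt_top (Measurable.liminf hΛm) hlim] with ω hω
  obtain ⟨B, hB1, hB2⟩ := ENNReal.lt_iff_exists_nnreal_btwn.1 hω
  refine ⟨B, (frequently_lt_of_liminf_lt (by isBoundedDefault) hB1).mono fun n hn => ?_⟩
  have hh : 0 < K / 2 ^ n := by positivity
  simp only [hΛ] at hn
  rw [← ENNReal.ofReal_sum_of_nonneg fun _ _ => sq_nonneg _,
    ← ENNReal.ofReal_mul (by positivity), ← ENNReal.ofReal_coe_nnreal] at hn
  have := (ENNReal.ofReal_le_ofReal_iff B.2).1 hn.le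
  rw [inv_mul_le_iff₀ hh, mul_comm] at this
  simp only [hG, map_sub] at this
  exact this

theorem ae_exists_extension [CompleteSpace E] (h : IsL2Bounded μ p M Φ) (hM : 0 ≤ M)
    (hP : IsSemigroupOf A P) (hp : Continuous p) (H : C) {K : ℝ} (hK : 0 < K) :
    ∀ᵐ ω ∂μ, ∃ ψ : ℝ → E, Continuous ψ ∧ ∀ x ∈ dyadics K, ψ x = Φ ω (P x.toNNReal H) := by
  filter_upwards [h.ae_frequently hM hP hp H hK] with ω ⟨B, hB⟩
  exact exists_continuous_extension hK fun x hx y hy hxy =>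
    norm_sub_sq_le_of_frequently (φ := fun x => Φ ω (P x.toNNReal H)) hB hK hx hy hxy

/-- P_xH - P_0H minus the Riemann sums of P_vAH tends to 0 in the seminorm, even though the integral
need not exist in `C`. Applying `Φ` kills this difference in the limit, and the images of the sums
converge to the integral of `ψ`. -/
theorem ae_integral_eq [CompleteSpace E] (h : IsL2Bounded μ p M Φ)
    (hP : IsSemigroupOf A P) (hp : Continuous p) (H : C) {K : ℝ} (hK : 0 < K) :
    ∀ᵐ ω ∂μ, ∀ ψ : ℝ → E, Continuous ψ → (∀ x ∈ dyadics K, ψ x = Φ ω (P x.toNNReal (A H))) →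
      ∀ x ∈ dyadics K, Φ ω (P x.toNNReal H) - Φ ω (P 0 H) = ∫ v in (0 : ℝ)..x, ψ v := by
  have hcount : (dyadics K).Countable := by
    have : dyadics K ⊆ Set.range fun q : ℕ × ℕ => (q.2 : ℝ) * (K / 2 ^ q.1) := by
      rintro x ⟨n, j, -, rfl⟩
      exact ⟨(n, j), rfl⟩
    exact (Set.countable_range _).mono this
  have hae : ∀ x ∈ dyadics K, ∀ᵐ ω ∂μ, ∀ ψ : ℝ → E, Continuous ψ →
      (∀ x ∈ dyadics K, ψ x = Φ ω (P x.toNNReal (A H))) →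
      Φ ω (P x.toNNReal H) - Φ ω (P 0 H) = ∫ v in (0 : ℝ)..x, ψ v := by
    intro x hx
    rcases (dyadics_subset_Icc hK.le hx).1.eq_or_lt with hx0 | hx0
    · exact Eventually.of_forall fun ω ψ _ _ => by simp [← hx0]
    set G : ℕ → C := fun m => P x.toNNReal H - P 0 H
      - ∑ j ∈ Finset.range (2 ^ m), (x / 2 ^ m) • P (j * (x / 2 ^ m)).toNNReal (A H) with hG
    have hGp : Tendsto (fun m => p (G m)) atTop (𝓝 0) := by
      rw [Metric.tendsto_atTop']
      intro ε hε
      have hη : 0 < ε / (2 * x) := by positivity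
      obtain ⟨N, hN⟩ := eventually_atTop.1 (hP.eventually_seminorm_le hp H hx0 hη)
      refine ⟨N, fun m hm => ?_⟩
      have hxm : (2 : ℝ) ^ m * (x / 2 ^ m) = x := mul_div_cancel₀ x (by positivity)
      have htel := Finset.sum_range_sub (fun j : ℕ => P (j * (x / 2 ^ m)).toNNReal H) (2 ^ m)
      push_cast at htel
      rw [hxm] at htel
      simp only [zero_mul, Real.toNNReal_zero] at htel
      have e : G m = ∑ j ∈ Finset.range (2 ^ m),
          (P ((j + 1 : ℕ) * (x / 2 ^ m)).toNNReal H - P (j * (x / 2 ^ m)).toNNReal H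
            - (x / 2 ^ m) • P (j * (x / 2 ^ m)).toNNReal (A H)) := by
        rw [hG, Finset.sum_sub_distrib]
        push_cast
        rw [htel]
      rw [Real.dist_eq, sub_zero, abs_of_nonneg (apply_nonneg p _), e]
      calc _ ≤ ∑ j ∈ Finset.range (2 ^ m), ε / (2 * x) * (x / 2 ^ m) :=
            (Finset.le_sum_of_subadditive p (map_zero p).le (map_add_le_add p) _ _).trans
              (Finset.sum_le_sum fun j hj => hN m hm.le j (Finset.mem_range.1 hj).le)
        _ = ε / 2 := by
            rw [Finset.sum_const, Finset.card_range, nsmul_eq_mul]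
            push_cast
            field_simp
        _ < ε := half_lt_self hε
    filter_upwards [h.ae_eq_zero_of_tendsto hGp] with ω hω ψ hψ hψD
    have hlim : Tendsto (fun m : ℕ => Φ ω (G m)) atTop
        (𝓝 (Φ ω (P x.toNNReal H) - Φ ω (P 0 H) - ∫ v in (0 : ℝ)..x, ψ v)) := by
      have hpow : Tendsto (fun m : ℕ => 2 ^ m) atTop atTop :=
        tendsto_pow_atTop_atTop_of_one_lt one_lt_two
      have h1 := ((tendsto_riemann_sum hψ hx0.le (p := fun N j => j * (x / N)) fun N hN j hj =>
        ⟨le_rfl, by gcongr; simp⟩).comp hpow).const_sub (Φ ω (P x.toNNReal H) - Φ ω (P 0 H))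
      refine h1.congr fun m => ?_
      simp only [hG, map_sub, map_sum, map_smul, Function.comp]
      congr 1
      push_cast
      refine Finset.sum_congr rfl fun j hj => ?_
      obtain ⟨n, i, hi, hxi⟩ := hx
      -- Subdividing a dyadic `x` of level `n` into `2 ^ m` parts gives dyadics of level `n + m`,
      -- where `ψ` is known.
      rw [hψD _ ⟨n + m, j * i, ?_, ?_⟩]
      · rw [pow_add, mul_comm (2 ^ n)]
        exact Nat.mul_le_mul (Finset.mem_range.1 hj).le hi
      · rw [hxi, pow_add]
        push_cast
        field_simp
    exact sub_eq_zero.1 (hω _ hlim)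
  filter_upwards [(ae_ball_iff hcount).2 hae] with ω hω ψ hψ hψD x hx
  exact hω x hx ψ hψ hψD

end IsL2Bounded

end OrnsteinUhlenbeck

/-! ### Differentiable versions of the noise. -/

namespace OrnsteinUhlenbeck

/-- The integral relations hold on [0,K] only. Replacing each function, from the top level down, by
a primitive of the next one already extended makes them hold as two-sided derivatives on the whole
line. -/
theorem exists_smooth_extension {E : Type*} [NormedAddCommGroup E] [NormedSpace ℝ E]
    [CompleteSpace E] {K : ℝ} (n : ℕ) (φ : ℕ → ℝ → E) (hφ : ∀ k, Continuous (φ k))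
    (hint : ∀ k, ∀ x ∈ Set.Icc 0 K, φ k x = φ k 0 + ∫ v in (0 : ℝ)..x, φ (k + 1) v) :
    ∃ w : ℕ → ℝ → E, (∀ k, Continuous (w k)) ∧
      (∀ k < n, ∀ u, HasDerivAt (w k) (w (k + 1) u) u) ∧ ∀ x ∈ Set.Icc 0 K, w 0 x = φ 0 x := by
  induction n generalizing φ with
  | zero => exact ⟨φ, hφ, by simp, fun _ _ => rfl⟩
  | succ n ih =>
    obtain ⟨w, hw, hd, he⟩ := ih (fun k => φ (k + 1)) (fun k => hφ _) (fun k => hint _)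
    have hd0 : ∀ u, HasDerivAt (fun u => φ 0 0 + ∫ v in (0 : ℝ)..u, w 0 v) (w 0 u) u := fun u =>
      HasDerivAt.const_add (φ 0 0) ((hw 0).integral_hasStrictDerivAt 0 u).hasDerivAt
    have hc0 : Continuous fun u => φ 0 0 + ∫ v in (0 : ℝ)..u, w 0 v :=
      continuous_iff_continuousAt.2 fun u => (hd0 u).continuousAt
    refine ⟨fun k => Nat.casesOn k (fun u => φ 0 0 + ∫ v in (0 : ℝ)..u, w 0 v) w, ?_, ?_, ?_⟩
    · rintro (_ | k)
      exacts [hc0, hw k]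
    · rintro (_ | k) hk u
      · exact hd0 u
      · exact hd k (by omega) u
    · intro x hx
      rw [hint 0 x hx]
      refine congrArg (φ 0 0 + ·) (intervalIntegral.integral_congr fun v hv => ?_)
      rw [Set.uIcc_of_le hx.1] at hv
      exact he v ⟨hv.1, hv.2.trans hx.2⟩

variable {C : Type*} [AddCommGroup C] [Module ℝ C] [TopologicalSpace C]
  [IsTopologicalAddGroup C] [ContinuousSMul ℝ C]
variable {A : C →ₗ[ℝ] C} {P : ℝ≥0 → C →L[ℝ] C} {p : Seminorm ℝ C}
variable {Ω : Type*} {mΩ : MeasurableSpace Ω} {μ : Measure Ω} {E : Type*} [NormedAddCommGroup E]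
    [NormedSpace ℝ E] {M : ℝ} {Φ : Ω → C →ₗ[ℝ] E}

/-- The derivatives of u ↦ Φ(P_uH) should be Φ(P_uA^kH). The extension and integral relations for
all the vectors A^kH involve countably many null sets. -/
theorem IsL2Bounded.ae_exists_smooth [CompleteSpace E] (h : IsL2Bounded μ p M Φ) (hM : 0 ≤ M)
    (hP : IsSemigroupOf A P) (hp : Continuous p) (H : C) {K : ℝ} (hK : 0 < K) (n : ℕ) :
    ∀ᵐ ω ∂μ, ∃ w : ℕ → ℝ → E, (∀ k, Continuous (w k)) ∧
      (∀ k < n, ∀ u, HasDerivAt (w k) (w (k + 1) u) u) ∧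
      ∀ x ∈ dyadics K, w 0 x = Φ ω (P x.toNNReal H) := by
  filter_upwards [ae_all_iff.2 fun k : ℕ => h.ae_exists_extension hM hP hp ((⇑A)^[k] H) hK,
    ae_all_iff.2 fun k : ℕ => h.ae_integral_eq hP hp ((⇑A)^[k] H) hK] with ω h1 h2
  choose φ hφ hφD using h1
  have hint : ∀ k, ∀ x ∈ Set.Icc 0 K, φ k x = φ k 0 + ∫ v in (0 : ℝ)..x, φ (k + 1) v := by
    intro k x hx
    have hcl : IsClosed {x : ℝ | φ k x = φ k 0 + ∫ v in (0 : ℝ)..x, φ (k + 1) v} := by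
      refine isClosed_eq (hφ k) (continuous_const.add ?_)
      exact intervalIntegral.continuous_primitive
        (fun a b => (hφ (k + 1)).intervalIntegrable a b) 0
    refine closure_minimal (fun z hz => ?_) hcl (Icc_subset_closure_dyadics hx)
    have h3 := h2 k (φ (k + 1)) (hφ _)
      (fun y hy => by rw [hφD _ y hy, Function.iterate_succ_apply']) z hz
    rw [Set.mem_ofPred_eq, ← h3, hφD k z hz, hφD k 0 (zero_mem_dyadics K), Real.toNNReal_zero]
    abel
  obtain ⟨w, hw, hd, he⟩ := exists_smooth_extension n φ hφ hint
  exact ⟨w, hw, hd, fun x hx => by rw [he x (dyadics_subset_Icc hK.le hx), hφD 0 x hx]; rfl⟩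

end OrnsteinUhlenbeck

/-! ### The drift martingale as a linear map into path space. -/

namespace OrnsteinUhlenbeck

variable {C : Type*} [AddCommGroup C] [Module ℝ C] [TopologicalSpace C]
  [IsTopologicalAddGroup C] [ContinuousSMul ℝ C] {T : ℝ}

theorem continuous_path_eval (y : DualPath T C) (H : C) : Continuous fun t => y t H :=
  (WeakDual.eval_continuous H).comp y.continuous

theorem continuous_path_projIcc (hT : 0 ≤ T) (y : DualPath T C) (H : C) :
    Continuous fun s : ℝ => y (Set.projIcc 0 T hT s) H :=
  (continuous_path_eval y H).comp continuous_projIcc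

/-- The path `t ↦ y_t(H) - y_0(H) - ∫₀ᵗ y_s(A H) ds`, linear in `H`. -/
noncomputable def driftPath (hT : 0 < T) (A : C →ₗ[ℝ] C) (y : DualPath T C) :
    C →ₗ[ℝ] C(Set.Icc (0 : ℝ) T, ℝ) where
  toFun H := ⟨fun t => y t H - y ⟨0, le_rfl, hT.le⟩ H
      - ∫ s in (0 : ℝ)..(t : ℝ), y (Set.projIcc 0 T hT.le s) (A H), by
    refine ((continuous_path_eval y H).sub continuous_const).sub ?_
    exact (intervalIntegral.continuous_primitive (fun a b =>
      (continuous_path_projIcc hT.le y (A H)).intervalIntegrable a b) 0).comp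
      continuous_subtype_val⟩
  map_add' H G := by
    ext t
    simp only [map_add, ContinuousMap.coe_mk, ContinuousMap.add_apply]
    rw [intervalIntegral.integral_add
      ((continuous_path_projIcc hT.le y (A H)).intervalIntegrable _ _)
      ((continuous_path_projIcc hT.le y (A G)).intervalIntegrable _ _)]
    ring
  map_smul' a H := by
    ext t
    simp only [map_smul, ContinuousMap.coe_mk, ContinuousMap.smul_apply,
      RingHom.id_apply, smul_eq_mul,
      intervalIntegral.integral_const_mul]
    ring

theorem driftPath_apply (hT : 0 < T) (A : C →ₗ[ℝ] C) (y : DualPath T C) (H : C)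
    (t : Set.Icc (0 : ℝ) T) : driftPath hT A y H t = y t H - y ⟨0, le_rfl, hT.le⟩ H
      - ∫ s in (0 : ℝ)..(t : ℝ), y (Set.projIcc 0 T hT.le s) (A H) := rfl

theorem driftPath_zero (hT : 0 < T) (A : C →ₗ[ℝ] C) (y : DualPath T C) (H : C) :
    driftPath hT A y H ⟨0, le_rfl, hT.le⟩ = 0 := by
  simp [driftPath_apply]

theorem driftPath_sub (hT : 0 < T) (A : C →ₗ[ℝ] C) (y : DualPath T C) (H : C)
    (s t : Set.Icc (0 : ℝ) T) : driftPath hT A y H t - driftPath hT A y H s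
      = y t H - y s H - ∫ v in (s : ℝ)..(t : ℝ), y (Set.projIcc 0 T hT.le v) (A H) := by
  have hi : ∀ a b : ℝ, IntervalIntegrable (fun v => y (Set.projIcc 0 T hT.le v) (A H))
      volume a b := fun a b => (continuous_path_projIcc hT.le y (A H)).intervalIntegrable a b
  rw [driftPath_apply, driftPath_apply, ← intervalIntegral.integral_add_adjacent_intervals
    (hi 0 s) (hi s t)]
  ring

namespace IsSolution

variable {Ω : Type*} {mΩ : MeasurableSpace Ω} {μ : Measure Ω} [IsProbabilityMeasure μ]
  {hT : 0 < T} {A : C →ₗ[ℝ] C} {c : C → ℝ} {ν₀ : Measure (WeakDual ℝ C)} {Y : Ω → DualPath T C}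

omit [IsProbabilityMeasure μ] in
theorem hasLinearBracket (h : IsSolution hT A c ν₀ μ Y) (H : C) :
    HasLinearBracket (naturalFiltration Y h.measurable) μ (c H ^ 2)
      fun ω => driftPath hT A (Y ω) H :=
  ⟨h.martingale_drift H, h.martingale_bracket H⟩

theorem integral_sq (h : IsSolution hT A c ν₀ μ Y) (H : C) :
    ∫ ω, driftPath hT A (Y ω) H ⟨T, hT.le, le_rfl⟩ ^ 2 ∂μ = T * c H ^ 2 := by
  have := (h.hasLinearBracket H).integral_sq_sub (s := ⟨0, le_rfl, hT.le⟩) (t := ⟨T, hT.le, le_rfl⟩)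
    hT.le
  simpa only [driftPath_zero, sub_zero] using this

/-- Up to the factor √T, `c H` is the L² norm of M_T(H), which is linear in H, so this is
Minkowski's inequality. It comes from the weighted bound (x+y)² ≤ (1+q/p)x² + (1+p/q)y²; adding ε/2
keeps both weights positive. -/
theorem add_le (h : IsSolution hT A c ν₀ μ Y) (hc : ∀ H, 0 ≤ c H) (H G : C) :
    c (H + G) ≤ c H + c G := by
  refine le_of_forall_pos_le_add fun ε hε => ?_
  have hp : 0 < c H + ε / 2 := by linarith [hc H]
  have hq : 0 < c G + ε / 2 := by linarith [hc G]
  set p := c H + ε / 2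
  set q := c G + ε / 2
  set τ : Set.Icc (0 : ℝ) T := ⟨T, hT.le, le_rfl⟩
  have hm : ∀ F, Integrable (fun ω => driftPath hT A (Y ω) F τ ^ 2) μ := fun F =>
    ((h.hasLinearBracket F).memLp τ).integrable_sq
  have h1 : T * c (H + G) ^ 2 ≤ (1 + q / p) * (T * c H ^ 2) + (1 + p / q) * (T * c G ^ 2) := by
    rw [← h.integral_sq, ← h.integral_sq, ← h.integral_sq, ← integral_const_mul,
      ← integral_const_mul, ← integral_add ((hm H).const_mul _) ((hm G).const_mul _)]
    refine integral_mono (hm _) (((hm H).const_mul _).add ((hm G).const_mul _)) fun ω => ?_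
    simp only [map_add, ContinuousMap.add_apply]
    set x := driftPath hT A (Y ω) H τ
    set y := driftPath hT A (Y ω) G τ
    have : (1 + q / p) * x ^ 2 + (1 + p / q) * y ^ 2 - (x + y) ^ 2
        = (q * x - p * y) ^ 2 / (p * q) := by
      field_simp
      ring
    have h0 : 0 ≤ (q * x - p * y) ^ 2 / (p * q) := by positivity
    linarith
  have h2 : (1 + q / p) * (T * c H ^ 2) + (1 + p / q) * (T * c G ^ 2) ≤ T * (p + q) ^ 2 := by
    calc _ ≤ (1 + q / p) * (T * p ^ 2) + (1 + p / q) * (T * q ^ 2) := by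
          have := hc H
          have := hc G
          gcongr <;> simp only [p, q] <;> linarith
      _ = _ := by
        field_simp
        ring
  have h3 : c (H + G) ^ 2 ≤ (p + q) ^ 2 := le_of_mul_le_mul_left (h1.trans h2) hT
  have h4 := abs_le_of_sq_le_sq h3 (by positivity)
  linarith [(le_abs_self _).trans h4, show p + q = c H + c G + ε by simp only [p, q]; ring]

theorem exists_seminorm (h : IsSolution hT A c ν₀ μ Y) (hc : ∀ H, 0 ≤ c H)
    (hhom : ∀ (a : ℝ) (H : C), c (a • H) = |a| * c H) : ∃ p : Seminorm ℝ C, ⇑p = c :=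
  ⟨Seminorm.of c (h.add_le hc) hhom, rfl⟩

theorem isL2Bounded (h : IsSolution hT A c ν₀ μ Y) {p : Seminorm ℝ C} (hp : ⇑p = c) :
    IsL2Bounded μ p (4 * T) fun ω => driftPath hT A (Y ω) where
  measurable G := (h.hasLinearBracket G).measurable_norm hT.le
  bound G := by
    rw [hp, mul_assoc]
    exact (h.hasLinearBracket G).lintegral_norm_sq_le hT.le fun ω => driftPath_zero hT A _ G

end IsSolution

end OrnsteinUhlenbeck

/-! ### Paths as stochastic convolutions. -/

namespace OrnsteinUhlenbeck

variable {C : Type*} [AddCommGroup C] [Module ℝ C] [TopologicalSpace C]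
  [IsTopologicalAddGroup C] [ContinuousSMul ℝ C] {T : ℝ}
  {A : C →ₗ[ℝ] C} {P : ℝ≥0 → C →L[ℝ] C}

/-- Joint continuity in time and space comes from the sup norm: evaluation is jointly continuous on
continuous paths. -/
theorem smoothNoise_of_path (hT : 0 ≤ T) (s : Set.Icc (0 : ℝ) T)
    {w : ℕ → ℝ → C(Set.Icc (0 : ℝ) T, ℝ)} (hw : ∀ k, Continuous (w k))
    (hd : ∀ k < 3, ∀ u, HasDerivAt (w k) (w (k + 1) u) u) :
    SmoothNoise fun k r u => w k u (Set.projIcc 0 T hT (s + r)) - w k u s where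
  cont k := by
    have hp : Continuous fun p : ℝ × ℝ => Set.projIcc 0 T hT (s + p.1) :=
      continuous_projIcc.comp (by fun_prop)
    have h2 : Continuous fun p : ℝ × ℝ => w k p.2 := (hw k).comp continuous_snd
    exact (h2.eval hp).sub (h2.eval continuous_const)
  deriv k hk r u :=
    ((ContinuousMap.evalCLM ℝ (Set.projIcc 0 T hT (s + r))).hasFDerivAt.comp_hasDerivAt u
      (hd k hk u)).sub ((ContinuousMap.evalCLM ℝ s).hasFDerivAt.comp_hasDerivAt u (hd k hk u))
  zero k u := by simp

/-- For dyadic `u`, where `w 0` is the actual noise, y_{s+r}(P_uH) solves the transport equation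
driven by the increments of `w`. The convolution solves the same equation, so the difference is
homogeneous. It is separately continuous since paths are weak-* continuous and each y_r is
continuous on `C`. -/
theorem transportFamily_of_path (hT : 0 < T) (hP : IsSemigroupOf A P) (y : DualPath T C) (H : C)
    {s t : Set.Icc (0 : ℝ) T} {K : ℝ} {w : ℕ → ℝ → C(Set.Icc (0 : ℝ) T, ℝ)}
    (hw : ∀ k, Continuous (w k)) (hd : ∀ k < 3, ∀ u, HasDerivAt (w k) (w (k + 1) u) u)
    (hD : ∀ x ∈ dyadics K, w 0 x = driftPath hT A y (P x.toNNReal H)) :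
    TransportFamily K (t - s) (dyadics K) fun k r u =>
      y (Set.projIcc 0 T hT.le (s + r)) (P u.toNNReal ((⇑A)^[k] H)) - noiseConvolution
        (fun k r u => w k u (Set.projIcc 0 T hT.le (s + r)) - w k u s) k r u := by
  have hW := smoothNoise_of_path hT.le s hw hd
  have hF : ∀ k u, Continuous fun r : ℝ =>
      y (Set.projIcc 0 T hT.le (s + r)) (P u ((⇑A)^[k] H)) := fun k u =>
    (continuous_path_projIcc hT.le y _).comp (by fun_prop : Continuous fun r : ℝ => (s : ℝ) + r)
  have hct : ∀ k u, Continuous fun r : ℝ => noiseConvolution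
      (fun k r u => w k u (Set.projIcc 0 T hT.le (s + r)) - w k u s) k r u := fun k u =>
    (hW.cont_convolution k).comp (continuous_id.prodMk continuous_const)
  refine ⟨fun k u => (hF k _).sub (hct k u), fun k r => ?_, fun k hk r u hu => ?_, ?_,
    fun u hu huK ε hε => exists_dyadic_between hu huK hε⟩
  · refine Continuous.sub ?_ ((hW.cont_convolution k).comp (continuous_const.prodMk continuous_id))
    exact (y _).continuous.comp ((hP.continuous_apply _).comp continuous_real_toNNReal)
  · refine HasDerivWithinAt.sub ?_ (hW.deriv_convolution hk r u).hasDerivWithinAt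
    rw [Function.iterate_succ_apply']
    exact hP.hasDerivWithinAt (y (Set.projIcc 0 T hT.le (s + r))) _ hu
  · intro u hu r hr
    have hmem : (s : ℝ) + r ∈ Set.Icc 0 T :=
      ⟨add_nonneg s.2.1 hr.1, by linarith [hr.2, t.2.2]⟩
    have h1 := driftPath_sub hT A y (P u.toNNReal H) s (Set.projIcc 0 T hT.le (s + r))
    rw [← hD u hu, Set.projIcc_of_mem hT.le hmem] at h1
    have h2 := intervalIntegral.integral_comp_add_left (a := 0) (b := r)
      (fun v => y (Set.projIcc 0 T hT.le v) (P u.toNNReal (A H))) (s : ℝ)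
    have h3 : ∀ v, y (Set.projIcc 0 T hT.le v) (A (P u.toNNReal H))
        = y (Set.projIcc 0 T hT.le v) (P u.toNNReal (A H)) := fun v =>
      hP.apply_comm (y (Set.projIcc 0 T hT.le v)).continuous H _
    simp only [h3] at h1
    rw [add_zero] at h2
    rw [intervalIntegral.integral_sub ((hF 1 _).intervalIntegrable _ _)
      ((hct 1 _).intervalIntegrable _ _), hW.integral_convolution, hW.convolution_zero]
    simp only [Function.iterate_zero, id, Function.iterate_one, add_zero, Set.projIcc_val,
      Set.projIcc_of_mem hT.le hmem]
    rw [h2]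
    linarith

/-- Constancy along the characteristic from (0, t-s) to (t-s, 0) identifies the limit with the noise
convolution. The length 2(t-s) leaves the room that `apply_eq` demands, and the times remaining to
`t` are its dyadics of level `n + 1`. -/
theorem tendsto_sum_driftPath (hT : 0 < T) (hP : IsSemigroupOf A P) (y : DualPath T C) (H : C)
    {s t : Set.Icc (0 : ℝ) T} (hst : s < t) {w : ℕ → ℝ → C(Set.Icc (0 : ℝ) T, ℝ)}
    (hw : ∀ k, Continuous (w k)) (hd : ∀ k < 3, ∀ u, HasDerivAt (w k) (w (k + 1) u) u)
    (hD : ∀ x ∈ dyadics (2 * (t - s : ℝ)), w 0 x = driftPath hT A y (P x.toNNReal H)) :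
    Tendsto (fun n : ℕ => ∑ j ∈ Finset.range (2 ^ n),
      (driftPath hT A y (P ((t - s : ℝ) - (j + 1 : ℕ) * ((t - s : ℝ) / (2 ^ n : ℕ))).toNNReal H)
          (gridTime hT.le s ((t - s : ℝ) / (2 ^ n : ℕ)) (j + 1))
        - driftPath hT A y (P ((t - s : ℝ) - (j + 1 : ℕ) * ((t - s : ℝ) / (2 ^ n : ℕ))).toNNReal H)
          (gridTime hT.le s ((t - s : ℝ) / (2 ^ n : ℕ)) j))) atTop
      (𝓝 (y t H - y s (P (t - s : ℝ).toNNReal H))) := by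
  have hL : (0 : ℝ) < t - s := sub_pos.2 hst
  have hW := smoothNoise_of_path hT.le s hw hd
  have h1 := (transportFamily_of_path hT hP y H (s := s) (t := t) hw hd hD).apply_eq hL.le
    (by linarith)
  simp only [hW.convolution_zero, add_sub_cancel, add_zero, Set.projIcc_val, Real.toNNReal_zero,
    Function.iterate_zero, id, hP.zero, ContinuousLinearMap.id_apply, sub_zero] at h1
  have h2 := (hW.tendsto_sum_increments hL.le).comp
    (tendsto_pow_atTop_atTop_of_one_lt (one_lt_two : (1 : ℕ) < 2))
  rw [← h1, sub_sub_self]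
  refine h2.congr fun n => Finset.sum_congr rfl fun j hj => ?_
  have hj' : j + 1 ≤ 2 ^ n := Finset.mem_range.1 hj
  have hu : (t - s : ℝ) - (j + 1 : ℕ) * ((t - s : ℝ) / (2 ^ n : ℕ)) ∈
      dyadics (2 * (t - s : ℝ)) := by
    refine ⟨n + 1, 2 ^ n - (j + 1), (Nat.sub_le _ _).trans (Nat.pow_le_pow_right two_pos
      n.le_succ), ?_⟩
    rw [Nat.cast_sub hj', pow_succ]
    push_cast
    field_simp
  simp only [hD _ hu, gridTime]
  ring

end OrnsteinUhlenbeck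

/-! ### The conditional characteristic function. -/

namespace OrnsteinUhlenbeck

theorem stronglyMeasurable_cexp_mul_I {Ω : Type*} {m : MeasurableSpace Ω} {f : Ω → ℝ}
    (hf : StronglyMeasurable[m] f) :
    StronglyMeasurable[m] fun ω => Complex.exp ((f ω : ℝ) * Complex.I) :=
  (by fun_prop : Continuous fun x : ℝ => Complex.exp (x * Complex.I)).comp_stronglyMeasurable hf

variable {C : Type*} [AddCommGroup C] [Module ℝ C] [TopologicalSpace C]
  [IsTopologicalAddGroup C] [ContinuousSMul ℝ C] {T : ℝ}
  {Ω : Type*} {mΩ : MeasurableSpace Ω}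

theorem stronglyMeasurable_naturalFiltration {Y : Ω → DualPath T C} (hY : Measurable Y)
    {s t : Set.Icc (0 : ℝ) T} (hst : s ≤ t) (H : C) :
    StronglyMeasurable[naturalFiltration Y hY t] fun ω => Y ω s H := by
  refine Measurable.stronglyMeasurable (measurable_iff_comap_le.2 ?_)
  exact le_iSup_of_le s (le_iSup_of_le hst (le_iSup_of_le H le_rfl))

namespace IsSolution

variable {μ : Measure Ω} [IsProbabilityMeasure μ] {hT : 0 < T} {A : C →ₗ[ℝ] C}
  {P : ℝ≥0 → C →L[ℝ] C} {c : C → ℝ} {ν₀ : Measure (WeakDual ℝ C)} {Y : Ω → DualPath T C}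

/-- Lévy's characterization peels off the last increment, the earlier ones being absorbed into the
weight. Only one martingale is used at a time, so the test vector may change from step to step. -/
theorem integral_exp_sum (h : IsSolution hT A c ν₀ μ Y) (G : ℕ → C) {τ : ℕ → Set.Icc (0 : ℝ) T}
    (hτ : Monotone τ) {ζ : Ω → ℂ} {B : ℝ}
    (hζ : StronglyMeasurable[naturalFiltration Y h.measurable (τ 0)] ζ) (hB : ∀ ω, ‖ζ ω‖ ≤ B)
    (k : ℕ) :
    ∫ ω, Complex.exp ((∑ j ∈ Finset.range k, (driftPath hT A (Y ω) (G j) (τ (j + 1))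
        - driftPath hT A (Y ω) (G j) (τ j)) : ℝ) * Complex.I) * ζ ω ∂μ
      = Real.exp (-(∑ j ∈ Finset.range k, ((τ (j + 1) : ℝ) - τ j) * c (G j) ^ 2) / 2)
        * ∫ ω, ζ ω ∂μ := by
  induction k with
  | zero => simp
  | succ k ih =>
    have hmeas : ∀ (i : ℕ) (G : C), i ≤ k → StronglyMeasurable[naturalFiltration Y h.measurable
        (τ k)] fun ω => driftPath hT A (Y ω) G (τ i) := fun i G hi =>
      ((h.hasLinearBracket G).measurable (τ i)).mono ((naturalFiltration Y h.measurable).mono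
        (hτ hi))
    have hS : StronglyMeasurable[naturalFiltration Y h.measurable (τ k)] fun ω =>
        ∑ j ∈ Finset.range k, (driftPath hT A (Y ω) (G j) (τ (j + 1))
          - driftPath hT A (Y ω) (G j) (τ j)) :=
      Finset.stronglyMeasurable_fun_sum _ fun j hj =>
        (hmeas _ _ (Finset.mem_range.1 hj)).sub (hmeas _ _ (Finset.mem_range.1 hj).le)
    have := (h.hasLinearBracket (G k)).integral_exp_mul hT.le (sq_nonneg _)
      (fun ω => driftPath_zero hT A _ _) (hτ k.le_succ) (B := B)
      ((stronglyMeasurable_cexp_mul_I hS).mul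
        (hζ.mono ((naturalFiltration Y h.measurable).mono (hτ k.zero_le))))
      (fun ω => by rw [Pi.mul_apply, norm_mul, Complex.norm_exp_ofReal_mul_I, one_mul]; exact hB ω)
    simp only [Pi.mul_apply, Nat.succ_eq_add_one] at this
    rw [ih] at this
    rw [Finset.sum_range_succ, neg_add, add_div, Real.exp_add, mul_comm (Real.exp _),
      Complex.ofReal_mul, mul_assoc, ← this]
    refine integral_congr_ae (Eventually.of_forall fun ω => ?_)
    simp only
    rw [Finset.sum_range_succ, Complex.ofReal_add, add_mul, Complex.exp_add]
    ring

/-- The conditional characteristic function of `Y_t` given the past up to time `s`. -/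
theorem integral_exp_apply (h : IsSolution hT A c ν₀ μ Y) (hc_nonneg : ∀ H, 0 ≤ c H)
    (hc : Continuous c) (hhom : ∀ (a : ℝ) (H : C), c (a • H) = |a| * c H)
    (hP : IsSemigroupOf A P) {s t : Set.Icc (0 : ℝ) T} (hst : s ≤ t) (H : C) {ζ : Ω → ℂ} {B : ℝ}
    (hζ : StronglyMeasurable[naturalFiltration Y h.measurable s] ζ) (hB : ∀ ω, ‖ζ ω‖ ≤ B) :
    ∫ ω, Complex.exp ((Y ω t H : ℝ) * Complex.I) * ζ ω ∂μ
      = Real.exp (-(∫ u in (0 : ℝ)..(t - s), c (P u.toNNReal H) ^ 2) / 2)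
        * ∫ ω, Complex.exp ((Y ω s (P (t - s : ℝ).toNNReal H) : ℝ) * Complex.I) * ζ ω ∂μ := by
  rcases hst.eq_or_lt with rfl | hst
  · simp [hP.zero]
  obtain ⟨p, rfl⟩ := h.exists_seminorm hc_nonneg hhom
  have hL : (0 : ℝ) < t - s := sub_pos.2 hst
  set L : ℝ := t - s with hLdef
  set ζ' : Ω → ℂ := fun ω => Complex.exp ((Y ω s (P L.toNNReal H) : ℝ) * Complex.I) * ζ ω with hζ'
  have hζ'm : StronglyMeasurable[naturalFiltration Y h.measurable s] ζ' :=
    (stronglyMeasurable_cexp_mul_I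
      (stronglyMeasurable_naturalFiltration h.measurable le_rfl _)).mul hζ
  have hζ'B : ∀ ω, ‖ζ' ω‖ ≤ B := fun ω => by
    simpa [hζ', Complex.norm_exp_ofReal_mul_I] using hB ω
  set G : ℕ → ℕ → C := fun n j => P (L - (j + 1 : ℕ) * (L / (2 ^ n : ℕ))).toNNReal H with hG
  set τ : ℕ → ℕ → Set.Icc (0 : ℝ) T := fun n => gridTime hT.le s (L / (2 ^ n : ℕ)) with hτ
  have hτm : ∀ n, Monotone (τ n) := fun n => gridTime_mono hT.le _ (by positivity)
  -- The discretised stochastic convolution, with the deterministic test vector frozen at the right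
  -- end of each interval.
  set R : ℕ → Ω → ℝ := fun n ω => ∑ j ∈ Finset.range (2 ^ n),
    (driftPath hT A (Y ω) (G n j) (τ n (j + 1)) - driftPath hT A (Y ω) (G n j) (τ n j)) with hR
  have hlim : ∀ᵐ ω ∂μ, Tendsto (fun n => R n ω) atTop (𝓝 (Y ω t H - Y ω s (P L.toNNReal H))) := by
    filter_upwards [(h.isL2Bounded rfl).ae_exists_smooth (by positivity) hP hc H
      (K := 2 * L) (by positivity) 3] with ω ⟨w, hw, hd, hD⟩
    exact tendsto_sum_driftPath hT hP (Y ω) H hst hw hd hD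
  have hRm : ∀ n, StronglyMeasurable (R n) := fun n =>
    Finset.stronglyMeasurable_fun_sum _ fun j _ =>
      ((h.hasLinearBracket _).measurable' _).stronglyMeasurable.sub
        ((h.hasLinearBracket _).measurable' _).stronglyMeasurable
  have hζ'M : StronglyMeasurable ζ' := hζ'm.mono ((naturalFiltration Y h.measurable).le s)
  have hl : Tendsto (fun n => ∫ ω, Complex.exp ((R n ω : ℝ) * Complex.I) * ζ' ω ∂μ) atTop
      (𝓝 (∫ ω, Complex.exp ((Y ω t H : ℝ) * Complex.I) * ζ ω ∂μ)) := by
    refine tendsto_integral_of_dominated_convergence (fun _ => B)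
      (fun n => ((stronglyMeasurable_cexp_mul_I (hRm n)).mul hζ'M).aestronglyMeasurable)
      (integrable_const B) (fun n => Eventually.of_forall fun ω => ?_) ?_
    · simpa [Complex.norm_exp_ofReal_mul_I] using hζ'B ω
    · filter_upwards [hlim] with ω hω
      have h1 := ((by fun_prop : Continuous fun x : ℝ =>
        Complex.exp (x * Complex.I) * ζ' ω).tendsto _).comp hω
      have h2 : Complex.exp (((Y ω t H - Y ω s (P L.toNNReal H) : ℝ) : ℂ) * Complex.I) * ζ' ω
          = Complex.exp ((Y ω t H : ℝ) * Complex.I) * ζ ω := by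
        rw [hζ', ← mul_assoc, ← Complex.exp_add]
        congr 2
        push_cast
        ring
      rw [h2] at h1
      exact h1
  have hφ : Continuous fun v : ℝ => p (P (L - v).toNNReal H) ^ 2 :=
    (hc.comp ((hP.continuous_apply H).comp
      (continuous_real_toNNReal.comp (continuous_const.sub continuous_id)))).pow 2
  -- The variances form a right-endpoint Riemann sum of c(P_{L-v}H)², which becomes the stated
  -- integral under u = L - v.
  have hr : Tendsto (fun n : ℕ => ∑ j ∈ Finset.range (2 ^ n),
      ((τ n (j + 1) : ℝ) - τ n j) * p (G n j) ^ 2) atTop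
      (𝓝 (∫ u in (0 : ℝ)..L, p (P u.toNNReal H) ^ 2)) := by
    have h1 := (tendsto_riemann_sum hφ hL.le (p := fun N j => (j + 1 : ℕ) * (L / N))
      fun N hN j hj => ⟨by gcongr; simp, le_rfl⟩).comp
      (tendsto_pow_atTop_atTop_of_one_lt (one_lt_two : (1 : ℕ) < 2))
    rw [intervalIntegral.integral_comp_sub_left (fun u => p (P u.toNNReal H) ^ 2), sub_self,
      sub_zero] at h1
    refine h1.congr fun n => Finset.sum_congr rfl fun j hj => ?_
    have hj' : j + 1 ≤ 2 ^ n := Finset.mem_range.1 hj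
    have e1 := gridTime_coe hT.le (gridTime_mem hst.le (by positivity : 0 < 2 ^ n) hj')
    have e2 := gridTime_coe hT.le (gridTime_mem hst.le (by positivity : 0 < 2 ^ n)
      (j.le_succ.trans hj'))
    simp only [hτ, hG, hLdef, e1, e2, smul_eq_mul]
    congr 1
    push_cast
    ring
  have hsum : ∀ n, ∫ ω, Complex.exp ((R n ω : ℝ) * Complex.I) * ζ' ω ∂μ
      = Real.exp (-(∑ j ∈ Finset.range (2 ^ n),
          ((τ n (j + 1) : ℝ) - τ n j) * p (G n j) ^ 2) / 2) * ∫ ω, ζ' ω ∂μ := fun n =>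
    h.integral_exp_sum (G n) (hτm n)
      (by rw [show τ n 0 = s from gridTime_zero hT.le s _]; exact hζ'm) hζ'B _
  simp only [hsum] at hl
  refine tendsto_nhds_unique hl (Tendsto.mul_const _ ?_)
  exact ((by fun_prop : Continuous fun x : ℝ => ((Real.exp (-x / 2) : ℝ) : ℂ)).tendsto _).comp hr

end IsSolution

end OrnsteinUhlenbeck

/-! ### Finite-dimensional laws. -/

namespace OrnsteinUhlenbeck

variable {C : Type*} [AddCommGroup C] [Module ℝ C] [TopologicalSpace C]

theorem measurable_dual_eval (H : C) : Measurable fun y : WeakDual ℝ C => y H :=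
  measurable_iff_comap_le.2 (le_iSup_of_le (f := fun H : C =>
    MeasurableSpace.comap (fun y : WeakDual ℝ C => y H) Real.measurableSpace) H le_rfl)

variable [IsTopologicalAddGroup C] [ContinuousSMul ℝ C] {T : ℝ}
  {Ω : Type*} {mΩ : MeasurableSpace Ω}

theorem measurable_path_apply (t : Set.Icc (0 : ℝ) T) :
    Measurable fun y : DualPath T C => y t := by
  rw [measurable_iff_comap_le, dualCylinder, MeasurableSpace.comap_iSup]
  refine iSup_le fun H => ?_
  rw [MeasurableSpace.comap_comp]
  exact (measurable_path_eval t H).comap_le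

namespace IsSolution

variable {μ : Measure Ω} [IsProbabilityMeasure μ] {hT : 0 < T} {A : C →ₗ[ℝ] C}
  {P : ℝ≥0 → C →L[ℝ] C} {c : C → ℝ} {ν₀ : Measure (WeakDual ℝ C)} {Y : Ω → DualPath T C}

omit [IsProbabilityMeasure μ] in
theorem measurable_eval (h : IsSolution hT A c ν₀ μ Y) (t : Set.Icc (0 : ℝ) T) (H : C) :
    Measurable fun ω => Y ω t H := (measurable_path_eval t H).comp h.measurable

omit [IsProbabilityMeasure μ] in
theorem integral_exp_zero (h : IsSolution hT A c ν₀ μ Y) (θ : ℝ) (G : C) :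
    ∫ ω, Complex.exp ((θ * Y ω ⟨0, le_rfl, hT.le⟩ G : ℝ) * Complex.I) ∂μ
      = ∫ y : WeakDual ℝ C, Complex.exp ((θ * y G : ℝ) * Complex.I) ∂ν₀ := by
  have hm : Measurable fun ω => Y ω ⟨0, le_rfl, hT.le⟩ :=
    (measurable_path_apply _).comp h.measurable
  rw [← h.initial_law]
  refine Eq.symm (integral_map (f := fun y : WeakDual ℝ C =>
    Complex.exp ((θ * y G : ℝ) * Complex.I)) hm.aemeasurable ?_)
  exact ((by fun_prop : Continuous fun x : ℝ =>
    Complex.exp ((θ * x : ℝ) * Complex.I)).measurable.comp (measurable_dual_eval G)).aestronglyMeasurable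

/-- The form suited to induction over times: `X` collects observations from the past, and
homogeneity of `c` extracts the factor θ². -/
theorem integral_exp_add (h : IsSolution hT A c ν₀ μ Y) (hc_nonneg : ∀ H, 0 ≤ c H)
    (hc : Continuous c) (hhom : ∀ (a : ℝ) (H : C), c (a • H) = |a| * c H)
    (hP : IsSemigroupOf A P) {s t : Set.Icc (0 : ℝ) T} (hst : s ≤ t) (F : C) {X : Ω → ℝ}
    (hX : StronglyMeasurable[naturalFiltration Y h.measurable s] X) (θ : ℝ) :
    ∫ ω, Complex.exp ((θ * (Y ω t F + X ω) : ℝ) * Complex.I) ∂μ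
      = Real.exp (-(θ ^ 2 * ∫ u in (0 : ℝ)..(t - s), c (P u.toNNReal F) ^ 2) / 2)
        * ∫ ω, Complex.exp ((θ * (Y ω s (P (t - s : ℝ).toNNReal F) + X ω) : ℝ) * Complex.I) ∂μ := by
  have h1 := h.integral_exp_apply hc_nonneg hc hhom hP hst (θ • F)
    (stronglyMeasurable_cexp_mul_I (hX.const_mul θ)) (B := 1)
    (fun ω => (Complex.norm_exp_ofReal_mul_I _).le)
  have e : ∀ (τ : Set.Icc (0 : ℝ) T) (G : C) (ω : Ω),
      Complex.exp ((Y ω τ (θ • G) : ℝ) * Complex.I) * Complex.exp ((θ * X ω : ℝ) * Complex.I)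
        = Complex.exp ((θ * (Y ω τ G + X ω) : ℝ) * Complex.I) := fun τ G ω => by
    rw [← Complex.exp_add, map_smul, smul_eq_mul]
    congr 1
    push_cast
    ring
  simp only [map_smul (P _), e, hhom, mul_pow, sq_abs, intervalIntegral.integral_const_mul] at h1
  exact h1

/-- The latest observation is traded for P_{t-a}F at the preceding time `a`, where it merges with `H
a`, at the price of a Gaussian factor. The resulting `G` and `q` involve only the times, the test
vectors, `P` and `c`; treating both solutions at once records that they are common. -/
theorem exists_integral_exp_sum (h : IsSolution hT A c ν₀ μ Y) {Ω' : Type*}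
    {mΩ' : MeasurableSpace Ω'} {μ' : Measure Ω'} [IsProbabilityMeasure μ'] {Y' : Ω' → DualPath T C}
    (h' : IsSolution hT A c ν₀ μ' Y') (hc_nonneg : ∀ H, 0 ≤ c H)
    (hc : Continuous c) (hhom : ∀ (a : ℝ) (H : C), c (a • H) = |a| * c H)
    (hP : IsSemigroupOf A P) (S : Finset (Set.Icc (0 : ℝ) T)) (H : Set.Icc (0 : ℝ) T → C)
    (t : Set.Icc (0 : ℝ) T) (ht : ∀ x ∈ S, x ≤ t) (F : C) :
    ∃ (G : C) (q : ℝ), 0 ≤ q ∧ ∀ θ : ℝ,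
      ∫ ω, Complex.exp ((θ * (Y ω t F + ∑ x ∈ S, Y ω x (H x)) : ℝ) * Complex.I) ∂μ
        = Real.exp (-(θ ^ 2 * q) / 2)
          * ∫ y : WeakDual ℝ C, Complex.exp ((θ * y G : ℝ) * Complex.I) ∂ν₀ ∧
      ∫ ω, Complex.exp ((θ * (Y' ω t F + ∑ x ∈ S, Y' ω x (H x)) : ℝ) * Complex.I) ∂μ'
        = Real.exp (-(θ ^ 2 * q) / 2)
          * ∫ y : WeakDual ℝ C, Complex.exp ((θ * y G : ℝ) * Complex.I) ∂ν₀ := by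
  have hq : ∀ (s t : Set.Icc (0 : ℝ) T) (F : C), s ≤ t →
      0 ≤ ∫ u in (0 : ℝ)..(t - s), c (P u.toNNReal F) ^ 2 := fun s t F hst =>
    intervalIntegral.integral_nonneg (sub_nonneg.2 hst) fun u _ => sq_nonneg _
  induction S using Finset.induction_on_max generalizing t F with
  | empty =>
    have h0t : (⟨0, le_rfl, hT.le⟩ : Set.Icc (0 : ℝ) T) ≤ t := t.2.1
    refine ⟨P (t - (⟨0, le_rfl, hT.le⟩ : Set.Icc (0 : ℝ) T) : ℝ).toNNReal F, _, hq _ t F h0t,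
      fun θ => ⟨?_, ?_⟩⟩
    · simpa only [Finset.sum_empty, add_zero, h.integral_exp_zero] using
        h.integral_exp_add hc_nonneg hc hhom hP h0t F (X := fun _ => 0) stronglyMeasurable_const θ
    · simpa only [Finset.sum_empty, add_zero, h'.integral_exp_zero] using
        h'.integral_exp_add hc_nonneg hc hhom hP h0t F (X := fun _ => 0) stronglyMeasurable_const θ
  | insert a S hS ih =>
    have hat : a ≤ t := ht a (Finset.mem_insert_self a S)
    obtain ⟨G, q, hq0, hG⟩ := ih a (fun x hx => (hS x hx).le) (P (t - a : ℝ).toNNReal F + H a)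
    have haS : a ∉ S := fun ha => (hS a ha).false
    refine ⟨G, (∫ u in (0 : ℝ)..(t - a), c (P u.toNNReal F) ^ 2) + q,
      add_nonneg (hq a t F hat) hq0, fun θ => ?_⟩
    rw [mul_add, neg_add, add_div, Real.exp_add, Complex.ofReal_mul, mul_assoc]
    simp only [Finset.sum_insert haS]
    refine ⟨?_, ?_⟩
    · rw [← (hG θ).1, h.integral_exp_add hc_nonneg hc hhom hP hat F
        (X := fun ω => Y ω a (H a) + ∑ x ∈ S, Y ω x (H x))
        ((stronglyMeasurable_naturalFiltration h.measurable le_rfl _).add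
          (Finset.stronglyMeasurable_fun_sum _ fun x hx =>
            stronglyMeasurable_naturalFiltration h.measurable (hS x hx).le _)) θ]
      simp only [map_add, add_assoc]
    · rw [← (hG θ).2, h'.integral_exp_add hc_nonneg hc hhom hP hat F
        (X := fun ω => Y' ω a (H a) + ∑ x ∈ S, Y' ω x (H x))
        ((stronglyMeasurable_naturalFiltration h'.measurable le_rfl _).add
          (Finset.stronglyMeasurable_fun_sum _ fun x hx =>
            stronglyMeasurable_naturalFiltration h'.measurable (hS x hx).le _)) θ]
      simp only [map_add, add_assoc]

/-- The characteristic functions of the finite-dimensional laws of a solution are determined by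
the initial law. -/
theorem exists_charFun (h : IsSolution hT A c ν₀ μ Y) {Ω' : Type*}
    {mΩ' : MeasurableSpace Ω'} {μ' : Measure Ω'} [IsProbabilityMeasure μ'] {Y' : Ω' → DualPath T C}
    (h' : IsSolution hT A c ν₀ μ' Y') (hc_nonneg : ∀ H, 0 ≤ c H)
    (hc : Continuous c) (hhom : ∀ (a : ℝ) (H : C), c (a • H) = |a| * c H)
    (hP : IsSemigroupOf A P) {ι : Type*} [Fintype ι] (τ : ι → Set.Icc (0 : ℝ) T) (H : ι → C) :
    ∃ (G : C) (q : ℝ), 0 ≤ q ∧ ∀ θ : ℝ,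
      ∫ ω, Complex.exp ((θ * ∑ i, Y ω (τ i) (H i) : ℝ) * Complex.I) ∂μ
        = Real.exp (-(θ ^ 2 * q) / 2)
          * ∫ y : WeakDual ℝ C, Complex.exp ((θ * y G : ℝ) * Complex.I) ∂ν₀ ∧
      ∫ ω, Complex.exp ((θ * ∑ i, Y' ω (τ i) (H i) : ℝ) * Complex.I) ∂μ'
        = Real.exp (-(θ ^ 2 * q) / 2)
          * ∫ y : WeakDual ℝ C, Complex.exp ((θ * y G : ℝ) * Complex.I) ∂ν₀ := by
  classical
  -- Indices sharing a time are grouped into one test vector, and the extra final observation is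
  -- made void by taking it at time `T` with vector 0.
  obtain ⟨G, q, hq, hG⟩ := h.exists_integral_exp_sum h' hc_nonneg hc hhom hP
    (Finset.univ.image τ) (fun t => ∑ i with τ i = t, H i) ⟨T, hT.le, le_rfl⟩ (fun x _ => x.2.2) 0
  have e : ∀ y : DualPath T C, ∑ t ∈ Finset.univ.image τ, y t (∑ i with τ i = t, H i)
      = ∑ i, y (τ i) (H i) := fun y => by
    rw [← Finset.sum_fiberwise_of_maps_to (t := Finset.univ.image τ) (g := τ)
      fun i _ => Finset.mem_image_of_mem τ (Finset.mem_univ i)]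
    refine Finset.sum_congr rfl fun t _ => ?_
    rw [map_sum]
    refine Finset.sum_congr rfl fun i hi => ?_
    rw [(Finset.mem_filter.1 hi).2]
  simp only [map_zero, zero_add, e] at hG
  exact ⟨G, q, hq, hG⟩

end IsSolution

end OrnsteinUhlenbeck

/-! ### Uniqueness in law, Gaussianity and covariances. -/

namespace OrnsteinUhlenbeck

section GaussianReal

variable {Ω : Type*} {mΩ : MeasurableSpace Ω} {μ : Measure Ω} {X : Ω → ℝ} {V : ℝ}

theorem integral_exp_eq_charFun_map (hX : AEMeasurable X μ) (θ : ℝ) :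
    ∫ ω, Complex.exp ((θ * X ω : ℝ) * Complex.I) ∂μ = charFun (μ.map X) θ := by
  rw [charFun_apply_real, integral_map hX (by fun_prop)]
  simp

theorem map_eq_gaussianReal_of_integral_exp [IsFiniteMeasure μ] (hX : AEMeasurable X μ)
    (hV : 0 ≤ V) (h : ∀ θ : ℝ, ∫ ω, Complex.exp ((θ * X ω : ℝ) * Complex.I) ∂μ
      = Real.exp (-(θ ^ 2 * V) / 2)) : μ.map X = gaussianReal 0 V.toNNReal := by
  refine Measure.ext_of_charFun (funext fun θ => ?_)
  rw [← integral_exp_eq_charFun_map hX, h, charFun_gaussianReal, Real.coe_toNNReal V hV]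
  push_cast
  congr 1
  ring

theorem memLp_two_of_map_eq_gaussianReal (hX : AEMeasurable X μ) {v : ℝ≥0}
    (h : μ.map X = gaussianReal 0 v) : MemLp X 2 μ := by
  have := memLp_id_gaussianReal (μ := 0) (v := v) 2
  rw [← h] at this
  exact (memLp_map_measure_iff aestronglyMeasurable_id hX).1 this

theorem integral_of_map_eq_gaussianReal (hX : AEMeasurable X μ) {v : ℝ≥0}
    (h : μ.map X = gaussianReal 0 v) : ∫ ω, X ω ∂μ = 0 := by
  have := integral_map hX (f := fun x : ℝ => x) (by fun_prop)
  rw [← this, h, integral_id_gaussianReal]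

theorem integral_sq_of_map_eq_gaussianReal (hX : AEMeasurable X μ) (hV : 0 ≤ V)
    (h : μ.map X = gaussianReal 0 V.toNNReal) : ∫ ω, X ω ^ 2 ∂μ = V := by
  have h1 := integral_map hX (f := fun x : ℝ => x ^ 2) (by fun_prop)
  have h2 := variance_fun_id_gaussianReal (μ := 0) (v := V.toNNReal)
  rw [variance_eq_integral measurable_id'.aemeasurable] at h2
  simp only [integral_id_gaussianReal, sub_zero] at h2
  rw [← h1, h, h2, Real.coe_toNNReal V hV]

theorem four_mul_integral_mul {X Y : Ω → ℝ} (hX : Integrable (fun ω => (X ω + Y ω) ^ 2) μ)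
    (hY : Integrable (fun ω => (X ω - Y ω) ^ 2) μ) :
    ∫ ω, X ω * Y ω ∂μ = (∫ ω, (X ω + Y ω) ^ 2 ∂μ - ∫ ω, (X ω - Y ω) ^ 2 ∂μ) / 4 := by
  rw [← integral_sub hX hY, eq_div_iff four_ne_zero, ← integral_mul_const]
  congr 1 with ω
  ring

end GaussianReal

variable {C : Type*} [AddCommGroup C] [Module ℝ C] [TopologicalSpace C]

namespace IsCentredGaussianField

variable {𝔈 : C → C → ℝ} {ν₀ : Measure (WeakDual ℝ C)}

theorem variance_nonneg (h : IsCentredGaussianField 𝔈 ν₀) (G : C) : 0 ≤ 𝔈 G G := by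
  rw [← h.covariance]
  exact integral_nonneg fun y => mul_self_nonneg _

theorem map_eq_gaussianReal (h : IsCentredGaussianField 𝔈 ν₀) (G : C) :
    ν₀.map (fun y : WeakDual ℝ C => y G) = gaussianReal 0 (𝔈 G G).toNNReal := by
  rw [(h.gaussian.hasGaussianLaw_eval G).map_eq_gaussianReal, h.centred,
    variance_of_integral_eq_zero (measurable_dual_eval G).aemeasurable (h.centred G),
    ← h.covariance]
  simp only [sq]

theorem integral_exp (h : IsCentredGaussianField 𝔈 ν₀) (θ : ℝ) (G : C) :
    ∫ y : WeakDual ℝ C, Complex.exp ((θ * y G : ℝ) * Complex.I) ∂ν₀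
      = Real.exp (-(θ ^ 2 * 𝔈 G G) / 2) := by
  rw [integral_exp_eq_charFun_map (measurable_dual_eval G).aemeasurable, h.map_eq_gaussianReal,
    charFun_gaussianReal, Real.coe_toNNReal _ (h.variance_nonneg G)]
  push_cast
  congr 1
  ring

theorem polarization (h : IsCentredGaussianField 𝔈 ν₀) (H G : C) :
    𝔈 H G = (𝔈 (H + G) (H + G) - 𝔈 (H - G) (H - G)) / 4 := by
  have hi : ∀ F : C, Integrable (fun y : WeakDual ℝ C => y F ^ 2) ν₀ := fun F =>
    (memLp_two_of_map_eq_gaussianReal (measurable_dual_eval F).aemeasurable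
      (h.map_eq_gaussianReal F)).integrable_sq
  have h1 := hi (H + G)
  have h2 := hi (H - G)
  rw [← h.covariance, ← h.covariance, ← h.covariance]
  simp only [map_add, map_sub, ← sq] at h1 h2 ⊢
  exact four_mul_integral_mul h1 h2

end IsCentredGaussianField

/-- Scalars move into the test vectors, so characteristic functions of vectors of observations
reduce to those of sums of observations. -/
theorem dual_restrict_eq_sum {J : Type*} [DecidableEq J] (I : Finset J)
    (L : StrongDual ℝ (I → ℝ)) (x : J → WeakDual ℝ C) (H : J → C) : L (I.restrict fun j => x j (H j))
      = ∑ i : I, x i (L (Pi.single i 1) • H i) := by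
  have := LinearMap.pi_apply_eq_sum_univ (L : (I → ℝ) →ₗ[ℝ] ℝ) (I.restrict fun j => x j (H j))
  refine this.trans (Finset.sum_congr rfl fun i _ => ?_)
  rw [map_smul, smul_eq_mul, smul_eq_mul, mul_comm]
  congr 1
  refine congrArg L (funext fun j => ?_)
  simp [Pi.single_apply, eq_comm]

variable [IsTopologicalAddGroup C] [ContinuousSMul ℝ C] {T : ℝ}

namespace IsSolution

variable {Ω : Type*} {mΩ : MeasurableSpace Ω} {μ : Measure Ω} [IsProbabilityMeasure μ]
  {hT : 0 < T} {A : C →ₗ[ℝ] C} {P : ℝ≥0 → C →L[ℝ] C} {c : C → ℝ} {ν₀ : Measure (WeakDual ℝ C)}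
  {Y : Ω → DualPath T C}

omit [IsProbabilityMeasure μ] in
theorem measurable_restrict (h : IsSolution hT A c ν₀ μ Y) (I : Finset (Set.Icc (0 : ℝ) T × C)) :
    Measurable fun ω => I.restrict fun p => Y ω p.1 p.2 :=
  measurable_pi_lambda _ fun i => h.measurable_eval i.1.1 i.1.2

theorem map_restrict_eq (h : IsSolution hT A c ν₀ μ Y) {Ω' : Type*}
    {mΩ' : MeasurableSpace Ω'} {μ' : Measure Ω'} [IsProbabilityMeasure μ'] {Y' : Ω' → DualPath T C}
    (h' : IsSolution hT A c ν₀ μ' Y') (hc_nonneg : ∀ H, 0 ≤ c H)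
    (hc : Continuous c) (hhom : ∀ (a : ℝ) (H : C), c (a • H) = |a| * c H)
    (hP : IsSemigroupOf A P) (I : Finset (Set.Icc (0 : ℝ) T × C)) :
    μ.map (fun ω => I.restrict fun p => Y ω p.1 p.2)
      = μ'.map (fun ω => I.restrict fun p => Y' ω p.1 p.2) := by
  classical
  have := Measure.isFiniteMeasure_map μ (fun ω => I.restrict fun p => Y ω p.1 p.2)
  have := Measure.isFiniteMeasure_map μ' (fun ω => I.restrict fun p => Y' ω p.1 p.2)
  refine Measure.ext_of_charFunDual (funext fun L => ?_)
  obtain ⟨G, q, -, hG⟩ := h.exists_charFun h' hc_nonneg hc hhom hP (fun i : I => i.1.1)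
    (fun i : I => L (Pi.single i 1) • i.1.2)
  have h1 := (hG 1).1.trans (hG 1).2.symm
  rw [charFunDual_apply, charFunDual_apply,
    integral_map (h.measurable_restrict I).aemeasurable (by fun_prop),
    integral_map (h'.measurable_restrict I).aemeasurable (by fun_prop)]
  simp only [one_mul] at h1
  simpa only [dual_restrict_eq_sum I L (fun p => Y _ p.1) (fun p => p.2),
    dual_restrict_eq_sum I L (fun p => Y' _ p.1) (fun p => p.2)] using h1

/-- It lets equality of laws on the product space, which follows from the finite-dimensional laws,
descend to path space. -/
theorem pathCylinder_eq_comap : (pathCylinder T : MeasurableSpace (DualPath T C)) =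
    MeasurableSpace.comap (fun y (p : Set.Icc (0 : ℝ) T × C) => y p.1 p.2) MeasurableSpace.pi := by
  rw [MeasurableSpace.pi, MeasurableSpace.comap_iSup, iSup_prod]
  simp only [MeasurableSpace.comap_comp]
  rfl

/-- Uniqueness in law. -/
theorem map_eq (h : IsSolution hT A c ν₀ μ Y) {Ω' : Type*}
    {mΩ' : MeasurableSpace Ω'} {μ' : Measure Ω'} [IsProbabilityMeasure μ'] {Y' : Ω' → DualPath T C}
    (h' : IsSolution hT A c ν₀ μ' Y') (hc_nonneg : ∀ H, 0 ≤ c H)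
    (hc : Continuous c) (hhom : ∀ (a : ℝ) (H : C), c (a • H) = |a| * c H)
    (hP : IsSemigroupOf A P) : μ.map Y = μ'.map Y' := by
  set ev : DualPath T C → Set.Icc (0 : ℝ) T × C → ℝ := fun y p => y p.1 p.2 with hev
  have hm : Measurable fun ω => ev (Y ω) :=
    measurable_pi_lambda _ fun p => h.measurable_eval p.1 p.2
  have hm' : Measurable fun ω => ev (Y' ω) :=
    measurable_pi_lambda _ fun p => h'.measurable_eval p.1 p.2
  have h1 := isProjectiveLimit_map (X := fun (p : Set.Icc (0 : ℝ) T × C) ω => Y ω p.1 p.2) (P := μ)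
    hm.aemeasurable
  have h2 := isProjectiveLimit_map (X := fun (p : Set.Icc (0 : ℝ) T × C) ω => Y' ω p.1 p.2) (P := μ')
    hm'.aemeasurable
  simp only [h.map_restrict_eq h' hc_nonneg hc hhom hP] at h1
  have heq := h1.unique h2
  refine Measure.ext fun B hB => ?_
  rw [Measure.map_apply h.measurable hB, Measure.map_apply h'.measurable hB]
  rw [pathCylinder_eq_comap] at hB
  obtain ⟨B', hB', rfl⟩ := hB
  have h3 := congrArg (fun ρ => ρ B') heq
  rw [Measure.map_apply hm hB', Measure.map_apply hm' hB'] at h3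
  exact h3

section Gaussian

variable {𝔈 : C → C → ℝ}

theorem gaussian_finite_dimensional (h : IsSolution hT A c ν₀ μ Y) (hc_nonneg : ∀ H, 0 ≤ c H)
    (hc : Continuous c) (hhom : ∀ (a : ℝ) (H : C), c (a • H) = |a| * c H)
    (hP : IsSemigroupOf A P) (h𝔈 : IsCentredGaussianField 𝔈 ν₀) :
    IsGaussianProcess (fun (p : Set.Icc (0 : ℝ) T × C) (ω : Ω) => Y ω p.1 p.2) μ := by
  classical
  refine ⟨fun I => ⟨isGaussian_of_map_eq_gaussianReal fun L => ?_⟩⟩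
  -- The solution is compared with itself; only its own formula is used. The projection then has
  -- variance `q + 𝔈 G G`.
  obtain ⟨G, q, hq, hG⟩ := h.exists_charFun h hc_nonneg hc hhom hP (fun i : I => i.1.1)
    (fun i : I => L (Pi.single i 1) • i.1.2)
  refine ⟨0, (q + 𝔈 G G).toNNReal, ?_⟩
  have hm := h.measurable_restrict I
  rw [Measure.map_map L.continuous.measurable hm]
  refine map_eq_gaussianReal_of_integral_exp (L.continuous.measurable.comp hm).aemeasurable
    (add_nonneg hq (h𝔈.variance_nonneg G)) fun θ => ?_
  have h1 := (hG θ).1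
  rw [h𝔈.integral_exp, ← Complex.ofReal_mul, ← Real.exp_add] at h1
  simp only [Function.comp, dual_restrict_eq_sum I L (fun p => Y _ p.1) (fun p => p.2)]
  rw [h1]
  congr 2
  ring

/-- The conditional formula is applied from t to s, then from s to 0 with the vector P_{t-s}H + G.
Nonnegativity is recorded because `toNNReal` would otherwise truncate the variance. -/
theorem map_add_eq_gaussianReal (h : IsSolution hT A c ν₀ μ Y) (hc_nonneg : ∀ H, 0 ≤ c H)
    (hc : Continuous c) (hhom : ∀ (a : ℝ) (H : C), c (a • H) = |a| * c H)
    (hP : IsSemigroupOf A P) (h𝔈 : IsCentredGaussianField 𝔈 ν₀) {s t : Set.Icc (0 : ℝ) T}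
    (hst : s ≤ t) (H G : C) :
    0 ≤ (∫ u in (0 : ℝ)..(t - s), c (P u.toNNReal H) ^ 2)
      + (∫ r in (0 : ℝ)..s, c (P (t - r : ℝ).toNNReal H + P (s - r : ℝ).toNNReal G) ^ 2)
      + 𝔈 (P (t : ℝ).toNNReal H + P (s : ℝ).toNNReal G)
        (P (t : ℝ).toNNReal H + P (s : ℝ).toNNReal G) ∧
    μ.map (fun ω => Y ω t H + Y ω s G) = gaussianReal 0
      ((∫ u in (0 : ℝ)..(t - s), c (P u.toNNReal H) ^ 2)
      + (∫ r in (0 : ℝ)..s, c (P (t - r : ℝ).toNNReal H + P (s - r : ℝ).toNNReal G) ^ 2)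
      + 𝔈 (P (t : ℝ).toNNReal H + P (s : ℝ).toNNReal G)
        (P (t : ℝ).toNNReal H + P (s : ℝ).toNNReal G)).toNNReal := by
  have hst' : (0 : ℝ) ≤ t - s := sub_nonneg.2 hst
  have hV : 0 ≤ (∫ u in (0 : ℝ)..(t - s), c (P u.toNNReal H) ^ 2)
      + (∫ r in (0 : ℝ)..s, c (P (t - r : ℝ).toNNReal H + P (s - r : ℝ).toNNReal G) ^ 2)
      + 𝔈 (P (t : ℝ).toNNReal H + P (s : ℝ).toNNReal G)
        (P (t : ℝ).toNNReal H + P (s : ℝ).toNNReal G) :=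
    add_nonneg (add_nonneg (intervalIntegral.integral_nonneg hst' fun u _ => sq_nonneg _)
      (intervalIntegral.integral_nonneg s.2.1 fun u _ => sq_nonneg _)) (h𝔈.variance_nonneg _)
  refine ⟨hV, map_eq_gaussianReal_of_integral_exp
    ((h.measurable_eval t H).add (h.measurable_eval s G)).aemeasurable hV fun θ => ?_⟩
  have h0s : (⟨0, le_rfl, hT.le⟩ : Set.Icc (0 : ℝ) T) ≤ s := s.2.1
  have hPs : ∀ r : ℝ, r ≤ s → P (s - r : ℝ).toNNReal (P (t - s : ℝ).toNNReal H + G)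
      = P (t - r : ℝ).toNNReal H + P (s - r : ℝ).toNNReal G := fun r hr => by
    rw [map_add, ← ContinuousLinearMap.comp_apply, ← hP.add,
      ← Real.toNNReal_add (sub_nonneg.2 hr) hst']
    congr 4
    ring
  have h1 := h.integral_exp_add hc_nonneg hc hhom hP hst H (X := fun ω => Y ω s G)
    (stronglyMeasurable_naturalFiltration h.measurable le_rfl G) θ
  have h2 := h.integral_exp_add hc_nonneg hc hhom hP h0s (P (t - s : ℝ).toNNReal H + G)
    (X := fun _ => 0) stronglyMeasurable_const θ
  simp only [add_zero, h.integral_exp_zero, h𝔈.integral_exp, hPs 0 s.2.1] at h2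
  simp only [← map_add] at h1
  have h3 := intervalIntegral.integral_comp_sub_left (a := 0) (b := s)
    (fun u => c (P u.toNNReal (P (t - s : ℝ).toNNReal H + G)) ^ 2) (s : ℝ)
  rw [sub_zero, sub_self] at h3
  have h4 : ∫ r in (0 : ℝ)..s, c (P (s - r : ℝ).toNNReal (P (t - s : ℝ).toNNReal H + G)) ^ 2
      = ∫ r in (0 : ℝ)..s, c (P (t - r : ℝ).toNNReal H + P (s - r : ℝ).toNNReal G) ^ 2 := by
    refine intervalIntegral.integral_congr fun r hr => ?_
    rw [Set.uIcc_of_le s.2.1] at hr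
    simp only [hPs r hr.2]
  rw [h1, h2, sub_zero, ← h3, h4, sub_zero, ← Complex.ofReal_mul, ← Complex.ofReal_mul,
    ← Real.exp_add, ← Real.exp_add]
  congr 2
  ring

theorem integral_apply_eq_zero (h : IsSolution hT A c ν₀ μ Y) (hc_nonneg : ∀ H, 0 ≤ c H)
    (hc : Continuous c) (hhom : ∀ (a : ℝ) (H : C), c (a • H) = |a| * c H)
    (hP : IsSemigroupOf A P) (h𝔈 : IsCentredGaussianField 𝔈 ν₀) (t : Set.Icc (0 : ℝ) T) (H : C) :
    ∫ ω, Y ω t H ∂μ = 0 := by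
  have := (h.map_add_eq_gaussianReal hc_nonneg hc hhom hP h𝔈 (le_refl t) H 0).2
  simp only [map_zero, add_zero] at this
  exact integral_of_map_eq_gaussianReal (h.measurable_eval t H).aemeasurable this

/-- Polarization between `G` and `-G`: the noise from [s,t] contributes a variance depending on `H`
alone, which cancels. -/
theorem integral_mul (h : IsSolution hT A c ν₀ μ Y) (hc_nonneg : ∀ H, 0 ≤ c H)
    (hc : Continuous c) (hhom : ∀ (a : ℝ) (H : C), c (a • H) = |a| * c H)
    (hP : IsSemigroupOf A P) (h𝔈 : IsCentredGaussianField 𝔈 ν₀) {s t : Set.Icc (0 : ℝ) T}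
    (hst : s ≤ t) (H G : C) :
    ∫ ω, Y ω t H * Y ω s G ∂μ = 𝔈 (P (t : ℝ).toNNReal H) (P (s : ℝ).toNNReal G) +
      ∫ r in (0 : ℝ)..(s : ℝ), polar c (P ((t : ℝ) - r).toNNReal H) (P ((s : ℝ) - r).toNNReal G) := by
  have hm : ∀ G, AEMeasurable (fun ω => Y ω t H + Y ω s G) μ := fun G =>
    ((h.measurable_eval t H).add (h.measurable_eval s G)).aemeasurable
  obtain ⟨hV1, h1⟩ := h.map_add_eq_gaussianReal hc_nonneg hc hhom hP h𝔈 hst H G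
  obtain ⟨hV2, h2⟩ := h.map_add_eq_gaussianReal hc_nonneg hc hhom hP h𝔈 hst H (-G)
  have i1 := (memLp_two_of_map_eq_gaussianReal (hm G) h1).integrable_sq
  have i2 := (memLp_two_of_map_eq_gaussianReal (hm (-G)) h2).integrable_sq
  have e1 := integral_sq_of_map_eq_gaussianReal (hm G) hV1 h1
  have e2 := integral_sq_of_map_eq_gaussianReal (hm (-G)) hV2 h2
  simp only [map_neg, ← sub_eq_add_neg] at i2 e2
  have hcont : ∀ (b : ℝ) (F : C), Continuous fun r : ℝ => P (b - r).toNNReal F := fun b F =>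
    (hP.continuous_apply F).comp (continuous_real_toNNReal.comp (continuous_const.sub continuous_id))
  have j1 : IntervalIntegrable (fun r : ℝ => c (P (t - r : ℝ).toNNReal H
      + P (s - r : ℝ).toNNReal G) ^ 2) volume 0 s :=
    ((hc.comp ((hcont t H).add (hcont s G))).pow 2).intervalIntegrable _ _
  have j2 : IntervalIntegrable (fun r : ℝ => c (P (t - r : ℝ).toNNReal H
      - P (s - r : ℝ).toNNReal G) ^ 2) volume 0 s :=
    ((hc.comp ((hcont t H).sub (hcont s G))).pow 2).intervalIntegrable _ _
  simp only [polar]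
  rw [four_mul_integral_mul i1 i2, e1, e2, h𝔈.polarization (P (t : ℝ).toNNReal H),
    intervalIntegral.integral_div, intervalIntegral.integral_sub j1 j2]
  ring

/-- By the general formula, Y_t(H) and Y_s(P_{t-s}H) have the same covariance with Y_s(G). The
second covariance is read off from the law ν₀ of Y_s. -/
theorem integral_mul_of_stationary (h : IsSolution hT A c ν₀ μ Y) (hc_nonneg : ∀ H, 0 ≤ c H)
    (hc : Continuous c) (hhom : ∀ (a : ℝ) (H : C), c (a • H) = |a| * c H)
    (hP : IsSemigroupOf A P) (h𝔈 : IsCentredGaussianField 𝔈 ν₀)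
    (hstat : ∀ t : Set.Icc (0 : ℝ) T, μ.map (fun ω => Y ω t) = ν₀) {s t : Set.Icc (0 : ℝ) T}
    (hst : s ≤ t) (H G : C) :
    ∫ ω, Y ω t H * Y ω s G ∂μ = 𝔈 (P ((t : ℝ) - (s : ℝ)).toNNReal H) G := by
  have hst' : (0 : ℝ) ≤ t - s := sub_nonneg.2 hst
  have hPs : ∀ r : ℝ, r ≤ s → P (s - r : ℝ).toNNReal (P (t - s : ℝ).toNNReal H)
      = P (t - r : ℝ).toNNReal H := fun r hr => by
    rw [← ContinuousLinearMap.comp_apply, ← hP.add, ← Real.toNNReal_add (sub_nonneg.2 hr) hst']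
    congr 3
    ring
  have h1 : ∫ ω, Y ω t H * Y ω s G ∂μ = ∫ ω, Y ω s (P (t - s : ℝ).toNNReal H) * Y ω s G ∂μ := by
    rw [h.integral_mul hc_nonneg hc hhom hP h𝔈 hst, h.integral_mul hc_nonneg hc hhom hP h𝔈 le_rfl]
    have h0 := hPs 0 s.2.1
    rw [sub_zero, sub_zero] at h0
    rw [h0]
    congr 1
    refine intervalIntegral.integral_congr fun r hr => ?_
    rw [Set.uIcc_of_le s.2.1] at hr
    simp only [hPs r hr.2]
  have hm : Measurable fun ω => Y ω s := (measurable_path_apply s).comp h.measurable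
  have h2 := integral_map (μ := μ) hm.aemeasurable
    (f := fun y : WeakDual ℝ C => y (P (t - s : ℝ).toNNReal H) * y G)
    ((measurable_dual_eval _).mul (measurable_dual_eval _)).aestronglyMeasurable
  rw [h1, ← h2, hstat s, h𝔈.covariance]

end Gaussian

end IsSolution

end OrnsteinUhlenbeck
theorem mainTheorem3 {C : Type*} [AddCommGroup C] [Module ℝ C] [TopologicalSpace C]
    [IsTopologicalAddGroup C] [ContinuousSMul ℝ C]
    (T : ℝ) (hT : 0 < T)
    (A : C →ₗ[ℝ] C)
    (c : C → ℝ) (hc_nonneg : ∀ H : C, 0 ≤ c H) (hc_cont : Continuous c)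
    (hc_hom : ∀ (a : ℝ) (H : C), c (a • H) = |a| * c H)
    (P : ℝ≥0 → C →L[ℝ] C) (hP : OrnsteinUhlenbeck.IsSemigroupOf A P)
    (ν₀ : Measure (WeakDual ℝ C)) :
    -- uniqueness in law
    (∀ (Ω : Type*) [MeasurableSpace Ω] (μ : Measure Ω) [IsProbabilityMeasure μ]
        (Y : Ω → OrnsteinUhlenbeck.DualPath T C)
        (Ω' : Type*) [MeasurableSpace Ω'] (μ' : Measure Ω') [IsProbabilityMeasure μ']
        (Y' : Ω' → OrnsteinUhlenbeck.DualPath T C),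
        OrnsteinUhlenbeck.IsSolution hT A c ν₀ μ Y →
        OrnsteinUhlenbeck.IsSolution hT A c ν₀ μ' Y' →
        μ.map Y = μ'.map Y') ∧
    -- centred Gaussian initial conditions
    (∀ 𝔈 : C → C → ℝ, OrnsteinUhlenbeck.IsCentredGaussianField 𝔈 ν₀ →
      ∀ (Ω : Type*) [MeasurableSpace Ω] (μ : Measure Ω) [IsProbabilityMeasure μ]
        (Y : Ω → OrnsteinUhlenbeck.DualPath T C),
        OrnsteinUhlenbeck.IsSolution hT A c ν₀ μ Y →
        IsGaussianProcess (fun (p : Set.Icc (0 : ℝ) T × C) (ω : Ω) => Y ω p.1 p.2) μ ∧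
        (∀ (t : Set.Icc (0 : ℝ) T) (H : C), ∫ ω, Y ω t H ∂μ = 0) ∧
        (∀ s t : Set.Icc (0 : ℝ) T, s ≤ t → ∀ H G : C,
          ∫ ω, Y ω t H * Y ω s G ∂μ =
            𝔈 (P (t : ℝ).toNNReal H) (P (s : ℝ).toNNReal G) +
              ∫ r in (0 : ℝ)..(s : ℝ), OrnsteinUhlenbeck.polar c
                (P ((t : ℝ) - r).toNNReal H) (P ((s : ℝ) - r).toNNReal G)) ∧
        ((∀ t : Set.Icc (0 : ℝ) T, μ.map (fun ω => Y ω t) = ν₀) →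
          ∀ s t : Set.Icc (0 : ℝ) T, s ≤ t → ∀ H G : C,
            ∫ ω, Y ω t H * Y ω s G ∂μ = 𝔈 (P ((t : ℝ) - (s : ℝ)).toNNReal H) G)) := by
  refine ⟨fun Ω _ μ _ Y Ω' _ μ' _ Y' h h' => h.map_eq h' hc_nonneg hc_cont hc_hom hP,
    fun 𝔈 h𝔈 Ω _ μ _ Y h => ⟨h.gaussian_finite_dimensional hc_nonneg hc_cont hc_hom hP h𝔈,
      h.integral_apply_eq_zero hc_nonneg hc_cont hc_hom hP h𝔈,
      fun s t hst => h.integral_mul hc_nonneg hc_cont hc_hom hP h𝔈 hst,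
      fun hstat s t hst => h.integral_mul_of_stationary hc_nonneg hc_cont hc_hom hP h𝔈 hstat hst⟩⟩
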